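/- Proposition (Morawetz-type inequality). There is an absolute constant $C$ with the following property. Let $3\le p<5$, $\kappa\ge 0$, $t_0\in\mathbb R$, $T_+\in(0,\infty]$, and let $\phi:\mathbb R^3\to\mathbb R$ be a differentiable function such that $$0\le\phi(x)\le 1,\qquad (p-1)\phi(x)-x\cdot\nabla\phi(x)\ge 0\qquad\text{for all }x\in\mathbb R^3 .$$ Let $v$ be a (real-valued) solution in the time interval $I=[t_0,t_0+T_+)$ of the Cauchy problem $$\partial_t^2 v-\Delta v=-\phi(x)e^{-\kappa t}|v|^{p-1}v,\qquad v(\cdot,t_0)=v_0\in\dot H^1(\mathbb R^3)\cap L^{p+1}(\mathbb R^3;\phi(x)dx),\qquad v_t(\cdot,t_0)=v_1\in L^2(\mathbb R^3),$$ that is: $(v,v_t)\in C(I;\dot H^1\times L^2(\mathbb R^3))$; the norm $\|v\|_{L^{2p/(p-3)}L^{2p}(J\times\mathbb R^3)}$ is finite for every bounded closed interval $J\subseteq I$ (with $2p/(p-3)=\infty$ if $p=3$); and for all $t\in I$ $$v(\cdot,t)=\cos((t-t_0)\sqrt{-\Delta})\,v_0+\frac{\sin((t-t_0)\sqrt{-\Delta})}{\sqrt{-\Delta}}\,v_1-\int_{t_0}^t\frac{\sin((t-\tau)\sqrt{-\Delta})}{\sqrt{-\Delta}}\Big[\phi\,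 e^{-\kappa\tau}|v(\cdot,\tau)|^{p-1}v(\cdot,\tau)\Big]d\tau .$$ Suppose that the energy at time $t_0$ is finite, where $$E(t)=\int_{\mathbb R^3}\Big[\tfrac12|\nabla v(x,t)|^2+\tfrac12|v_t(x,t)|^2+e^{-\kappa t}\phi(x)\frac{|v(x,t)|^{p+1}}{p+1}\Big]dx .$$ Then $$\int_{t_0}^{t_0+T_+}\!\!\int_{\mathbb R^3}e^{-\kappa t}\,\frac{(p-1)\phi(x)-x\cdot\nabla\phi(x)}{|x|}\,|v(x,t)|^{p+1}\,dx\,dt\le C\,E(t_0).$$ -/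

import Mathlib

open MeasureTheory Set Filter Topology
open scoped ENNReal NNReal ContDiff SchwartzMap FourierTransform

namespace WaveMorawetz

noncomputable section

/-- Three-dimensional Euclidean space. -/
abbrev E3 : Type := EuclideanSpace ℝ (Fin 3)

/-- `g` is the weak gradient of `f`:
`∫ f ∂_y ψ = - ∫ (g · y) ψ` for every direction `y` and every test function `ψ`. -/
def IsWeakGradient (f : E3 → ℝ) (g : E3 → E3) : Prop :=
  LocallyIntegrable f volume ∧ LocallyIntegrable g volume ∧
    ∀ ψ : E3 → ℝ, ContDiff ℝ ∞ ψ → HasCompactSupport ψ → ∀ y : E3,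
      ∫ x, f x * fderiv ℝ ψ x y = - ∫ x, inner ℝ (g x) y * ψ x

/-- The homogeneous Sobolev space `Ḣ¹(ℝ³)`, realised as the space of all functions in `L⁶(ℝ³)`
whose weak gradient is square integrable. -/
def MemHDot1 (f : E3 → ℝ) : Prop :=
  MemLp f 6 volume ∧ ∃ g : E3 → E3, MemLp g 2 volume ∧ IsWeakGradient f g

open scoped Classical in
/-- The square integrable weak gradient of `f` (unique up to null sets), when it exists. -/
def weakGrad (f : E3 → ℝ) : E3 → E3 :=
  if h : ∃ g : E3 → E3, MemLp g 2 volume ∧ IsWeakGradient f g then h.choose else 0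

/-- The pairing `∫ f g dx` of a real function `f` with a complex function `g`. -/
def pairing (f : E3 → ℝ) (g : E3 → ℂ) : ℂ := ∫ x, (f x : ℂ) * g x

/-- The operator `cos (t √-Δ)` on Schwartz functions, as a Fourier multiplier.
With the Fourier transform `𝓕 ψ ξ = ∫ exp (-2 π i x · ξ) ψ x dx`, the symbol of `√-Δ`
is `2 π |ξ|`. -/
def cosProp (t : ℝ) (ψ : 𝓢(E3, ℂ)) : E3 → ℂ :=
  𝓕⁻ (fun ξ : E3 => ((Real.cos (t * (2 * Real.pi * ‖ξ‖)) : ℝ) : ℂ) * 𝓕 (ψ : E3 → ℂ) ξ)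

/-- The operator `sin (t √-Δ) / √-Δ` on Schwartz functions, as a Fourier multiplier; its symbol is
`t * sinc (2 π t |ξ|)`, that is `sin (2 π t |ξ|) / (2 π |ξ|)`, with value `t` at `ξ = 0`. -/
def sinProp (t : ℝ) (ψ : 𝓢(E3, ℂ)) : E3 → ℂ :=
  𝓕⁻ (fun ξ : E3 => ((t * Real.sinc (t * (2 * Real.pi * ‖ξ‖)) : ℝ) : ℂ) * 𝓕 (ψ : E3 → ℂ) ξ)

/-- The tempered distribution `(sin (t √-Δ) / √-Δ) f`. The symbol is even,
so the multiplier is moved to the test function. -/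
def sinEvolution (t : ℝ) (f : E3 → ℝ) (ψ : 𝓢(E3, ℂ)) : ℂ := pairing f (sinProp t ψ)

/-- The free wave evolution `cos (t √-Δ) u₀ + (sin (t √-Δ) / √-Δ) u₁`, as a tempered
distribution. -/
def freeWave (t : ℝ) (u₀ u₁ : E3 → ℝ) (ψ : 𝓢(E3, ℂ)) : ℂ :=
  pairing u₀ (cosProp t ψ) + sinEvolution t u₁ ψ

/-- The nonlinearity `G(x, t, v) = - φ(x) exp (-κ t) |v| ^ (p - 1) v` along a function `v`. -/
def nonlinearity (φ : E3 → ℝ) (κ p : ℝ) (v : ℝ → E3 → ℝ) (t : ℝ) (x : E3) : ℝ :=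
  -(φ x * Real.exp (-κ * t) * |v t x| ^ (p - 1) * v t x)

/-- The mixed norm of `L^q (J; L^r (ℝ³))`. -/
def mixedNorm (q r : ℝ≥0∞) (J : Set ℝ) (v : ℝ → E3 → ℝ) : ℝ≥0∞ :=
  eLpNorm (fun t => eLpNorm (v t) r volume) q (volume.restrict J)

/-- `v`, with velocity `w = ∂ₜ v`, is a solution on the time interval `I ∋ t₀` of
`∂ₜ² v - Δ v = - φ exp (-κ t) |v| ^ (p - 1) v` with initial data
`v(t₀) = v₀ ∈ Ḣ¹ ∩ L^(p+1)(φ dx)` and `∂ₜ v(t₀) = v₁ ∈ L²`. -/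
structure IsSolution (φ : E3 → ℝ) (κ p t₀ : ℝ) (I : Set ℝ) (v₀ v₁ : E3 → ℝ)
    (v w : ℝ → E3 → ℝ) : Prop where
  mem_interval : t₀ ∈ I
  data_hDot1 : MemHDot1 v₀
  data_weighted : ∫⁻ x, ENNReal.ofReal (φ x * |v₀ x| ^ (p + 1)) < ⊤
  data_velocity : MemLp v₁ 2 volume
  initial : v t₀ =ᵐ[volume] v₀
  initial_velocity : w t₀ =ᵐ[volume] v₁
  mem_hDot1 : ∀ t ∈ I, MemHDot1 (v t)
  mem_velocity : ∀ t ∈ I, MemLp (w t) 2 volume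
  /-- `w` is the time derivative of `v` in the sense of distributions. -/
  velocity : ∀ ψ : 𝓢(E3, ℂ), ∀ t ∈ I,
    HasDerivWithinAt (fun s => pairing (v s) ψ) (pairing (w t) ψ) I t
  continuous_hDot1 : ∀ t ∈ I,
    Tendsto (fun s => eLpNorm (weakGrad (v s - v t)) 2 volume) (𝓝[I] t) (𝓝 0)
  continuous_velocity : ∀ t ∈ I,
    Tendsto (fun s => eLpNorm (w s - w t) 2 volume) (𝓝[I] t) (𝓝 0)
  /-- The norm of `L^(2p/(p-3)) L^(2p)` is finite on bounded closed intervals;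
  the time exponent is `∞` when `p = 3`. -/
  strichartz : ∀ a b : ℝ, Icc a b ⊆ I →
    mixedNorm (ENNReal.ofReal (2 * p) / ENNReal.ofReal (p - 3)) (ENNReal.ofReal (2 * p))
      (Icc a b) v < ⊤
  /-- The integral equation, as an identity of tempered distributions. -/
  duhamel : ∀ t ∈ I, ∀ ψ : 𝓢(E3, ℂ),
    pairing (v t) ψ = freeWave (t - t₀) v₀ v₁ ψ +
      ∫ τ in t₀..t, sinEvolution (t - τ) (nonlinearity φ κ p v τ) ψ

/-- The energy of the state `(u, u')` at time `t`. -/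
def energy (φ : E3 → ℝ) (κ p t : ℝ) (u u' : E3 → ℝ) : ℝ≥0∞ :=
  ∫⁻ x, ENNReal.ofReal (1 / 2 * ‖weakGrad u x‖ ^ 2 + 1 / 2 * |u' x| ^ 2 +
    Real.exp (-κ * t) * φ x * (|u x| ^ (p + 1) / (p + 1)))

/-- The interval `[t₀, t₀ + T)`, where `T` may be infinite. -/
def forwardInterval (t₀ : ℝ) (T : ℝ≥0∞) : Set ℝ :=
  {t | t₀ ≤ t ∧ ENNReal.ofReal (t - t₀) < T}

end

end WaveMorawetz

/-!
The estimate comes from testing the equation with the Morawetz multiplier `∂ᵣv + v / |x|`, that is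
with `∇a · ∇v + (Δa / 2) v` for `a = |x|`. This operator is antisymmetric, so the time derivative of
`∫ vₜ (∂ᵣv + v / |x|)` is the sum of a contribution of `Δv`, which is nonpositive because `a` is
convex and `Δ²a ≤ 0`, and of a contribution of the nonlinearity. With the regularised weight
`a = √(|x|² + δ²)` the sign of the first one is `integral_laplacian_mul_mop_nonpos`, which rests on
the pointwise computation `morawetz_algebra`. After integration in time the contribution of the
nonlinearity is bounded by the boundary terms, these are at most `4` times the kinetic energy by
Hardy's inequality (`abs_integral_mul_mop_le`), and the kinetic energy is bounded by the initial
energy: since `κ ≥ 0`, the potential decreases in time and the energy does not increase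
(`IsSolution.kinetic_le`). This gives `8 E(t₀)`.

It remains to bound the weighted density by `p + 1 ≤ 6` times the contribution of the nonlinearity
at a fixed time. Formally this is the integration by parts
`(p + 1) ∫ φ |v|ᵖ⁻¹ v (∂ᵣv + v / |x|) = ∫ ((p - 1) φ - x · ∇φ) |v|ᵖ⁺¹ / |x|`. As `φ` is only
differentiable, its gradient need not be locally integrable, and scaling is used instead: the
hypothesis on `φ` says that `μ ↦ μᵖ⁻¹ φ(x / μ)` is nondecreasing, so the difference quotients of
`∫ μᵖ⁻¹ φ(x / μ) |f|ᵖ⁺¹ / |x|` at `μ = 1` have a nonnegative integrand. A change of variables turns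
this integral into `∫ φ |f_μ|ᵖ⁺¹ / |x|` with `f_μ(x) = μ f(μ x)`, and `|f|ᵖ⁺¹ - |f_μ|ᵖ⁺¹` is bounded
by convexity. Fatou's lemma then gives `lintegral_weight_le_of_isTest`, and density gives
`lintegral_weight_le`. The resulting constant is `6 · 8 = 48`, uniformly in the time interval, and
monotone convergence covers the half-open interval.

To justify the computations for solutions of the integral equation, Kirchhoff's formula is used to
show that the wave propagators map Schwartz functions to functions of size `(1 + |x|)⁻⁴`
(`exists_sinProp_bound`, `exists_cosProp_bound`). All pairings then make sense and may be
differentiated in time, and the integral equation implies the wave equation in the sense of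
distributions (`weak_form_of_duhamel`). Mollification in space turns it into an equation which holds
pointwise in `x` and in integrated form in `t` (`moll_eq_of_duhamel`). Since `p < 5`, the exponent
`2p / (p - 3)` exceeds `p`, so the assumed space-time norm puts the nonlinearity in `L¹ L²`
(`IsSolution.isLinearSolution`), and the identities for the mollified solution pass to the limit in
the structure `IsLinearSolution` (`IsLinearSolution.energy_identity`, `IsLinearSolution.morawetz`).
The change of the potential energy is computed in the same way, localised in space at first
(`IsSolution.potential_energy`).
-/

open scoped Laplacian

namespace WaveMorawetz

noncomputable section

/-! ### Test functions and mollification -/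

/-- A test function: smooth with compact support. -/
def IsTest (k : E3 → ℝ) : Prop := ContDiff ℝ ∞ k ∧ HasCompactSupport k

/-- The `j`-th standard basis vector of `ℝ³`. -/
def ej (j : Fin 3) : E3 := EuclideanSpace.single j 1

/-- The `j`-th partial derivative. -/
def pd (j : Fin 3) (f : E3 → ℝ) (x : E3) : ℝ := fderiv ℝ f x (ej j)

/-- The convolution `k * f`. -/
def moll (k f : E3 → ℝ) : E3 → ℝ :=
  MeasureTheory.convolution k f (ContinuousLinearMap.lsmul ℝ ℝ) volume

lemma IsTest.continuous {k : E3 → ℝ} (hk : IsTest k) : Continuous k := hk.1.continuous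

lemma IsTest.differentiable {k : E3 → ℝ} (hk : IsTest k) : Differentiable ℝ k :=
  hk.1.differentiable (by simp)

lemma IsTest.integrable {k : E3 → ℝ} (hk : IsTest k) : Integrable k :=
  hk.continuous.integrable_of_hasCompactSupport hk.2

lemma contDiff_pd {k : E3 → ℝ} (hk : ContDiff ℝ ∞ k) (j : Fin 3) : ContDiff ℝ ∞ (pd j k) :=
  (hk.fderiv_right (m := ∞) (by simp)).clm_apply contDiff_const

lemma IsTest.pd {k : E3 → ℝ} (hk : IsTest k) (j : Fin 3) : IsTest (pd j k) := by
  refine ⟨contDiff_pd hk.1 j, ?_⟩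
  refine (hk.2.fderiv (𝕜 := ℝ)).mono' ?_
  intro x hx
  by_contra h
  apply hx
  have : fderiv ℝ k x = 0 := by
    by_contra h'
    exact h (subset_tsupport _ h')
  simp [WaveMorawetz.pd, this]

/-- The test function `y ↦ k (x - y)`. -/
lemma IsTest.comp_sub {k : E3 → ℝ} (hk : IsTest k) (x : E3) : IsTest (fun y => k (x - y)) := by
  refine ⟨hk.1.comp (contDiff_const.sub contDiff_id), ?_⟩
  exact hk.2.comp_homeomorph (Homeomorph.subLeft x)

lemma moll_eq (k f : E3 → ℝ) (x : E3) : moll k f x = ∫ y, k (x - y) * f y := by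
  simp [moll, MeasureTheory.convolution_lsmul_swap]

lemma moll_eq' (k f : E3 → ℝ) (x : E3) : moll k f x = ∫ y, k y * f (x - y) := by
  simp [moll, MeasureTheory.convolution_lsmul]

lemma pd_comp_sub {k : E3 → ℝ} (hk : IsTest k) (x y : E3) (j : Fin 3) :
    pd j (fun y => k (x - y)) y = - pd j k (x - y) := by
  have h : HasFDerivAt (fun y => k (x - y))
      ((fderiv ℝ k (x - y)).comp (-(ContinuousLinearMap.id ℝ E3))) y :=
    (hk.differentiable (x - y)).hasFDerivAt.comp y ((hasFDerivAt_id y).const_sub x)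
  simp [pd, h.fderiv]

lemma contDiff_moll {k f : E3 → ℝ} (hk : IsTest k) (hf : LocallyIntegrable f) :
    ContDiff ℝ ∞ (moll k f) :=
  hk.2.contDiff_convolution_left _ hk.1 hf

lemma moll_congr {k f g : E3 → ℝ} (h : f =ᵐ[volume] g) : moll k f = moll k g := by
  ext x
  rw [moll_eq, moll_eq]
  apply integral_congr_ae
  filter_upwards [h] with y hy
  rw [hy]

lemma IsTest.integrable_mul {k f : E3 → ℝ} (hk : IsTest k) (hf : LocallyIntegrable f) :
    Integrable (fun y => k y * f y) := by
  have := hf.integrable_smul_left_of_hasCompactSupport hk.continuous hk.2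
  simpa using this

lemma pd_moll {k f : E3 → ℝ} (hk : IsTest k) (hf : LocallyIntegrable f) (j : Fin 3) :
    pd j (moll k f) = moll (pd j k) f := by
  ext x
  have h := hk.2.hasFDerivAt_convolution_left (ContinuousLinearMap.lsmul ℝ ℝ)
    (hk.1.of_le (by simp)) hf x
  rw [moll_eq, pd, moll, h.fderiv, MeasureTheory.convolution_eq_swap,
    ContinuousLinearMap.integral_apply]
  · simp [pd, ContinuousLinearMap.precompL]
  · have h2 : HasCompactSupport (fderiv ℝ k) := hk.2.fderiv (𝕜 := ℝ)
    have h3 : Continuous (fderiv ℝ k) := hk.1.continuous_fderiv (by simp)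
    have := (h2.convolutionExists_left ((ContinuousLinearMap.lsmul ℝ ℝ).precompL E3)
      (h3) hf x).integrable_swap
    exact this

lemma moll_sub {k f g : E3 → ℝ} (hk : IsTest k) (hf : LocallyIntegrable f)
    (hg : LocallyIntegrable g) : moll k (f - g) = moll k f - moll k g := by
  ext x
  simp only [moll_eq, Pi.sub_apply]
  rw [← integral_sub ((hk.comp_sub x).integrable_mul hf) ((hk.comp_sub x).integrable_mul hg)]
  simp [mul_sub]

/-- Young's inequality `‖k * f‖_q ≤ ‖k‖_1 ‖f‖_q`, by Jensen's inequality for the finite measure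
`|k| dx`. -/
lemma eLpNorm_moll_le {k f : E3 → ℝ} (hk : Integrable k) {q : ℝ≥0∞}
    (hq1 : 1 ≤ q) (hq : q ≠ ⊤) (hf : AEStronglyMeasurable f volume) :
    eLpNorm (moll k f) q volume ≤ (∫⁻ x, ‖k x‖ₑ) * eLpNorm f q volume := by
  wlog hfm : StronglyMeasurable f generalizing f
  · rw [moll_congr hf.ae_eq_mk, eLpNorm_congr_ae hf.ae_eq_mk]
    exact this hf.stronglyMeasurable_mk.aestronglyMeasurable hf.stronglyMeasurable_mk
  have hq0 : q ≠ 0 := (zero_lt_one.trans_le hq1).ne'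
  set r := q.toReal with hr
  have hr1 : 1 ≤ r := by
    have := (ENNReal.toReal_le_toReal ENNReal.one_ne_top hq).2 hq1
    simpa using this
  have hr0 : 0 < r := by linarith
  set A := ∫⁻ x, ‖k x‖ₑ with hA
  have hAtop : A ≠ ⊤ := hk.2.ne
  -- Jensen's inequality for `ν = |k| dx`, then invariance of Lebesgue measure under translations
  set ν : Measure E3 := (volume : Measure E3).withDensity (fun x => ‖k x‖ₑ) with hν
  have hkm : AEMeasurable (fun x => ‖k x‖ₑ) (volume : Measure E3) := hk.1.enorm
  have hνu : ν univ = A := by simp [hν, hA]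
  have : IsFiniteMeasure ν := ⟨by rw [hνu]; exact hAtop.lt_top⟩
  have hshift : ∀ x : E3, StronglyMeasurable (fun y => f (x - y)) := fun x =>
    hfm.comp_measurable (by fun_prop)
  have key : ∀ x, ‖moll k f x‖ₑ ^ r ≤ A ^ (r - 1) * ∫⁻ y, ‖f (x - y)‖ₑ ^ r ∂ν := by
    intro x
    have h1 : ‖moll k f x‖ₑ ≤ ∫⁻ y, ‖f (x - y)‖ₑ ∂ν := by
      rw [moll_eq', hν, lintegral_withDensity_eq_lintegral_mul₀ hkm (hshift x).enorm.aemeasurable]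
      refine (enorm_integral_le_lintegral_enorm _).trans (le_of_eq ?_)
      simp [enorm_mul]
    have h2 := eLpNorm'_le_eLpNorm'_mul_rpow_measure_univ (μ := ν) zero_lt_one hr1
      (hshift x).aestronglyMeasurable
    simp only [eLpNorm', hνu, ENNReal.rpow_one, div_one] at h2
    calc ‖moll k f x‖ₑ ^ r ≤ ((∫⁻ y, ‖f (x - y)‖ₑ ^ r ∂ν) ^ (1 / r) * A ^ (1 - 1 / r)) ^ r :=
          ENNReal.rpow_le_rpow (h1.trans h2) hr0.le
      _ = A ^ (r - 1) * ∫⁻ y, ‖f (x - y)‖ₑ ^ r ∂ν := by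
          rw [ENNReal.mul_rpow_of_nonneg _ _ hr0.le, ← ENNReal.rpow_mul, ← ENNReal.rpow_mul,
            one_div_mul_cancel hr0.ne', ENNReal.rpow_one, mul_comm]
          congr 2
          field_simp
  have hmeas : Measurable (fun z : E3 × E3 => ‖f (z.1 - z.2)‖ₑ ^ r) :=
    ((hfm.comp_measurable (measurable_fst.sub measurable_snd)).enorm).pow_const r
  have h3 : ∫⁻ x, ‖moll k f x‖ₑ ^ r ≤ A ^ r * ∫⁻ x, ‖f x‖ₑ ^ r := by
    calc ∫⁻ x, ‖moll k f x‖ₑ ^ r ≤ ∫⁻ x, A ^ (r - 1) * ∫⁻ y, ‖f (x - y)‖ₑ ^ r ∂ν :=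
          lintegral_mono key
      _ = A ^ (r - 1) * ∫⁻ x, ∫⁻ y, ‖f (x - y)‖ₑ ^ r ∂ν :=
          lintegral_const_mul' _ _ (ENNReal.rpow_ne_top_of_nonneg (by linarith) hAtop)
      _ = A ^ (r - 1) * ∫⁻ y, ∫⁻ x, ‖f (x - y)‖ₑ ^ r ∂volume ∂ν := by
          rw [lintegral_lintegral_swap hmeas.aemeasurable]
      _ = A ^ (r - 1) * (A * ∫⁻ x, ‖f x‖ₑ ^ r) := by
          congr 1
          have : ∀ y : E3, ∫⁻ x, ‖f (x - y)‖ₑ ^ r = ∫⁻ x, ‖f x‖ₑ ^ r := fun y =>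
            lintegral_sub_right_eq_self (fun x => ‖f x‖ₑ ^ r) y
          simp [this, hνu, mul_comm]
      _ = A ^ r * ∫⁻ x, ‖f x‖ₑ ^ r := by
          rw [← mul_assoc]
          congr 1
          nth_rewrite 2 [← ENNReal.rpow_one A]
          rw [← ENNReal.rpow_add_of_nonneg _ _ (by linarith) zero_le_one]
          congr 1
          ring
  rw [eLpNorm_eq_lintegral_rpow_enorm_toReal hq0 hq, eLpNorm_eq_lintegral_rpow_enorm_toReal hq0 hq]
  calc _ ≤ (A ^ r * ∫⁻ x, ‖f x‖ₑ ^ r) ^ (1 / r) := ENNReal.rpow_le_rpow h3 (by positivity)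
    _ = _ := by
      rw [ENNReal.mul_rpow_of_nonneg _ _ (by positivity), ← ENNReal.rpow_mul,
        mul_one_div_cancel hr0.ne', ENNReal.rpow_one]

/-- The bump functions underlying the standard mollifiers; the support has radius `1 / (n + 1)`. -/
def rhoBump (n : ℕ) : ContDiffBump (0 : E3) where
  rIn := 1 / (2 * (n + 1))
  rOut := 1 / (n + 1)
  rIn_pos := by positivity
  rIn_lt_rOut := by
    apply one_div_lt_one_div_of_lt <;> linarith [show (0 : ℝ) ≤ n from Nat.cast_nonneg n]

/-- The standard mollifiers. -/
def rho (n : ℕ) : E3 → ℝ := (rhoBump n).normed volume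

lemma isTest_rho (n : ℕ) : IsTest (rho n) :=
  ⟨(rhoBump n).contDiff_normed, (rhoBump n).hasCompactSupport_normed⟩

lemma lintegral_rho (n : ℕ) : ∫⁻ x, ‖rho n x‖ₑ = 1 := by
  have h1 := (rhoBump n).integral_normed (μ := (volume : Measure E3))
  have h2 : ∀ x, 0 ≤ rho n x := (rhoBump n).nonneg_normed
  have h3 := ofReal_integral_eq_lintegral_ofReal (isTest_rho n).integrable (ae_of_all _ h2)
  rw [show ∫ x, rho n x = 1 from h1, ENNReal.ofReal_one] at h3
  rw [h3]
  exact lintegral_congr fun x => Real.enorm_of_nonneg (h2 x)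

lemma eLpNorm_moll_rho_le {f : E3 → ℝ} (n : ℕ) {q : ℝ≥0∞}
    (hq1 : 1 ≤ q) (hq : q ≠ ⊤) (hf : AEStronglyMeasurable f volume) :
    eLpNorm (moll (rho n) f) q volume ≤ eLpNorm f q volume := by
  have := eLpNorm_moll_le (isTest_rho n).integrable hq1 hq hf
  rwa [lintegral_rho, one_mul] at this

lemma tendsto_rhoBump_rOut : Tendsto (fun n => (rhoBump n).rOut) atTop (𝓝 0) :=
  tendsto_one_div_add_atTop_nhds_zero_nat

lemma ae_tendsto_moll_rho {f : E3 → ℝ} (hf : LocallyIntegrable f) :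
    ∀ᵐ x, Tendsto (fun n => moll (rho n) f x) atTop (𝓝 (f x)) := by
  refine ContDiffBump.ae_convolution_tendsto_right_of_locallyIntegrable (φ := rhoBump) (K := 2)
    tendsto_rhoBump_rOut (Eventually.of_forall fun n => ?_) hf
  simp only [rhoBump]
  have : (0 : ℝ) < n + 1 := by positivity
  apply le_of_eq
  field_simp

/-- The uniform continuity of `g` gives uniform convergence on a fixed compact set which contains the
supports. -/
lemma tendsto_eLpNorm_moll_rho_sub_of_continuous {g : E3 → ℝ} (hg : Continuous g)
    (hgs : HasCompactSupport g) {q : ℝ≥0∞} (hq1 : 1 ≤ q) (hq : q ≠ ⊤) :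
    Tendsto (fun n => eLpNorm (moll (rho n) g - g) q volume) atTop (𝓝 0) := by
  have hq0 : q ≠ 0 := (zero_lt_one.trans_le hq1).ne'
  set K := Metric.cthickening 1 (tsupport g) with hK
  have hKc : IsCompact K := hgs.isCompact.cthickening
  have hzero : ∀ n x, x ∉ K → (moll (rho n) g - g) x = 0 := by
    intro n x hx
    have hgx : ∀ y ∈ Metric.ball x 1, g y = 0 := by
      intro y hy
      by_contra h
      apply hx
      refine Metric.mem_cthickening_of_dist_le x y 1 _ (subset_tsupport _ h) ?_
      rw [dist_comm]; exact hy.le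
    have hx0 : g x = 0 := hgx x (Metric.mem_ball_self one_pos)
    have : moll (rho n) g x = g x := by
      apply ContDiffBump.normed_convolution_eq_right
      intro y hy
      rw [hx0]
      refine hgx y (Metric.ball_subset_ball ?_ hy)
      simp only [rhoBump]
      rw [div_le_one (by positivity)]
      linarith [show (0 : ℝ) ≤ n from Nat.cast_nonneg n]
    simp [this]
  have huc : UniformContinuous g := hgs.uniformContinuous_of_continuous hg
  set L := (volume K) ^ (1 / q.toReal) with hL
  have hLtop : L ≠ ⊤ := ENNReal.rpow_ne_top_of_nonneg (by positivity) hKc.measure_lt_top.ne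
  rw [ENNReal.tendsto_nhds_zero]
  intro ε hε
  obtain ⟨c, hc0, hc⟩ : ∃ c : ℝ, 0 < c ∧ ENNReal.ofReal c * L ≤ ε := by
    rcases eq_or_ne ε ⊤ with rfl | hεt
    · exact ⟨1, one_pos, le_top⟩
    refine ⟨ε.toReal / (L.toReal + 1), by
      have := ENNReal.toReal_pos hε.ne' hεt
      positivity, ?_⟩
    rw [← ENNReal.ofReal_toReal hLtop, ← ENNReal.ofReal_mul (by positivity)]
    refine ENNReal.ofReal_le_of_le_toReal ?_
    rw [div_mul_eq_mul_div, div_le_iff₀ (by positivity)]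
    have : 0 ≤ ε.toReal := ENNReal.toReal_nonneg
    rw [ENNReal.toReal_ofReal ENNReal.toReal_nonneg]
    nlinarith
  obtain ⟨d, hd, hd'⟩ := Metric.uniformContinuous_iff.1 huc c hc0
  filter_upwards [tendsto_rhoBump_rOut.eventually_lt_const hd] with n hn
  have hb : ∀ x, ‖(moll (rho n) g - g) x‖ ≤ c := by
    intro x
    rw [Pi.sub_apply, ← dist_eq_norm]
    apply ContDiffBump.dist_normed_convolution_le hg.aestronglyMeasurable
    intro y hy
    exact (hd' (lt_trans hy hn)).le
  calc eLpNorm (moll (rho n) g - g) q volume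
      ≤ eLpNorm (K.indicator fun _ => c) q volume := by
        apply eLpNorm_mono
        intro x
        by_cases hx : x ∈ K
        · simpa [hx, abs_of_pos hc0] using hb x
        · simp [hx, hzero n x hx]
    _ = ENNReal.ofReal c * L := by
        rw [eLpNorm_indicator_const hKc.measurableSet hq0 hq, Real.enorm_of_nonneg hc0.le]
    _ ≤ ε := hc

/-- Mollification converges in `L^q` for `1 ≤ q < ∞`. -/
lemma tendsto_eLpNorm_moll_rho_sub {f : E3 → ℝ} {q : ℝ≥0∞} (hq1 : 1 ≤ q) (hq : q ≠ ⊤)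
    (hf : MemLp f q volume) :
    Tendsto (fun n => eLpNorm (moll (rho n) f - f) q volume) atTop (𝓝 0) := by
  rw [ENNReal.tendsto_nhds_zero]
  intro ε hε
  have hε3 : ε / 3 ≠ 0 := by simp [hε.ne']
  obtain ⟨g, hgs, hfg, hgc, hgm⟩ := hf.exists_hasCompactSupport_eLpNorm_sub_le hq hε3
  have h0 := tendsto_eLpNorm_moll_rho_sub_of_continuous hgc hgs hq1 hq
  filter_upwards [(ENNReal.tendsto_nhds_zero.1 h0) (ε / 3) (pos_iff_ne_zero.2 hε3)] with n hn
  have hfl : LocallyIntegrable f := hf.locallyIntegrable hq1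
  have hgl : LocallyIntegrable g := hgm.locallyIntegrable hq1
  have hm : ∀ {u : E3 → ℝ}, LocallyIntegrable u → AEStronglyMeasurable (moll (rho n) u) volume :=
    fun hu => (contDiff_moll (isTest_rho n) hu).continuous.aestronglyMeasurable
  have hsplit : moll (rho n) f - f = moll (rho n) (f - g) + (moll (rho n) g - g) + (g - f) := by
    rw [moll_sub (isTest_rho n) hfl hgl]
    ring
  have h1 : eLpNorm (moll (rho n) (f - g)) q volume ≤ ε / 3 :=
    (eLpNorm_moll_rho_le n hq1 hq (hf.1.sub hgm.1)).trans hfg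
  have h2 : eLpNorm (g - f) q volume ≤ ε / 3 := by rwa [eLpNorm_sub_comm]
  rw [hsplit]
  calc _ ≤ eLpNorm (moll (rho n) (f - g) + (moll (rho n) g - g)) q volume
        + eLpNorm (g - f) q volume := eLpNorm_add_le
          ((hm (hfl.sub hgl)).add ((hm hgl).sub hgm.1)) (hgm.1.sub hf.1) hq1
    _ ≤ (eLpNorm (moll (rho n) (f - g)) q volume + eLpNorm (moll (rho n) g - g) q volume)
        + eLpNorm (g - f) q volume := by
          gcongr
          exact eLpNorm_add_le (hm (hfl.sub hgl)) ((hm hgl).sub hgm.1) hq1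
    _ ≤ (ε / 3 + ε / 3) + ε / 3 := by gcongr
    _ = ε := ENNReal.add_thirds ε

lemma memLp_moll {k f : E3 → ℝ} (hk : IsTest k) {q : ℝ≥0∞} (hq1 : 1 ≤ q) (hq : q ≠ ⊤)
    (hf : MemLp f q volume) : MemLp (moll k f) q volume := by
  refine ⟨(contDiff_moll hk (hf.locallyIntegrable hq1)).continuous.aestronglyMeasurable, ?_⟩
  refine (eLpNorm_moll_le hk.integrable hq1 hq hf.1).trans_lt ?_
  exact ENNReal.mul_lt_top hk.integrable.2 hf.2

/-! ### Weak gradients and density of test functions -/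

lemma inner_ej (v : E3) (j : Fin 3) : inner ℝ v (ej j) = v j := by
  simp [ej, EuclideanSpace.inner_single_right]

lemma gradient_apply (u : E3 → ℝ) (x : E3) (j : Fin 3) : gradient u x j = pd j u x := by
  rw [← inner_ej, gradient, InnerProductSpace.toDual_symm_apply, pd]

lemma norm_gradient (u : E3 → ℝ) (x : E3) : ‖gradient u x‖ = ‖fderiv ℝ u x‖ := by
  simp [gradient]

lemma continuous_gradient {u : E3 → ℝ} (hu : ContDiff ℝ ∞ u) : Continuous (gradient u) :=
  (InnerProductSpace.toDual ℝ E3).symm.continuous.comp (hu.continuous_fderiv (by simp))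

lemma norm_le_sum_abs (v : E3) : ‖v‖ ≤ ∑ j, |v j| := by
  have : v = ∑ j, v j • ej j := by
    ext i
    simp [ej, Finset.sum_apply, Pi.single_apply]
  calc ‖v‖ = ‖∑ j, v j • ej j‖ := by rw [← this]
    _ ≤ ∑ j, ‖v j • ej j‖ := norm_sum_le _ _
    _ = ∑ j, |v j| := by simp [norm_smul, ej]

lemma abs_apply_le_norm (v : E3) (j : Fin 3) : |v j| ≤ ‖v‖ := PiLp.norm_apply_le v j

lemma aestronglyMeasurable_apply {G : E3 → E3} (hG : AEStronglyMeasurable G volume)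
    (j : Fin 3) : AEStronglyMeasurable (fun x => G x j) volume :=
  (EuclideanSpace.proj (𝕜 := ℝ) j).continuous.comp_aestronglyMeasurable hG

lemma memLp_apply {G : E3 → E3} {q : ℝ≥0∞} (hG : MemLp G q volume) (j : Fin 3) :
    MemLp (fun x => G x j) q volume :=
  hG.mono (aestronglyMeasurable_apply hG.1 j) (ae_of_all _ fun _ => abs_apply_le_norm _ j)

lemma eLpNorm_le_sum_apply {G : E3 → E3} (hG : AEStronglyMeasurable G volume) {q : ℝ≥0∞}
    (hq : 1 ≤ q) : eLpNorm G q volume ≤ ∑ j, eLpNorm (fun x => G x j) q volume := by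
  calc eLpNorm G q volume ≤ eLpNorm (∑ j, fun x => |G x j|) q volume := by
        apply eLpNorm_mono_real
        intro x
        simpa [Finset.sum_apply] using norm_le_sum_abs (G x)
    _ ≤ ∑ j, eLpNorm (fun x => |G x j|) q volume :=
        eLpNorm_sum_le (fun j _ => (aestronglyMeasurable_apply hG j).norm) hq
    _ = _ := by
        congr 1
        ext j
        exact eLpNorm_norm (fun x => G x j)

/-- Mollifying against a weak gradient: `∂ⱼ (k * f) = k * Gⱼ`. -/
lemma IsWeakGradient.pd_moll {f : E3 → ℝ} {G : E3 → E3} (h : IsWeakGradient f G) {k : E3 → ℝ}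
    (hk : IsTest k) (j : Fin 3) : pd j (moll k f) = moll k (fun x => G x j) := by
  ext x
  rw [WaveMorawetz.pd_moll hk h.1, moll_eq, moll_eq]
  have h1 := h.2.2 (fun y => k (x - y)) (hk.comp_sub x).1 (hk.comp_sub x).2 (ej j)
  have h2 : ∀ y, fderiv ℝ (fun y => k (x - y)) y (ej j) = - pd j k (x - y) :=
    fun y => pd_comp_sub hk x y j
  simp only [h2, inner_ej] at h1
  have h3 : ∫ y, pd j k (x - y) * f y = - ∫ y, f y * -pd j k (x - y) := by
    rw [← integral_neg]
    congr 1; ext y; ring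
  rw [h3, h1, neg_neg]
  congr 1; ext y; ring

lemma IsWeakGradient.ae_eq {f : E3 → ℝ} {G G' : E3 → E3} (h : IsWeakGradient f G)
    (h' : IsWeakGradient f G') : G =ᵐ[volume] G' := by
  have key : ∀ j : Fin 3, ∀ᵐ x, G x j = G' x j := by
    intro j
    have hl : ∀ {H : E3 → E3}, LocallyIntegrable H → LocallyIntegrable (fun x => H x j) := by
      intro H hH
      exact hH.mono (aestronglyMeasurable_apply hH.aestronglyMeasurable j)
        (ae_of_all _ fun _ => abs_apply_le_norm _ j)
    apply ae_eq_of_integral_contDiff_smul_eq (hl h.2.1) (hl h'.2.1)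
    intro ψ h1 h2
    have e1 := h.2.2 ψ h1 h2 (ej j)
    rw [h'.2.2 ψ h1 h2 (ej j), neg_inj] at e1
    simp only [inner_ej] at e1
    simp only [smul_eq_mul, mul_comm (ψ _)]
    exact e1.symm
  filter_upwards [ae_all_iff.2 key] with x hx
  ext j
  exact hx j

lemma IsWeakGradient.sub {f f' : E3 → ℝ} {G G' : E3 → E3} (h : IsWeakGradient f G)
    (h' : IsWeakGradient f' G') : IsWeakGradient (f - f') (G - G') := by
  refine ⟨h.1.sub h'.1, h.2.1.sub h'.2.1, fun ψ h1 h2 y => ?_⟩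
  have hψ : IsTest ψ := ⟨h1, h2⟩
  have hd : Continuous fun x => fderiv ℝ ψ x y :=
    (h1.continuous_fderiv (by simp)).clm_apply continuous_const
  have hds : HasCompactSupport fun x => fderiv ℝ ψ x y :=
    (h2.fderiv (𝕜 := ℝ)).comp_left (g := fun L : E3 →L[ℝ] ℝ => L y) (by simp)
  have i1 : ∀ {u : E3 → ℝ}, LocallyIntegrable u → Integrable fun x => u x * fderiv ℝ ψ x y :=
    fun hu => by simpa using hu.integrable_smul_right_of_hasCompactSupport hd hds
  have i2 : ∀ {H : E3 → E3}, LocallyIntegrable H → Integrable fun x => inner ℝ (H x) y * ψ x := by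
    intro H hH
    have := (hH.integrable_smul_left_of_hasCompactSupport hψ.continuous hψ.2).inner_const
      (𝕜 := ℝ) y
    simpa [inner_smul_left, mul_comm] using this
  have e1 : (fun x => (f - f') x * fderiv ℝ ψ x y)
      = fun x => f x * fderiv ℝ ψ x y - f' x * fderiv ℝ ψ x y := by ext x; simp [sub_mul]
  have e2 : (fun x => inner ℝ ((G - G') x) y * ψ x)
      = fun x => inner ℝ (G x) y * ψ x - inner ℝ (G' x) y * ψ x := by
    ext x; simp [inner_sub_left, sub_mul]
  rw [e1, e2, integral_sub (i1 h.1) (i1 h'.1), integral_sub (i2 h.2.1) (i2 h'.2.1),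
    h.2.2 ψ h1 h2 y, h'.2.2 ψ h1 h2 y]
  ring

lemma MemHDot1.weakGrad {f : E3 → ℝ} (h : MemHDot1 f) :
    MemLp (weakGrad f) 2 volume ∧ IsWeakGradient f (weakGrad f) := by
  rw [WaveMorawetz.weakGrad, dif_pos h.2]
  exact h.2.choose_spec

lemma MemHDot1.sub {f g : E3 → ℝ} (hf : MemHDot1 f) (hg : MemHDot1 g) : MemHDot1 (f - g) :=
  ⟨hf.1.sub hg.1, _, hf.weakGrad.1.sub hg.weakGrad.1, hf.weakGrad.2.sub hg.weakGrad.2⟩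

lemma weakGrad_sub {f g : E3 → ℝ} (hf : MemHDot1 f) (hg : MemHDot1 g) :
    weakGrad (f - g) =ᵐ[volume] weakGrad f - weakGrad g :=
  (hf.sub hg).weakGrad.2.ae_eq (hf.weakGrad.2.sub hg.weakGrad.2)

lemma pd_mul {u v : E3 → ℝ} (hu : Differentiable ℝ u) (hv : Differentiable ℝ v) (j : Fin 3)
    (x : E3) : pd j (fun x => u x * v x) x = pd j u x * v x + u x * pd j v x := by
  simp only [pd]
  rw [fderiv_fun_mul (hu x) (hv x)]
  simp
  ring

lemma gradient_mul {u v : E3 → ℝ} (hu : Differentiable ℝ u) (hv : Differentiable ℝ v) (x : E3) :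
    gradient (fun x => u x * v x) x = u x • gradient v x + v x • gradient u x := by
  ext j
  simp only [gradient_apply, PiLp.add_apply, PiLp.smul_apply, smul_eq_mul, pd_mul hu hv]
  ring

lemma norm_smul_le_of_abs_le_one {E : Type*} [NormedAddCommGroup E] [NormedSpace ℝ E] {c : ℝ}
    (hc : |c| ≤ 1) (v : E) : ‖c • v‖ ≤ ‖v‖ := by
  rw [norm_smul]
  exact mul_le_of_le_one_left (norm_nonneg _) hc

/-- Multiplication by a bounded sequence tending to `0` pointwise. -/
lemma tendsto_eLpNorm_smul_of_tendsto_zero {E : Type*} [NormedAddCommGroup E] [NormedSpace ℝ E]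
    {f : E3 → E} {q : ℝ≥0∞} (hq0 : q ≠ 0) (hq : q ≠ ⊤)
    (hf : MemLp f q volume) {m : ℕ → E3 → ℝ} (hm : ∀ n, AEStronglyMeasurable (m n) volume)
    (hb : ∀ n x, |m n x| ≤ 1) (ht : ∀ᵐ x, Tendsto (fun n => m n x) atTop (𝓝 0)) :
    Tendsto (fun n => eLpNorm (fun x => m n x • f x) q volume) atTop (𝓝 0) := by
  have hr : 0 < q.toReal := ENNReal.toReal_pos hq0 hq
  simp only [eLpNorm_eq_lintegral_rpow_enorm_toReal hq0 hq]
  have h0 : Tendsto (fun n => ∫⁻ x, ‖m n x • f x‖ₑ ^ q.toReal) atTop (𝓝 (∫⁻ _ : E3, 0)) := by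
    refine tendsto_lintegral_of_dominated_convergence' (fun x => ‖f x‖ₑ ^ q.toReal)
      (fun n => (((hm n).smul hf.1).enorm.pow_const _)) (fun n => ae_of_all _ fun x => ?_) ?_ ?_
    · simp only
      gcongr
      rw [enorm_smul]
      refine mul_le_of_le_one_left (by simp) ?_
      rw [Real.enorm_eq_ofReal_abs]
      simpa using hb n x
    · exact (lintegral_rpow_enorm_lt_top_of_eLpNorm_lt_top hq0 hq hf.2).ne
    · filter_upwards [ht] with x hx
      have h1 : Tendsto (fun n => ‖m n x • f x‖ₑ) atTop (𝓝 0) := by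
        have := (hx.smul_const (f x)).enorm
        simpa using this
      have := h1.ennrpow_const q.toReal
      simpa [ENNReal.zero_rpow_of_pos hr] using this
  have := h0.ennrpow_const (1 / q.toReal)
  simpa [ENNReal.zero_rpow_of_pos (show 0 < q.toReal⁻¹ by positivity)] using this

/-- A fixed cutoff function. -/
def cutoffBump : ContDiffBump (0 : E3) where
  rIn := 1
  rOut := 2
  rIn_pos := one_pos
  rIn_lt_rOut := one_lt_two

/-- The cutoff functions `χ (x / (n + 1))`. -/
def chi (n : ℕ) (x : E3) : ℝ := cutoffBump (((n : ℝ) + 1)⁻¹ • x)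

lemma isTest_chi (n : ℕ) : IsTest (chi n) := by
  refine ⟨cutoffBump.contDiff.comp (contDiff_const_smul _), ?_⟩
  have hn : ((n : ℝ) + 1)⁻¹ ≠ 0 := by positivity
  exact cutoffBump.hasCompactSupport.comp_homeomorph (Homeomorph.smulOfNeZero _ hn)

lemma chi_nonneg (n : ℕ) (x : E3) : 0 ≤ chi n x := cutoffBump.nonneg

lemma chi_le_one (n : ℕ) (x : E3) : chi n x ≤ 1 := cutoffBump.le_one

lemma chi_eq_one {n : ℕ} {x : E3} (h : ‖x‖ ≤ n + 1) : chi n x = 1 := by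
  apply cutoffBump.one_of_mem_closedBall
  have hn : (0 : ℝ) < n + 1 := by positivity
  simp only [cutoffBump, mem_closedBall_zero_iff, norm_smul, norm_inv, Real.norm_eq_abs,
    abs_of_pos hn]
  rw [inv_mul_le_iff₀ hn]
  linarith

lemma tendsto_chi (x : E3) : Tendsto (fun n => chi n x) atTop (𝓝 1) := by
  apply tendsto_const_nhds.congr'
  obtain ⟨N, hN⟩ := exists_nat_ge ‖x‖
  filter_upwards [eventually_ge_atTop N] with n hn
  have : (N : ℝ) ≤ n := by exact_mod_cast hn
  exact (chi_eq_one (by linarith)).symm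

lemma fderiv_chi (n : ℕ) (x : E3) :
    fderiv ℝ (chi n) x = ((n : ℝ) + 1)⁻¹ • fderiv ℝ cutoffBump (((n : ℝ) + 1)⁻¹ • x) := by
  have h := (cutoffBump.contDiff (n := 1)).differentiable (by simp) (((n : ℝ) + 1)⁻¹ • x)
  have h2 : HasFDerivAt (chi n) _ x := h.hasFDerivAt.comp x
    ((hasFDerivAt_id x).const_smul (((n : ℝ) + 1)⁻¹))
  rw [h2.fderiv]
  ext v
  simp

lemma gradient_chi_eq_zero {n : ℕ} {x : E3} (h : ‖x‖ < n + 1) : gradient (chi n) x = 0 := by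
  have : chi n =ᶠ[𝓝 x] fun _ => 1 := by
    filter_upwards [(continuous_norm.tendsto x).eventually_lt_const h] with y hy
    exact chi_eq_one hy.le
  rw [← norm_eq_zero, norm_gradient, this.fderiv_eq]
  simp

/-- The gradients of the cutoff functions are bounded in `L³`, by scaling. -/
lemma exists_eLpNorm_gradient_chi_le :
    ∃ C : ℝ≥0, ∀ n, eLpNorm (gradient (chi n)) 3 volume ≤ C := by
  obtain ⟨C, hC⟩ := ((cutoffBump.hasCompactSupport.fderiv (𝕜 := ℝ)).norm).exists_bound_of_continuous
    ((cutoffBump.contDiff (n := 1)).continuous_fderiv (by simp)).norm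
  simp only [norm_norm] at hC
  have hC0 : 0 ≤ C := (norm_nonneg _).trans (hC 0)
  set M := (volume (Metric.ball (0 : E3) 1)) ^ ((1 : ℝ) / 3) with hM
  have hMtop : M ≠ ⊤ := ENNReal.rpow_ne_top_of_nonneg (by positivity) measure_ball_lt_top.ne
  refine ⟨(ENNReal.ofReal (3 * C) * M).toNNReal, fun n => ?_⟩
  rw [ENNReal.coe_toNNReal (ENNReal.mul_ne_top ENNReal.ofReal_ne_top hMtop)]
  have hn : (0 : ℝ) < n + 1 := by positivity
  set B := Metric.ball (0 : E3) (3 * (n + 1)) with hB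
  calc eLpNorm (gradient (chi n)) 3 volume
      ≤ eLpNorm (B.indicator fun _ => ((n : ℝ) + 1)⁻¹ * C) 3 volume := by
        apply eLpNorm_mono
        intro x
        rw [norm_gradient, fderiv_chi, norm_smul, norm_inv, Real.norm_eq_abs, abs_of_pos hn]
        by_cases hx : x ∈ B
        · rw [indicator_of_mem hx, Real.norm_of_nonneg (by positivity)]
          gcongr
          exact hC _
        · have hx' : fderiv ℝ cutoffBump (((n : ℝ) + 1)⁻¹ • x) = 0 := by
            by_contra h
            have h1 := (tsupport_fderiv_subset ℝ (f := cutoffBump)) (subset_tsupport _ h)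
            rw [cutoffBump.tsupport_eq, mem_closedBall_zero_iff, norm_smul, norm_inv,
              Real.norm_eq_abs, abs_of_pos hn, inv_mul_le_iff₀ hn] at h1
            apply hx
            rw [hB, mem_ball_zero_iff]
            simp only [cutoffBump] at h1
            linarith
          simp [hx, hx']
    -- the volume of the ball grows like `(n + 1) ^ 3`, whose cube root cancels the factor `1 / (n + 1)`
    _ = ENNReal.ofReal (3 * C) * M := by
        rw [eLpNorm_indicator_const Metric.isOpen_ball.measurableSet (by simp) (by simp),
          Measure.addHaar_ball _ _ (by positivity), Real.enorm_of_nonneg (by positivity),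
          ENNReal.mul_rpow_of_nonneg _ _ (by positivity), hM, ← mul_assoc,
          ENNReal.ofReal_rpow_of_nonneg (by positivity) (by positivity),
          ← ENNReal.ofReal_mul (by positivity)]
        congr 2
        have : ((3 * ((n : ℝ) + 1)) ^ Module.finrank ℝ E3) ^ (1 / (3 : ℝ≥0∞).toReal)
            = 3 * ((n : ℝ) + 1) := by
          rw [← Real.rpow_natCast, ← Real.rpow_mul (by positivity)]
          simp
        rw [this]
        field_simp

/-- The exponents in Hölder's inequality `1/2 = 1/6 + 1/3`. -/
instance holderTriple_six_three_two : ENNReal.HolderTriple 6 3 2 := by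
  constructor
  rw [← ENNReal.toReal_eq_toReal_iff' (by simp) (by simp), ENNReal.toReal_add (by simp) (by simp)]
  norm_num

/-- Test functions are dense in `Ḣ¹`; the approximating sequence also converges in every
`L^q` to which the limit belongs. -/
lemma exists_isTest_tendsto {f : E3 → ℝ} {G : E3 → E3} (hf : MemLp f 6 volume)
    (hG : MemLp G 2 volume) (h : IsWeakGradient f G) :
    ∃ u : ℕ → E3 → ℝ, (∀ n, IsTest (u n)) ∧
      (∀ q : ℝ≥0∞, 1 ≤ q → q ≠ ⊤ → MemLp f q volume →
        Tendsto (fun n => eLpNorm (u n - f) q volume) atTop (𝓝 0)) ∧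
      Tendsto (fun n => eLpNorm (gradient (u n) - G) 2 volume) atTop (𝓝 0) ∧
      ∀ᵐ x, Tendsto (fun n => u n x) atTop (𝓝 (f x)) := by
  -- mollify, then cut off
  set w : ℕ → E3 → ℝ := fun n => moll (rho n) f with hw
  have hwc : ∀ n, ContDiff ℝ ∞ (w n) := fun n => contDiff_moll (isTest_rho n) h.1
  have hwm : ∀ n, AEStronglyMeasurable (w n) volume := fun n =>
    (hwc n).continuous.aestronglyMeasurable
  have hcm : ∀ n, AEStronglyMeasurable (chi n) volume := fun n =>
    (isTest_chi n).continuous.aestronglyMeasurable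
  have hchi1 : ∀ n x, |chi n x| ≤ 1 := fun n x => by
    rw [abs_of_nonneg (chi_nonneg n x)]; exact chi_le_one n x
  have hchi2 : ∀ n x, |chi n x - 1| ≤ 1 := fun n x => by
    rw [abs_le]; constructor <;> linarith [chi_nonneg n x, chi_le_one n x]
  have hchi3 : ∀ x, Tendsto (fun n => chi n x - 1) atTop (𝓝 0) := fun x => by
    simpa using (tendsto_chi x).sub_const 1
  have hgw : Tendsto (fun n => eLpNorm (gradient (w n) - G) 2 volume) atTop (𝓝 0) := by
    have hj : ∀ j : Fin 3, Tendsto (fun n => eLpNorm (moll (rho n) (fun x => G x j)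
        - fun x => G x j) 2 volume) atTop (𝓝 0) := fun j =>
      tendsto_eLpNorm_moll_rho_sub (by norm_num) (by norm_num) (memLp_apply hG j)
    have hs := tendsto_finsetSum Finset.univ fun j _ => hj j
    simp only [Finset.sum_const_zero] at hs
    refine tendsto_of_tendsto_of_tendsto_of_le_of_le tendsto_const_nhds hs (fun n => zero_le)
      fun n => ?_
    refine (eLpNorm_le_sum_apply ((continuous_gradient (hwc n)).aestronglyMeasurable.sub hG.1)
      (by norm_num)).trans (le_of_eq ?_)
    congr 1; ext j
    congr 1; ext x
    simp [gradient_apply, hw, h.pd_moll (isTest_rho n)]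
  have hLq : ∀ q : ℝ≥0∞, 1 ≤ q → q ≠ ⊤ → MemLp f q volume →
      Tendsto (fun n => eLpNorm (w n - f) q volume) atTop (𝓝 0) :=
    fun q h1 h2 h3 => tendsto_eLpNorm_moll_rho_sub h1 h2 h3
  refine ⟨fun n x => chi n x * w n x, fun n => ⟨(isTest_chi n).1.mul (hwc n),
    (isTest_chi n).2.mul_right⟩, ?_, ?_, ?_⟩
  · intro q h1 h2 h3
    have hq0 : q ≠ 0 := (zero_lt_one.trans_le h1).ne'
    have e2 := tendsto_eLpNorm_smul_of_tendsto_zero hq0 h2 h3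
      (fun n => (hcm n).sub aestronglyMeasurable_const) hchi2 (ae_of_all _ hchi3)
    have e3 := (hLq q h1 h2 h3).add e2
    simp only [add_zero] at e3
    refine tendsto_of_tendsto_of_tendsto_of_le_of_le tendsto_const_nhds e3 (fun n => zero_le)
      fun n => ?_
    have : (fun x => chi n x * w n x) - f
        = (fun x => chi n x • (w n - f) x) + fun x => (chi n x - 1) • f x := by
      ext x; simp; ring
    rw [this]
    refine (eLpNorm_add_le ((hcm n).smul ((hwm n).sub h3.1))
      (((hcm n).sub aestronglyMeasurable_const).smul h3.1) h1).trans ?_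
    exact add_le_add (eLpNorm_mono fun x => norm_smul_le_of_abs_le_one (hchi1 n x) _) le_rfl
  · obtain ⟨C, hC⟩ := exists_eLpNorm_gradient_chi_le
    -- The gradient of `chi n` lives on `|x| ≥ n + 1`, where the `L⁶` norm of `f` is small; Hölder's
    -- inequality with `1/2 = 1/6 + 1/3` and the bound in `L³` then make the commutator vanish.
    set m : ℕ → E3 → ℝ := fun n => {x : E3 | (n : ℝ) + 1 ≤ ‖x‖}.indicator fun _ => 1 with hm
    have hms : ∀ n : ℕ, MeasurableSet {x : E3 | (n : ℝ) + 1 ≤ ‖x‖} := fun n =>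
      measurableSet_le measurable_const measurable_norm
    have hmm : ∀ n, AEStronglyMeasurable (m n) volume := fun n =>
      (measurable_const.indicator (hms n)).aestronglyMeasurable
    have hm1 : ∀ n x, |m n x| ≤ 1 := fun n x => by
      simp only [hm, indicator_apply]; split_ifs <;> simp
    have hmt : ∀ x, Tendsto (fun n => m n x) atTop (𝓝 0) := fun x => by
      apply tendsto_const_nhds.congr'
      obtain ⟨N, hN⟩ := exists_nat_gt ‖x‖
      filter_upwards [eventually_ge_atTop N] with n hn
      have : (N : ℝ) ≤ n := by exact_mod_cast hn
      simp only [hm]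
      rw [indicator_of_notMem]
      simp only [mem_ofPred_eq, not_le]
      linarith
    have e1 := tendsto_eLpNorm_smul_of_tendsto_zero (by simp) (by simp) hf hmm hm1
      (ae_of_all _ hmt)
    have e2 := tendsto_eLpNorm_smul_of_tendsto_zero (by simp) (by simp) hG
      (fun n => (hcm n).sub aestronglyMeasurable_const) hchi2 (ae_of_all _ hchi3)
    have e3 := ((hLq 6 (by norm_num) (by simp) hf).add e1)
    have e4 := ENNReal.Tendsto.mul_const e3 (b := (C : ℝ≥0∞)) (Or.inr (by simp))
    have e5 := (hgw.add e2).add e4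
    simp only [add_zero, zero_mul] at e5
    refine tendsto_of_tendsto_of_tendsto_of_le_of_le tendsto_const_nhds e5 (fun n => zero_le)
      fun n => ?_
    have hgm : AEStronglyMeasurable (gradient (w n)) volume :=
      (continuous_gradient (hwc n)).aestronglyMeasurable
    have hgc : AEStronglyMeasurable (gradient (chi n)) volume :=
      (continuous_gradient (isTest_chi n).1).aestronglyMeasurable
    have hsplit : gradient (fun x => chi n x * w n x) - G
        = ((fun x => chi n x • (gradient (w n) - G) x) + fun x => (chi n x - 1) • G x)
          + fun x => (m n x * w n x) • gradient (chi n) x := by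
      ext1 x
      simp only [Pi.sub_apply, Pi.add_apply]
      rw [gradient_mul (isTest_chi n).differentiable ((hwc n).differentiable (by simp))]
      by_cases hx : (n : ℝ) + 1 ≤ ‖x‖
      · simp only [hm, mem_ofPred_eq, hx, indicator_of_mem]
        module
      · rw [gradient_chi_eq_zero (not_le.1 hx)]
        module
    have hmw : AEStronglyMeasurable (fun x => m n x * w n x) volume := (hmm n).mul (hwm n)
    rw [hsplit]
    refine (eLpNorm_add_le (((hcm n).smul (hgm.sub hG.1)).add
      (((hcm n).sub aestronglyMeasurable_const).smul hG.1)) (hmw.smul hgc)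
      (by norm_num)).trans (add_le_add ((eLpNorm_add_le ((hcm n).smul (hgm.sub hG.1))
      (((hcm n).sub aestronglyMeasurable_const).smul hG.1) (by norm_num)).trans ?_) ?_)
    · exact add_le_add (eLpNorm_mono fun x => norm_smul_le_of_abs_le_one (hchi1 n x) _) le_rfl
    · have hh := eLpNorm_smul_le_mul_eLpNorm (p := 6) (q := 3) (r := 2) hgc hmw
      refine hh.trans (mul_le_mul' ?_ (hC n))
      have : (fun x => m n x * w n x)
          = (fun x => m n x • (w n - f) x) + fun x => m n x • f x := by
        ext x; simp; ring
      rw [this]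
      refine (eLpNorm_add_le ((hmm n).smul ((hwm n).sub hf.1)) ((hmm n).smul hf.1)
        (by norm_num)).trans ?_
      exact add_le_add (eLpNorm_mono fun x => norm_smul_le_of_abs_le_one (hm1 n x) _) le_rfl
  · filter_upwards [ae_tendsto_moll_rho h.1] with x hx
    simpa using (tendsto_chi x).mul hx

/-- The Sobolev inequality `‖f‖₆ ≤ C ‖∇f‖₂`. -/
lemma exists_sobolev : ∃ C : ℝ≥0, ∀ (f : E3 → ℝ) (G : E3 → E3), MemLp f 6 volume →
    MemLp G 2 volume → IsWeakGradient f G → eLpNorm f 6 volume ≤ C * eLpNorm G 2 volume := by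
  refine ⟨eLpNormLESNormFDerivOfEqInnerConst (volume : Measure E3) 2, fun f G hf hG h => ?_⟩
  set C := eLpNormLESNormFDerivOfEqInnerConst (volume : Measure E3) 2
  obtain ⟨u, hu, hq, hg, -⟩ := exists_isTest_tendsto hf hG h
  have h6 := hq 6 (by norm_num) (by simp) hf
  have key : ∀ n, eLpNorm f 6 volume ≤ eLpNorm (u n - f) 6 volume
      + C * (eLpNorm (gradient (u n) - G) 2 volume + eLpNorm G 2 volume) := by
    intro n
    have hum : AEStronglyMeasurable (u n) volume := (hu n).continuous.aestronglyMeasurable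
    have hgm : AEStronglyMeasurable (gradient (u n)) volume :=
      (continuous_gradient (hu n).1).aestronglyMeasurable
    have e1 : eLpNorm (u n) 6 volume ≤ C * eLpNorm (gradient (u n)) 2 volume := by
      have := eLpNorm_le_eLpNorm_fderiv_of_eq_inner (μ := (volume : Measure E3)) (u := u n)
        ((hu n).1.of_le (by simp)) (hu n).2 (p := 2) (p' := 6) (by norm_num) (by simp)
        (by simp; norm_num)
      refine this.trans (le_of_eq ?_)
      congr 1
      exact eLpNorm_congr_norm_ae (ae_of_all _ fun x => (norm_gradient _ _).symm)
    calc eLpNorm f 6 volume = eLpNorm (u n - (u n - f)) 6 volume := by simp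
      _ ≤ eLpNorm (u n) 6 volume + eLpNorm (u n - f) 6 volume :=
          eLpNorm_sub_le hum (hum.sub hf.1) (by norm_num)
      _ ≤ C * eLpNorm (gradient (u n) - G + G) 2 volume + eLpNorm (u n - f) 6 volume := by
          gcongr; simpa using e1
      _ ≤ C * (eLpNorm (gradient (u n) - G) 2 volume + eLpNorm G 2 volume)
          + eLpNorm (u n - f) 6 volume := by
          gcongr
          exact eLpNorm_add_le (hgm.sub hG.1) hG.1 (by norm_num)
      _ = _ := add_comm _ _
  have hlim : Tendsto (fun n => eLpNorm (u n - f) 6 volume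
      + C * (eLpNorm (gradient (u n) - G) 2 volume + eLpNorm G 2 volume)) atTop
      (𝓝 (0 + C * (0 + eLpNorm G 2 volume))) :=
    h6.add (ENNReal.Tendsto.const_mul (hg.add_const _) (Or.inr (by simp)))
  rw [zero_add, zero_add] at hlim
  exact ge_of_tendsto' hlim key

/-! ### Calculus with partial derivatives -/

lemma isWeakGradient_gradient {u : E3 → ℝ} (hu : ContDiff ℝ ∞ u) :
    IsWeakGradient u (gradient u) := by
  refine ⟨hu.continuous.locallyIntegrable, (continuous_gradient hu).locallyIntegrable,
    fun ψ h1 h2 y => ?_⟩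
  have hu1 : Continuous fun x => fderiv ℝ u x y :=
    (hu.continuous_fderiv (by simp)).clm_apply continuous_const
  have hψ1 : Continuous fun x => fderiv ℝ ψ x y :=
    (h1.continuous_fderiv (by simp)).clm_apply continuous_const
  have hψs : HasCompactSupport fun x => fderiv ℝ ψ x y :=
    (h2.fderiv (𝕜 := ℝ)).comp_left (g := fun L : E3 →L[ℝ] ℝ => L y) (by simp)
  have := integral_mul_fderiv_eq_neg_fderiv_mul_of_integrable (μ := (volume : Measure E3))
    (f := u) (g := ψ) (v := y)
    ((hu1.mul h1.continuous).integrable_of_hasCompactSupport h2.mul_left)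
    ((hu.continuous.mul hψ1).integrable_of_hasCompactSupport hψs.mul_left)
    ((hu.continuous.mul h1.continuous).integrable_of_hasCompactSupport h2.mul_left)
    (fun x _ => hu.differentiable (by simp) x) (fun x _ => h1.differentiable (by simp) x)
  rw [this]
  congr 2
  ext x
  rw [gradient, InnerProductSpace.toDual_symm_apply]

/-- `f` is differentiable with `j`-th partial derivative `f'`. -/
def HasPD (j : Fin 3) (f f' : E3 → ℝ) : Prop := Differentiable ℝ f ∧ ∀ x, pd j f x = f' x

lemma HasPD.mul {j : Fin 3} {f f' g g' : E3 → ℝ} (hf : HasPD j f f') (hg : HasPD j g g') :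
    HasPD j (fun x => f x * g x) (fun x => f' x * g x + f x * g' x) :=
  ⟨hf.1.mul hg.1, fun x => by rw [pd_mul hf.1 hg.1, hf.2, hg.2]⟩

lemma HasPD.add {j : Fin 3} {f f' g g' : E3 → ℝ} (hf : HasPD j f f') (hg : HasPD j g g') :
    HasPD j (fun x => f x + g x) (fun x => f' x + g' x) :=
  ⟨hf.1.add hg.1, fun x => by
    simp only [← hf.2, ← hg.2, pd, fderiv_fun_add (hf.1 x) (hg.1 x), add_apply]⟩

lemma HasPD.const_mul {j : Fin 3} {f f' : E3 → ℝ} (c : ℝ) (hf : HasPD j f f') :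
    HasPD j (fun x => c * f x) (fun x => c * f' x) :=
  ⟨hf.1.const_mul c, fun x => by
    simp only [← hf.2, pd, fderiv_const_mul (hf.1 x), smul_apply, smul_eq_mul]⟩

lemma HasPD.congr {j : Fin 3} {f f' g g' : E3 → ℝ} (hf : HasPD j f f') (h1 : ∀ x, g x = f x)
    (h2 : ∀ x, g' x = f' x) : HasPD j g g' := by
  obtain rfl : g = f := funext h1
  obtain rfl : g' = f' := funext h2
  exact hf

lemma hasPD_of_contDiff {u : E3 → ℝ} (hu : ContDiff ℝ ∞ u) (j : Fin 3) : HasPD j u (pd j u) :=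
  ⟨hu.differentiable (by simp), fun _ => rfl⟩

lemma hasPD_coord (i j : Fin 3) :
    HasPD j (fun x => x i) (fun _ => if i = j then 1 else 0) := by
  refine ⟨(EuclideanSpace.proj (𝕜 := ℝ) i).differentiable, fun x => ?_⟩
  have : fderiv ℝ (fun x : E3 => x i) x = EuclideanSpace.proj (𝕜 := ℝ) i :=
    (EuclideanSpace.proj (𝕜 := ℝ) i).fderiv
  rw [pd, this]
  simp [ej]

/-- An integrable partial derivative of an integrable function has integral zero; this is the form in
which integration by parts is used. -/
lemma integral_pd_eq_zero {Z Z' : E3 → ℝ} {j : Fin 3} (hd : HasPD j Z Z') (hi : Integrable Z)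
    (hi' : Integrable Z') : ∫ x, Z' x = 0 := by
  have hpd : pd j Z = Z' := funext hd.2
  have := integral_mul_fderiv_eq_neg_fderiv_mul_of_integrable (μ := (volume : Measure E3))
    (f := Z) (g := fun _ => (1 : ℝ)) (v := ej j) (by simpa [← hpd, pd] using! hi') (by simp)
    (by simpa using hi) (fun x _ => hd.1 x) (fun x _ => by simp)
  simp only [fderiv_fun_const, Pi.zero_apply, zero_apply, mul_zero, integral_zero,
    mul_one, zero_eq_neg] at this
  rw [← hpd]
  exact this

lemma integral_add_add_eq_zero {Z : Fin 3 → E3 → ℝ} (hi : ∀ j, Integrable (Z j))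
    (hz : ∀ j, ∫ x, Z j x = 0) : ∫ x, Z 0 x + Z 1 x + Z 2 x = 0 := by
  have h01 : Integrable fun x => Z 0 x + Z 1 x := (hi 0).add (hi 1)
  rw [integral_add h01 (hi 2), integral_add (hi 0) (hi 1), hz, hz, hz]
  simp

lemma pd_comm {u : E3 → ℝ} (hu : ContDiff ℝ ∞ u) (i j : Fin 3) (x : E3) :
    pd i (pd j u) x = pd j (pd i u) x := by
  have hs : IsSymmSndFDerivAt ℝ u x := (contDiff_infty.1 hu 2).contDiffAt.isSymmSndFDerivAt (by simp)
  have hd : DifferentiableAt ℝ (fderiv ℝ u) x :=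
    (hu.fderiv_right (m := ∞) (by simp)).differentiable (by simp) x
  have key : ∀ a b : Fin 3, pd a (pd b u) x = fderiv ℝ (fderiv ℝ u) x (ej a) (ej b) := by
    intro a b
    have : HasFDerivAt (pd b u) _ x := hd.hasFDerivAt.clm_apply (hasFDerivAt_const (ej b) x)
    rw [pd, this.fderiv]
    simp
  rw [key, key]
  exact hs _ _

/-! ### The Morawetz multiplier -/

/-- The weight `(|x|² + δ²)^(-1/2)`; for `δ = 0` this is `1 / |x|`. -/
def sw (δ : ℝ) (x : E3) : ℝ := (√(‖x‖ ^ 2 + δ ^ 2))⁻¹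

lemma sw_nonneg (δ : ℝ) (x : E3) : 0 ≤ sw δ x := by unfold sw; positivity

lemma sw_zero (x : E3) : sw 0 x = ‖x‖⁻¹ := by simp [sw]

lemma norm_sq_eq (x : E3) : ‖x‖ ^ 2 = x 0 ^ 2 + x 1 ^ 2 + x 2 ^ 2 := by
  simp [EuclideanSpace.norm_sq_eq, Fin.sum_univ_three]

/-- The relation `s² (|x|² + δ²) = 1`, by which identities in the weight `s` and the coordinates are
reduced to polynomial ones. -/
lemma sw_rel {δ : ℝ} (hδ : 0 < δ) (x : E3) :
    sw δ x ^ 2 * (x 0 ^ 2 + x 1 ^ 2 + x 2 ^ 2 + δ ^ 2) = 1 := by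
  have h : 0 < ‖x‖ ^ 2 + δ ^ 2 := by positivity
  rw [sw, inv_pow, Real.sq_sqrt h.le, ← norm_sq_eq, inv_mul_cancel₀ h.ne']

lemma sw_mul_norm_le (δ : ℝ) (x : E3) : sw δ x * ‖x‖ ≤ 1 := by
  rw [sw]
  refine inv_mul_le_one_of_le₀ (Real.le_sqrt_of_sq_le (by nlinarith [sq_nonneg δ])) (by positivity)

lemma sw_mul_le (δ : ℝ) (x : E3) : sw δ x * |δ| ≤ 1 := by
  rw [sw]
  refine inv_mul_le_one_of_le₀ (Real.le_sqrt_of_sq_le ?_) (by positivity)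
  rw [sq_abs]; nlinarith [sq_nonneg ‖x‖]

lemma sw_le_sw_zero (δ : ℝ) {x : E3} (hx : x ≠ 0) : sw δ x ≤ sw 0 x := by
  rw [sw_zero, sw]
  have : 0 < ‖x‖ := norm_pos_iff.2 hx
  gcongr
  exact Real.le_sqrt_of_sq_le (by nlinarith [sq_nonneg δ])

lemma measurable_sw (δ : ℝ) : Measurable (sw δ) := by unfold sw; fun_prop

lemma contDiff_sw {δ : ℝ} (hδ : 0 < δ) : ContDiff ℝ ∞ (sw δ) := by
  have h : ∀ x : E3, 0 < ‖x‖ ^ 2 + δ ^ 2 := fun x => by positivity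
  apply ContDiff.inv
  · exact ContDiff.sqrt ((contDiff_norm_sq ℝ).add contDiff_const) fun x => (h x).ne'
  · exact fun x => (Real.sqrt_pos.2 (h x)).ne'

lemma hasPD_sw {δ : ℝ} (hδ : 0 < δ) (j : Fin 3) :
    HasPD j (sw δ) (fun x => -(x j * sw δ x ^ 3)) := by
  refine ⟨(contDiff_sw hδ).differentiable (by simp), fun x => ?_⟩
  have h : 0 < ‖x‖ ^ 2 + δ ^ 2 := by positivity
  have h1 : HasFDerivAt (fun x : E3 => ‖x‖ ^ 2 + δ ^ 2) _ x :=
    (hasStrictFDerivAt_norm_sq x).hasFDerivAt.add_const (δ ^ 2)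
  have hs : √(‖x‖ ^ 2 + δ ^ 2) ≠ 0 := (Real.sqrt_pos.2 h).ne'
  have h3 : HasFDerivAt (sw δ) _ x := (hasDerivAt_inv hs).comp_hasFDerivAt x (h1.sqrt h.ne')
  rw [pd, h3.fderiv]
  simp [sw, inner_ej]
  field_simp

/-- Bounded continuous coefficients. -/
def BC (m : E3 → ℝ) : Prop := Continuous m ∧ ∃ C, ∀ x, |m x| ≤ C

lemma BC.mul {m k : E3 → ℝ} (hm : BC m) (hk : BC k) : BC fun x => m x * k x := by
  obtain ⟨h1, C, hC⟩ := hm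
  obtain ⟨h2, D, hD⟩ := hk
  refine ⟨h1.mul h2, C * D, fun x => ?_⟩
  rw [abs_mul]
  exact mul_le_mul (hC x) (hD x) (abs_nonneg _) ((abs_nonneg _).trans (hC x))

lemma BC.add {m k : E3 → ℝ} (hm : BC m) (hk : BC k) : BC fun x => m x + k x := by
  obtain ⟨h1, C, hC⟩ := hm
  obtain ⟨h2, D, hD⟩ := hk
  exact ⟨h1.add h2, C + D, fun x => (abs_add_le _ _).trans (add_le_add (hC x) (hD x))⟩

lemma bc_const (c : ℝ) : BC fun _ => c := ⟨continuous_const, |c|, fun _ => le_rfl⟩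

lemma bc_sw {δ : ℝ} (hδ : 0 < δ) : BC (sw δ) := by
  refine ⟨(contDiff_sw hδ).continuous, δ⁻¹, fun x => ?_⟩
  rw [abs_of_nonneg (sw_nonneg _ _), ← one_div, le_div_iff₀ hδ]
  simpa [abs_of_pos hδ] using sw_mul_le δ x

lemma bc_coord {δ : ℝ} (hδ : 0 < δ) (j : Fin 3) : BC fun x => x j * sw δ x := by
  refine ⟨(EuclideanSpace.proj (𝕜 := ℝ) j).continuous.mul (contDiff_sw hδ).continuous, 1,
    fun x => ?_⟩
  rw [abs_mul, abs_of_nonneg (sw_nonneg _ _)]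
  refine (mul_le_mul_of_nonneg_right (abs_apply_le_norm x j) (sw_nonneg _ _)).trans ?_
  rw [mul_comm]
  exact sw_mul_norm_le δ x

lemma BC.memLp {m f : E3 → ℝ} {q : ℝ≥0∞} (hm : BC m) (hf : MemLp f q volume) :
    MemLp (fun x => m x * f x) q volume := by
  obtain ⟨h1, C, hC⟩ := hm
  refine hf.of_le_mul (c := C) (h1.aestronglyMeasurable.mul hf.1) (ae_of_all _ fun x => ?_)
  rw [norm_mul]
  exact mul_le_mul_of_nonneg_right (hC x) (norm_nonneg _)

lemma BC.integrable {m f g : E3 → ℝ} (hm : BC m) (hf : MemLp f 2 volume) (hg : MemLp g 2 volume) :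
    Integrable fun x => m x * (f x * g x) := by
  refine ((hm.memLp hf).integrable_mul hg).congr (ae_of_all _ fun x => ?_)
  simp [mul_assoc]

/-- The Morawetz multiplier `∇a · G + (Δa / 2) f` for `a = √(|x|² + δ²)`; for `δ = 0` and `G = ∇f`
it is `∂ᵣ f + f / |x|`. -/
def mop (δ : ℝ) (f : E3 → ℝ) (G : E3 → E3) (x : E3) : ℝ :=
  sw δ x * inner ℝ x (G x) + (sw δ x + δ ^ 2 * sw δ x ^ 3 / 2) * f x

lemma inner_eq_sum (x y : E3) : inner ℝ x y = x 0 * y 0 + x 1 * y 1 + x 2 * y 2 := by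
  rw [PiLp.inner_apply, Fin.sum_univ_three]
  simp
  ring

lemma mop_gradient (δ : ℝ) (u : E3 → ℝ) (x : E3) : mop δ u (gradient u) x =
    sw δ x * (x 0 * pd 0 u x + x 1 * pd 1 u x + x 2 * pd 2 u x)
      + (sw δ x + δ ^ 2 * sw δ x ^ 3 / 2) * u x := by
  rw [mop, inner_eq_sum, gradient_apply, gradient_apply, gradient_apply]

/-- `mop δ` is antisymmetric. -/
lemma integral_mul_mop_self {δ : ℝ} (hδ : 0 < δ) {w : E3 → ℝ} (hw : ContDiff ℝ ∞ w)
    (h0 : MemLp w 2 volume) (h1 : ∀ j, MemLp (pd j w) 2 volume) :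
    ∫ x, w x * mop δ w (gradient w) x = 0 := by
  -- `w` times the multiplier is the divergence of `w² ∇a / 2`
  set Z' : Fin 3 → E3 → ℝ := fun j x => (1 / 2 * (sw δ x + (x j * sw δ x) * (-(x j * sw δ x)
    * sw δ x))) * (w x * w x) + (x j * sw δ x) * (w x * pd j w x) with hZ'
  have hZ : ∀ j, HasPD j (fun x => (1 / 2) * ((x j * sw δ x) * (w x * w x))) (Z' j) := by
    intro j
    refine ((((hasPD_coord j j).mul (hasPD_sw hδ j)).mul ((hasPD_of_contDiff hw j).mul
      (hasPD_of_contDiff hw j))).const_mul (1 / 2)).congr (fun x => rfl) (fun x => ?_)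
    simp [hZ']
    ring
  have hi : ∀ j, Integrable (Z' j) := by
    intro j
    refine (BC.integrable ?_ h0 h0).add ((bc_coord hδ j).integrable h0 (h1 j))
    refine (bc_const _).mul ((bc_sw hδ).add ((bc_coord hδ j).mul (BC.mul ?_ (bc_sw hδ))))
    exact ((bc_const (-1)).mul (bc_coord hδ j)) |> fun h => by simpa using h
  have hz : ∀ j, ∫ x, Z' j x = 0 := fun j => integral_pd_eq_zero (hZ j)
    (((bc_coord hδ j).integrable h0 h0).const_mul _) (hi j)
  have : ∀ x, w x * mop δ w (gradient w) x = Z' 0 x + Z' 1 x + Z' 2 x := by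
    intro x
    rw [mop_gradient]
    simp only [hZ']
    have hr := sw_rel hδ x
    linear_combination (1 / 2 * w x ^ 2 * sw δ x) * hr
  simp only [this]
  exact integral_add_add_eq_zero hi hz

lemma memLp_mop_gradient {δ : ℝ} (hδ : 0 < δ) {u : E3 → ℝ}
    (h0 : MemLp (fun x => sw δ x * u x) 2 volume) (h1 : ∀ j, MemLp (pd j u) 2 volume) :
    MemLp (mop δ u (gradient u)) 2 volume := by
  have hb : BC fun x => 1 + δ ^ 2 / 2 * (sw δ x * sw δ x) :=
    (bc_const 1).add ((bc_const _).mul ((bc_sw hδ).mul (bc_sw hδ)))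
  have := ((((bc_coord hδ 0).memLp (h1 0)).add ((bc_coord hδ 1).memLp (h1 1))).add
    ((bc_coord hδ 2).memLp (h1 2))).add (hb.memLp h0)
  refine this.congr_norm ?_ (ae_of_all _ fun x => ?_) |> fun h => h
  · have h2 : mop δ u (gradient u) = ((((fun x => x 0 * sw δ x * pd 0 u x)
        + fun x => x 1 * sw δ x * pd 1 u x) + fun x => x 2 * sw δ x * pd 2 u x)
        + fun x => (1 + δ ^ 2 / 2 * (sw δ x * sw δ x)) * (sw δ x * u x)) := by
      ext x; rw [mop_gradient]; simp; ring
    rw [h2]; exact this.1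
  · rw [mop_gradient]; simp only [Pi.add_apply]; congr 1; ring

/-- The pointwise form of the Morawetz identity: with `x`, `p = ∇u`, `h = D²u` and `s` the weight,
the divergence of the momentum field `Z` dominates `Δu` times the multiplier `A`, the difference
being `D²a(∇u, ∇u) - Δ²a u² / 4`. -/
lemma morawetz_algebra {x p A' Z : Fin 3 → ℝ} {h d : Fin 3 → Fin 3 → ℝ} {s δ u A : ℝ}
    (hsym : ∀ i j, h i j = h j i) (hs0 : 0 ≤ s)
    (hr : s ^ 2 * (x 0 ^ 2 + x 1 ^ 2 + x 2 ^ 2 + δ ^ 2) = 1)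
    (hd : ∀ j k, d j k = (if k = j then 1 else 0) * s + (x k * s) * ((-1) * (x j * s) * s))
    (hA' : ∀ j, A' j = (d j 0 * p 0 + x 0 * s * h j 0) + (d j 1 * p 1 + x 1 * s * h j 1)
      + (d j 2 * p 2 + x 2 * s * h j 2) + (s * (1 + δ ^ 2 / 2 * (s * s)) * p j
        + ((x j * s) * ((-1) * s) * (1 + 3 / 2 * δ ^ 2 * (s * s))) * (s * u)))
    (hZ : ∀ j, Z j = (h j j * A + p j * A' j)
      + (-1 / 2) * (d j j * (p 0 * p 0) + 2 * (x j * s * (p 0 * h j 0)))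
      + (-1 / 2) * (d j j * (p 1 * p 1) + 2 * (x j * s * (p 1 * h j 1)))
      + (-1 / 2) * (d j j * (p 2 * p 2) + 2 * (x j * s * (p 2 * h j 2)))
      + (1 / 2) * ((s * (1 + 3 / 2 * δ ^ 2 * (s * s))
          + (x j * s) * (x j * s) * ((-3) * s + (-15 / 2 * δ ^ 2) * (s * (s * s))))
            * ((s * u) * (s * u))
        + 2 * ((x j * s) * (s * (1 + 3 / 2 * δ ^ 2 * (s * s))) * ((s * u) * p j)))) :
    (h 0 0 + h 1 1 + h 2 2) * A ≤ Z 0 + Z 1 + Z 2 := by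
  have hdiv : Z 0 + Z 1 + Z 2 = (h 0 0 + h 1 1 + h 2 2) * A
        + (s * (p 0 ^ 2 + p 1 ^ 2 + p 2 ^ 2) - s ^ 3 * (x 0 * p 0 + x 1 * p 1 + x 2 * p 2) ^ 2)
        + 15 / 4 * δ ^ 4 * s ^ 7 * u ^ 2 := by
    rw [hZ, hZ, hZ, hA', hA', hA', hsym 1 0, hsym 2 0, hsym 2 1]
    simp only [hd, Fin.isValue, if_true, one_ne_zero, zero_ne_one, if_false,
      show (2 : Fin 3) ≠ 0 by decide, show (2 : Fin 3) ≠ 1 by decide,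
      show (0 : Fin 3) ≠ 2 by decide, show (1 : Fin 3) ≠ 2 by decide]
    linear_combination (s / 2 * (p 0 ^ 2 + p 1 ^ 2 + p 2 ^ 2)
      - 1 / 2 * s ^ 3 * u ^ 2 * (3 + 15 / 2 * δ ^ 2 * s ^ 2)) * hr
  -- Cauchy-Schwarz: `a` is convex
  have hl : (x 0 * p 0 + x 1 * p 1 + x 2 * p 2) ^ 2
      ≤ (x 0 ^ 2 + x 1 ^ 2 + x 2 ^ 2) * (p 0 ^ 2 + p 1 ^ 2 + p 2 ^ 2) := by
    nlinarith [sq_nonneg (x 0 * p 1 - x 1 * p 0),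
      sq_nonneg (x 0 * p 2 - x 2 * p 0), sq_nonneg (x 1 * p 2 - x 2 * p 1)]
  have hx1 : s ^ 2 * (x 0 ^ 2 + x 1 ^ 2 + x 2 ^ 2) ≤ 1 := by nlinarith [sq_nonneg (s * δ)]
  have hcs : s ^ 3 * (x 0 * p 0 + x 1 * p 1 + x 2 * p 2) ^ 2
      ≤ s * (p 0 ^ 2 + p 1 ^ 2 + p 2 ^ 2) := by
    calc _ = s * (s ^ 2 * (x 0 * p 0 + x 1 * p 1 + x 2 * p 2) ^ 2) := by ring
      _ ≤ s * (s ^ 2 * ((x 0 ^ 2 + x 1 ^ 2 + x 2 ^ 2) * (p 0 ^ 2 + p 1 ^ 2 + p 2 ^ 2))) := by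
        gcongr
      _ = s * ((s ^ 2 * (x 0 ^ 2 + x 1 ^ 2 + x 2 ^ 2)) * (p 0 ^ 2 + p 1 ^ 2 + p 2 ^ 2)) := by ring
      _ ≤ s * (1 * (p 0 ^ 2 + p 1 ^ 2 + p 2 ^ 2)) := by gcongr
      _ = _ := by ring
  have : 0 ≤ 15 / 4 * δ ^ 4 * s ^ 7 * u ^ 2 := by positivity
  linarith

/-- The key positivity: `∫ Δu (∇a · ∇u + (Δa / 2) u) ≤ 0`, as `a` is convex and `Δ²a ≤ 0`. -/
lemma integral_laplacian_mul_mop_nonpos {δ : ℝ} (hδ : 0 < δ) {u : E3 → ℝ} (hu : ContDiff ℝ ∞ u)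
    (h0 : MemLp (fun x => sw δ x * u x) 2 volume) (h1 : ∀ j, MemLp (pd j u) 2 volume)
    (h2 : ∀ i j, MemLp (pd i (pd j u)) 2 volume) :
    ∫ x, (pd 0 (pd 0 u) x + pd 1 (pd 1 u) x + pd 2 (pd 2 u) x) * mop δ u (gradient u) x ≤ 0 := by
  have bs := bc_sw hδ
  have bx := bc_coord hδ
  set s := sw δ with hs
  set A := mop δ u (gradient u) with hA
  have hAm : MemLp A 2 volume := memLp_mop_gradient hδ h0 h1
  have bq : BC fun x => 1 + 3 / 2 * δ ^ 2 * (s x * s x) :=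
    (bc_const 1).add ((bc_const _).mul (bs.mul bs))
  have bb : BC fun x => s x * (1 + δ ^ 2 / 2 * (s x * s x)) :=
    bs.mul ((bc_const 1).add ((bc_const _).mul (bs.mul bs)))
  -- the coefficients `∂ⱼ (xₖ s)`
  set d : Fin 3 → Fin 3 → E3 → ℝ := fun j k x =>
    (if k = j then 1 else 0) * s x + (x k * s x) * ((-1) * (x j * s x) * s x) with hd
  have bd : ∀ j k, BC (d j k) := fun j k =>
    ((bc_const _).mul bs).add ((bx k).mul (((bc_const _).mul (bx j)).mul bs))
  have hxs : ∀ j k : Fin 3, HasPD j (fun x => x k * s x) (d j k) := fun j k =>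
    ((hasPD_coord k j).mul (hasPD_sw hδ j)).congr (fun _ => rfl) (fun x => by simp [hd, hs]; ring)
  have hsd : ∀ j, HasPD j s (fun x => -(x j * s x ^ 3)) := fun j => hasPD_sw hδ j
  have hud : ∀ j, HasPD j u (pd j u) := hasPD_of_contDiff hu
  have hudd : ∀ j k, HasPD j (pd k u) (pd j (pd k u)) := fun j k =>
    hasPD_of_contDiff (contDiff_pd hu k) j
  -- the derivative of the multiplier
  set A' : Fin 3 → E3 → ℝ := fun j x =>
    (d j 0 x * pd 0 u x + x 0 * s x * pd j (pd 0 u) x)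
      + (d j 1 x * pd 1 u x + x 1 * s x * pd j (pd 1 u) x)
      + (d j 2 x * pd 2 u x + x 2 * s x * pd j (pd 2 u) x)
      + (s x * (1 + δ ^ 2 / 2 * (s x * s x)) * pd j u x
        + ((x j * s x) * ((-1) * s x) * (1 + 3 / 2 * δ ^ 2 * (s x * s x))) * (s x * u x)) with hA'
  have hAd : ∀ j, HasPD j A (A' j) := by
    intro j
    have hb1 := (((hsd j).mul (hsd j)).mul (hsd j)).const_mul (δ ^ 2 / 2)
    have := (((((hxs j 0).mul (hudd j 0)).add ((hxs j 1).mul (hudd j 1))).add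
      ((hxs j 2).mul (hudd j 2))).add (((hsd j).add hb1).mul (hud j)))
    refine this.congr (fun x => ?_) (fun x => ?_)
    · rw [hA, mop_gradient]; ring
    · simp only [hA']; ring
  have hA'm : ∀ j, MemLp (A' j) 2 volume := by
    intro j
    exact (((((bd j 0).memLp (h1 0)).add ((bx 0).memLp (h2 j 0))).add
      (((bd j 1).memLp (h1 1)).add ((bx 1).memLp (h2 j 1)))).add
      (((bd j 2).memLp (h1 2)).add ((bx 2).memLp (h2 j 2)))).add
      ((bb.memLp (h1 j)).add ((((bx j).mul ((bc_const _).mul bs)).mul bq).memLp h0))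
  -- the vector field whose divergence is taken
  set Z : Fin 3 → E3 → ℝ := fun j x => pd j u x * A x
    + (-1 / 2) * (x j * s x * (pd 0 u x * pd 0 u x)) + (-1 / 2) * (x j * s x * (pd 1 u x * pd 1 u x))
    + (-1 / 2) * (x j * s x * (pd 2 u x * pd 2 u x))
    + (1 / 2) * ((x j * s x) * (1 + 3 / 2 * δ ^ 2 * (s x * s x)) * ((s x * u x) * (s x * u x)))
    with hZ
  have hZi : ∀ j, Integrable (Z j) := fun j =>
    (((((h1 j).integrable_mul hAm).add (((bx j).integrable (h1 0) (h1 0)).const_mul _)).add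
      (((bx j).integrable (h1 1) (h1 1)).const_mul _)).add
      (((bx j).integrable (h1 2) (h1 2)).const_mul _)).add
      ((((bx j).mul bq).integrable h0 h0).const_mul _)
  set Z' : Fin 3 → E3 → ℝ := fun j x => (pd j (pd j u) x * A x + pd j u x * A' j x)
    + (-1 / 2) * (d j j x * (pd 0 u x * pd 0 u x) + 2 * (x j * s x * (pd 0 u x * pd j (pd 0 u) x)))
    + (-1 / 2) * (d j j x * (pd 1 u x * pd 1 u x) + 2 * (x j * s x * (pd 1 u x * pd j (pd 1 u) x)))
    + (-1 / 2) * (d j j x * (pd 2 u x * pd 2 u x) + 2 * (x j * s x * (pd 2 u x * pd j (pd 2 u) x)))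
    + (1 / 2) * ((s x * (1 + 3 / 2 * δ ^ 2 * (s x * s x))
        + (x j * s x) * (x j * s x) * ((-3) * s x + (-15 / 2 * δ ^ 2) * (s x * (s x * s x))))
          * ((s x * u x) * (s x * u x))
      + 2 * ((x j * s x) * (s x * (1 + 3 / 2 * δ ^ 2 * (s x * s x))) * ((s x * u x) * pd j u x)))
    with hZ'
  have hZd : ∀ j, HasPD j (Z j) (Z' j) := by
    intro j
    have hq : ∀ k, HasPD j (fun x => (-1 / 2) * (x j * s x * (pd k u x * pd k u x))) _ := fun k =>
      ((hxs j j).mul ((hudd j k).mul (hudd j k))).const_mul (-1 / 2)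
    have hss := (hsd j).mul (hsd j)
    have hc : HasPD j (fun x => 1 + 3 / 2 * δ ^ 2 * (s x * s x)) _ :=
      (show HasPD j (fun _ => (1 : ℝ)) (fun _ => 0) from
        ⟨differentiable_const _, fun x => by simp [pd]⟩).add (hss.const_mul (3 / 2 * δ ^ 2))
    have hU := (hsd j).mul (hud j)
    have hl := (((hxs j j).mul hc).mul (hU.mul hU)).const_mul (1 / 2)
    have := ((((((hudd j j).mul (hAd j)).add (hq 0)).add (hq 1)).add (hq 2)).add hl)
    refine this.congr (fun x => rfl) (fun x => ?_)
    simp only [hZ', hd, if_true]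
    ring
  have hZ'i : ∀ j, Integrable (Z' j) := by
    intro j
    have hq : ∀ k, Integrable fun x => (-1 / 2) * (d j j x * (pd k u x * pd k u x)
        + 2 * (x j * s x * (pd k u x * pd j (pd k u) x))) := fun k =>
      (((bd j j).integrable (h1 k) (h1 k)).add
        (((bx j).integrable (h1 k) (h2 j k)).const_mul 2)).const_mul _
    refine ((((((h2 j j).integrable_mul hAm).add ((h1 j).integrable_mul (hA'm j))).add
      (hq 0)).add (hq 1)).add (hq 2)).add (Integrable.const_mul (Integrable.add ?_ ?_) _)
    · exact ((bs.mul bq).add (((bx j).mul (bx j)).mul (((bc_const _).mul bs).add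
        ((bc_const _).mul (bs.mul (bs.mul bs)))))).integrable h0 h0
    · exact (((bx j).mul (bs.mul bq)).integrable h0 (h1 j)).const_mul _
  have hz : ∀ j, ∫ x, Z' j x = 0 := fun j => integral_pd_eq_zero (hZd j) (hZi j) (hZ'i j)
  have hle : ∀ x, (pd 0 (pd 0 u) x + pd 1 (pd 1 u) x + pd 2 (pd 2 u) x) * A x
      ≤ Z' 0 x + Z' 1 x + Z' 2 x := by
    intro x
    have hr : s x ^ 2 * (x 0 ^ 2 + x 1 ^ 2 + x 2 ^ 2 + δ ^ 2) = 1 := sw_rel hδ x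
    exact morawetz_algebra (x := fun j => x j) (p := fun j => pd j u x)
      (h := fun i j => pd i (pd j u) x) (fun i j => pd_comm hu i j x) (sw_nonneg δ x) hr
      (d := fun j k => d j k x) (A' := fun j => A' j x) (Z := fun j => Z' j x)
      (fun _ _ => rfl) (fun _ => rfl) (fun _ => rfl)
  have hLi : Integrable fun x => (pd 0 (pd 0 u) x + pd 1 (pd 1 u) x + pd 2 (pd 2 u) x) * A x :=
    (((h2 0 0).add (h2 1 1)).add (h2 2 2)).integrable_mul hAm
  calc _ ≤ ∫ x, Z' 0 x + Z' 1 x + Z' 2 x :=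
        integral_mono hLi (((hZ'i 0).add (hZ'i 1)).add (hZ'i 2)) hle
    _ = 0 := integral_add_add_eq_zero hZ'i hz

/-- Hardy's inequality for test functions, with a regularised weight. -/
lemma integral_hardy_test {δ : ℝ} (hδ : 0 < δ) {u : E3 → ℝ} (hu : IsTest u) :
    ∫ x, (sw δ x * u x) ^ 2 ≤ 4 * ∫ x, ‖gradient u x‖ ^ 2 := by
  have hsc := (contDiff_sw hδ).continuous
  have huc := hu.continuous
  have hpc : ∀ j, Continuous (pd j u) := fun j => (hu.pd j).continuous
  have hcc : ∀ j : Fin 3, Continuous fun x : E3 => x j := fun j =>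
    (EuclideanSpace.proj (𝕜 := ℝ) j).continuous
  have hsup : ∀ {F : E3 → ℝ}, Continuous F → (∀ x, u x = 0 → F x = 0) → Integrable F :=
    fun hF h0 => hF.integrable_of_hasCompactSupport (hu.2.mono' fun x hx =>
      subset_tsupport _ fun h => hx (h0 x h))
  -- Integrate the divergence of `x s² u²`, and complete the square: the bound follows from
  -- `0 ≤ (s u + 2 s² x · ∇u)²`, up to terms of a sign which are due to `δ`.
  set Z' : Fin 3 → E3 → ℝ := fun j x => (sw δ x ^ 2 - 2 * x j ^ 2 * sw δ x ^ 4) * u x ^ 2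
    + 2 * x j * sw δ x ^ 2 * u x * pd j u x with hZ'
  have hZ : ∀ j, HasPD j (fun x => x j * (sw δ x * sw δ x) * (u x * u x)) (Z' j) := fun j =>
    ((((hasPD_coord j j).mul ((hasPD_sw hδ j).mul (hasPD_sw hδ j))).mul
      ((hasPD_of_contDiff hu.1 j).mul (hasPD_of_contDiff hu.1 j)))).congr (fun _ => rfl)
      (fun x => by simp [hZ']; ring)
  have hi : ∀ j, Integrable (Z' j) := fun j => hsup
    (by have := hpc j; have := hcc j; fun_prop) (fun x hx => by simp [hZ', hx])
  have hz : ∀ j, ∫ x, Z' j x = 0 := fun j => integral_pd_eq_zero (hZ j)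
    (hsup (by have := hcc j; fun_prop) (fun x hx => by simp [hx])) (hi j)
  have h0 := integral_add_add_eq_zero hi hz
  have hle : ∀ x, (sw δ x * u x) ^ 2 - 4 * ‖gradient u x‖ ^ 2 ≤ 2 * (Z' 0 x + Z' 1 x + Z' 2 x) := by
    intro x
    have hr := sw_rel hδ x
    rw [norm_sq_eq]
    simp only [gradient_apply, hZ']
    set X := x 0 * pd 0 u x + x 1 * pd 1 u x + x 2 * pd 2 u x with hX
    have hl : X ^ 2
        ≤ (x 0 ^ 2 + x 1 ^ 2 + x 2 ^ 2) * (pd 0 u x ^ 2 + pd 1 u x ^ 2 + pd 2 u x ^ 2) := by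
      nlinarith [sq_nonneg (x 0 * pd 1 u x - x 1 * pd 0 u x),
        sq_nonneg (x 0 * pd 2 u x - x 2 * pd 0 u x), sq_nonneg (x 1 * pd 2 u x - x 2 * pd 1 u x)]
    have hx1 : sw δ x ^ 2 * (x 0 ^ 2 + x 1 ^ 2 + x 2 ^ 2) ≤ 1 := by
      nlinarith [sq_nonneg (sw δ x * δ)]
    have hsX : sw δ x ^ 2 * X ^ 2 ≤ pd 0 u x ^ 2 + pd 1 u x ^ 2 + pd 2 u x ^ 2 := by
      calc _ ≤ sw δ x ^ 2 * ((x 0 ^ 2 + x 1 ^ 2 + x 2 ^ 2)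
            * (pd 0 u x ^ 2 + pd 1 u x ^ 2 + pd 2 u x ^ 2)) := by gcongr
        _ = sw δ x ^ 2 * (x 0 ^ 2 + x 1 ^ 2 + x 2 ^ 2)
            * (pd 0 u x ^ 2 + pd 1 u x ^ 2 + pd 2 u x ^ 2) := by ring
        _ ≤ 1 * (pd 0 u x ^ 2 + pd 1 u x ^ 2 + pd 2 u x ^ 2) := by gcongr
        _ = _ := one_mul _
    have hu2 : sw δ x ^ 2 * u x ^ 2 * (sw δ x ^ 2 * (x 0 ^ 2 + x 1 ^ 2 + x 2 ^ 2))
        ≤ sw δ x ^ 2 * u x ^ 2 * 1 := by gcongr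
    nlinarith [sq_nonneg (sw δ x * u x + 2 * (sw δ x * X))]
  have hi1 : Integrable fun x => (sw δ x * u x) ^ 2 := hsup (by fun_prop) (fun x hx => by simp [hx])
  have hi2 : Integrable fun x => ‖gradient u x‖ ^ 2 := by
    refine ((continuous_gradient hu.1).norm.pow 2).integrable_of_hasCompactSupport ?_
    refine (hu.2.fderiv (𝕜 := ℝ)).mono fun x hx => ?_
    intro h
    apply hx
    simp [norm_gradient, h]
  have hfin := integral_mono (hi1.sub (hi2.const_mul 4))
    ((((hi 0).add (hi 1)).add (hi 2)).const_mul 2) hle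
  simp only [Pi.add_apply, Pi.sub_apply] at hfin
  rw [integral_sub hi1 (hi2.const_mul 4), integral_const_mul, integral_const_mul, h0] at hfin
  linarith

/-! ### Hardy's inequality and the multiplier on `Ḣ¹` -/

lemma eLpNorm_two_sq {α E : Type*} [MeasurableSpace α] [NormedAddCommGroup E] {μ : Measure α}
    (f : α → E) : eLpNorm f 2 μ ^ 2 = ∫⁻ x, ‖f x‖ₑ ^ 2 ∂μ := by
  rw [eLpNorm_eq_lintegral_rpow_enorm_toReal (by simp) (by simp)]
  simp only [ENNReal.toReal_ofNat, ENNReal.rpow_ofNat]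
  rw [← ENNReal.rpow_natCast, ← ENNReal.rpow_mul]
  simp

lemma eLpNorm_two_sq_eq_ofReal {α E : Type*} [MeasurableSpace α] [NormedAddCommGroup E]
    {μ : Measure α} {f : α → E} (hf : MemLp f 2 μ) :
    eLpNorm f 2 μ ^ 2 = ENNReal.ofReal (∫ x, ‖f x‖ ^ 2 ∂μ) := by
  rw [eLpNorm_two_sq, ofReal_integral_eq_lintegral_ofReal (hf.integrable_norm_pow two_ne_zero)
    (ae_of_all _ fun x => by positivity)]
  refine lintegral_congr fun x => ?_
  rw [ENNReal.ofReal_pow (norm_nonneg _), ofReal_norm]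

/-- Fatou's lemma for `L^q` norms. -/
lemma eLpNorm_le_of_ae_tendsto {E : Type*} [NormedAddCommGroup E] {f : ℕ → E3 → E} {g : E3 → E}
    {q : ℝ≥0∞} {a : ℕ → ℝ≥0∞} {L : ℝ≥0∞} (hf : ∀ n, AEStronglyMeasurable (f n) volume)
    (hlim : ∀ᵐ x, Tendsto (fun n => f n x) atTop (𝓝 (g x)))
    (hb : ∀ n, eLpNorm (f n) q volume ≤ a n) (ha : Tendsto a atTop (𝓝 L)) :
    eLpNorm g q volume ≤ L := by
  refine (Lp.eLpNorm_lim_le_liminf_eLpNorm hf g hlim).trans ?_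
  rw [← ha.liminf_eq]
  exact liminf_le_liminf (Eventually.of_forall hb)

lemma tendsto_eLpNorm_of_tendsto_sub {E : Type*} [NormedAddCommGroup E] {f : ℕ → E3 → E}
    {g : E3 → E} {q : ℝ≥0∞} (hq : 1 ≤ q) (hf : ∀ n, AEStronglyMeasurable (f n) volume)
    (hg : AEStronglyMeasurable g volume)
    (h : Tendsto (fun n => eLpNorm (f n - g) q volume) atTop (𝓝 0)) (hgt : eLpNorm g q volume ≠ ⊤) :
    Tendsto (fun n => eLpNorm (f n) q volume) atTop (𝓝 (eLpNorm g q volume)) := by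
  have h1 : Tendsto (fun n => eLpNorm g q volume + eLpNorm (f n - g) q volume) atTop
      (𝓝 (eLpNorm g q volume)) := by simpa using h.const_add (eLpNorm g q volume)
  have h2 : Tendsto (fun n => eLpNorm g q volume - eLpNorm (f n - g) q volume) atTop
      (𝓝 (eLpNorm g q volume)) := by
    simpa using ENNReal.Tendsto.sub tendsto_const_nhds h (Or.inl hgt)
  refine tendsto_of_tendsto_of_tendsto_of_le_of_le h2 h1 (fun n => ?_) (fun n => ?_)
  · rw [tsub_le_iff_right]
    calc eLpNorm g q volume = eLpNorm (f n - (f n - g)) q volume := by simp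
      _ ≤ _ := eLpNorm_sub_le (hf n) ((hf n).sub hg) hq
  · calc eLpNorm (f n) q volume = eLpNorm (g + (f n - g)) q volume := by simp
      _ ≤ _ := eLpNorm_add_le hg ((hf n).sub hg) hq

lemma tendsto_sw {δ : ℕ → ℝ} (hδ : Tendsto δ atTop (𝓝 0)) {x : E3} (hx : x ≠ 0) :
    Tendsto (fun n => sw (δ n) x) atTop (𝓝 (sw 0 x)) := by
  have h0 : √(‖x‖ ^ 2 + 0 ^ 2) ≠ 0 := by simpa using hx
  exact (((hδ.pow 2).const_add (‖x‖ ^ 2)).sqrt).inv₀ h0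

lemma ae_ne_zero : ∀ᵐ x : E3, x ≠ 0 := Measure.ae_ne volume 0

/-- Hardy's inequality `‖f / |x|‖₂ ≤ 2 ‖∇f‖₂` in `Ḣ¹`, including the regularised weights. -/
lemma eLpNorm_hardy {f : E3 → ℝ} {G : E3 → E3} (hf : MemLp f 6 volume)
    (hG : MemLp G 2 volume) (h : IsWeakGradient f G) {δ : ℝ} (hδ : 0 ≤ δ) :
    eLpNorm (fun x => sw δ x * f x) 2 volume ≤ 2 * eLpNorm G 2 volume := by
  have hpos : ∀ δ : ℝ, 0 < δ →
      eLpNorm (fun x => sw δ x * f x) 2 volume ≤ 2 * eLpNorm G 2 volume := by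
    intro δ hδ
    obtain ⟨u, hu, -, hg, hae⟩ := exists_isTest_tendsto hf hG h
    have hgm : ∀ n, AEStronglyMeasurable (gradient (u n)) volume := fun n =>
      (continuous_gradient (hu n).1).aestronglyMeasurable
    have hsm := (contDiff_sw hδ).continuous
    refine eLpNorm_le_of_ae_tendsto (f := fun n x => sw δ x * u n x)
      (a := fun n => 2 * eLpNorm (gradient (u n)) 2 volume)
      (fun n => (hsm.mul (hu n).continuous).aestronglyMeasurable) ?_ (fun n => ?_) ?_
    · filter_upwards [hae] with x hx
      exact hx.const_mul _
    · have hm1 : MemLp (fun x => sw δ x * u n x) 2 volume :=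
        (hsm.mul (hu n).continuous).memLp_of_hasCompactSupport (hu n).2.mul_left
      have hm2 : MemLp (gradient (u n)) 2 volume := by
        refine (continuous_gradient (hu n).1).memLp_of_hasCompactSupport ?_
        refine ((hu n).2.fderiv (𝕜 := ℝ)).mono fun x hx h' => hx ?_
        rw [← norm_eq_zero, norm_gradient, h', norm_zero]
      rw [← ENNReal.pow_le_pow_left_iff two_ne_zero, mul_pow, eLpNorm_two_sq_eq_ofReal hm1,
        eLpNorm_two_sq_eq_ofReal hm2]
      have := integral_hardy_test hδ (hu n)
      simp only [Real.norm_eq_abs, sq_abs]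
      calc _ ≤ ENNReal.ofReal (4 * ∫ x, ‖gradient (u n) x‖ ^ 2) := ENNReal.ofReal_le_ofReal this
        _ = _ := by
          rw [ENNReal.ofReal_mul (by norm_num)]
          norm_num
    · exact ENNReal.Tendsto.const_mul (tendsto_eLpNorm_of_tendsto_sub (by norm_num) hgm hG.1 hg
        hG.2.ne) (Or.inr (by simp))
  rcases hδ.eq_or_lt with rfl | hδ
  -- the singular weight, by Fatou's lemma as `δ` tends to `0`
  · refine eLpNorm_le_of_ae_tendsto (f := fun n x => sw (1 / ((n : ℝ) + 1)) x * f x)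
      (fun n => (measurable_sw _).aestronglyMeasurable.mul hf.1) ?_
      (fun n => hpos _ (by positivity)) tendsto_const_nhds
    filter_upwards [ae_ne_zero] with x hx
    exact (tendsto_sw tendsto_one_div_add_atTop_nhds_zero_nat hx).mul_const _
  · exact hpos δ hδ

lemma aestronglyMeasurable_mop {f : E3 → ℝ} {G : E3 → E3} (hf : AEStronglyMeasurable f volume)
    (hG : AEStronglyMeasurable G volume) (δ : ℝ) : AEStronglyMeasurable (mop δ f G) volume := by
  have hs : AEStronglyMeasurable (sw δ) volume := (measurable_sw δ).aestronglyMeasurable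
  have hid : AEStronglyMeasurable (fun x : E3 => x) volume := aestronglyMeasurable_id
  have hc : AEStronglyMeasurable (fun x => sw δ x + δ ^ 2 * sw δ x ^ 3 / 2) volume := by
    have := measurable_sw δ
    exact Measurable.aestronglyMeasurable (by fun_prop)
  exact (hs.mul (hid.inner hG)).add (hc.mul hf)

lemma abs_mop_le (δ : ℝ) (f : E3 → ℝ) (G : E3 → E3) (x : E3) :
    |mop δ f G x| ≤ ‖G x‖ + 3 / 2 * |sw δ x * f x| := by
  have hs := sw_nonneg δ x
  have h1 : |sw δ x * inner ℝ x (G x)| ≤ ‖G x‖ := by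
    rw [abs_mul, abs_of_nonneg hs]
    calc sw δ x * |inner ℝ x (G x)| ≤ sw δ x * (‖x‖ * ‖G x‖) := by
          gcongr; exact abs_real_inner_le_norm _ _
      _ = (sw δ x * ‖x‖) * ‖G x‖ := by ring
      _ ≤ 1 * ‖G x‖ := by gcongr; exact sw_mul_norm_le δ x
      _ = _ := one_mul _
  have h2 : |(sw δ x + δ ^ 2 * sw δ x ^ 3 / 2) * f x| ≤ 3 / 2 * |sw δ x * f x| := by
    have h3 : δ ^ 2 * sw δ x ^ 2 ≤ 1 := by
      have := sw_mul_le δ x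
      calc δ ^ 2 * sw δ x ^ 2 = (sw δ x * |δ|) ^ 2 := by rw [mul_pow, sq_abs]; ring
        _ ≤ 1 := pow_le_one₀ (by positivity) this
    rw [show (sw δ x + δ ^ 2 * sw δ x ^ 3 / 2) * f x
      = (1 + δ ^ 2 * sw δ x ^ 2 / 2) * (sw δ x * f x) by ring, abs_mul,
      abs_of_nonneg (by positivity)]
    gcongr
    linarith
  exact (abs_add_le _ _).trans (add_le_add h1 h2)

/-- The multiplier is bounded from `Ḣ¹` to `L²`, uniformly in `δ`. -/
lemma eLpNorm_mop_le {f : E3 → ℝ} {G : E3 → E3} (hf : MemLp f 6 volume)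
    (hG : MemLp G 2 volume) (h : IsWeakGradient f G) {δ : ℝ} (hδ : 0 ≤ δ) :
    eLpNorm (mop δ f G) 2 volume ≤ 4 * eLpNorm G 2 volume := by
  have hm : AEStronglyMeasurable (fun x => sw δ x * f x) volume :=
    (measurable_sw δ).aestronglyMeasurable.mul hf.1
  calc eLpNorm (mop δ f G) 2 volume
      ≤ eLpNorm ((fun x => ‖G x‖) + fun x => (3 / 2 : ℝ) • |sw δ x * f x|) 2 volume :=
        eLpNorm_mono_real fun x => abs_mop_le δ f G x
    _ ≤ eLpNorm (fun x => ‖G x‖) 2 volume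
        + eLpNorm (fun x => (3 / 2 : ℝ) • |sw δ x * f x|) 2 volume :=
        eLpNorm_add_le hG.1.norm (hm.norm.const_smul (3 / 2 : ℝ)) (by norm_num)
    _ = eLpNorm G 2 volume + ENNReal.ofReal (3 / 2) * eLpNorm (fun x => sw δ x * f x) 2 volume := by
        rw [eLpNorm_norm]
        congr 1
        have := eLpNorm_const_smul (3 / 2 : ℝ) (fun x => |sw δ x * f x|) 2 (volume : Measure E3)
        refine this.trans ?_
        rw [Real.enorm_of_nonneg (by norm_num)]
        congr 1
        exact eLpNorm_norm (fun x => sw δ x * f x)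
    _ ≤ eLpNorm G 2 volume + ENNReal.ofReal (3 / 2) * (2 * eLpNorm G 2 volume) := by
        gcongr
        exact eLpNorm_hardy hf hG h hδ
    _ = 4 * eLpNorm G 2 volume := by
        have : ENNReal.ofReal (3 / 2) * 2 = 3 := by
          rw [← ENNReal.ofReal_ofNat 2, ← ENNReal.ofReal_mul (by norm_num)]
          norm_num
        rw [← mul_assoc, this]
        ring

lemma memLp_mop {f : E3 → ℝ} {G : E3 → E3} (hf : MemLp f 6 volume)
    (hG : MemLp G 2 volume) (h : IsWeakGradient f G) {δ : ℝ} (hδ : 0 ≤ δ) :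
    MemLp (mop δ f G) 2 volume :=
  ⟨aestronglyMeasurable_mop hf.1 hG.1 δ,
    (eLpNorm_mop_le hf hG h hδ).trans_lt (ENNReal.mul_lt_top (by simp) hG.2)⟩

lemma mop_sub (δ : ℝ) (f f' : E3 → ℝ) (G G' : E3 → E3) :
    mop δ (f - f') (G - G') = mop δ f G - mop δ f' G' := by
  ext x
  simp only [mop, Pi.sub_apply, inner_sub_right]
  ring

/-- Joint continuity of the multiplier in `Ḣ¹` and in the regularisation parameter. -/
lemma tendsto_mop {f : E3 → ℝ} {G : E3 → E3} (hf : MemLp f 6 volume)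
    (hG : MemLp G 2 volume) (h : IsWeakGradient f G) {δ : ℕ → ℝ} (hδ : ∀ n, 0 ≤ δ n)
    (hδ0 : Tendsto δ atTop (𝓝 0)) {u : ℕ → E3 → ℝ} {H : ℕ → E3 → E3}
    (hu : ∀ n, MemLp (u n) 6 volume) (hH : ∀ n, MemLp (H n) 2 volume)
    (hw : ∀ n, IsWeakGradient (u n) (H n))
    (hlim : Tendsto (fun n => eLpNorm (H n - G) 2 volume) atTop (𝓝 0)) :
    Tendsto (fun n => eLpNorm (mop (δ n) (u n) (H n) - mop 0 f G) 2 volume) atTop (𝓝 0) := by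
  have hm0 := memLp_mop hf hG h le_rfl
  -- convergence in the parameter alone is dominated convergence
  have h2 : Tendsto (fun n => eLpNorm (mop (δ n) f G - mop 0 f G) 2 volume) atTop (𝓝 0) := by
    set B : E3 → ℝ := fun x => 2 * (‖G x‖ + 3 / 2 * |sw 0 x * f x|) with hB
    have hBm : MemLp B 2 volume := by
      have hh : MemLp (fun x => sw 0 x * f x) 2 volume :=
        ⟨(measurable_sw 0).aestronglyMeasurable.mul hf.1,
          (eLpNorm_hardy hf hG h le_rfl).trans_lt (ENNReal.mul_lt_top (by simp) hG.2)⟩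
      exact (hG.norm.add (hh.abs.const_mul (3 / 2))).const_mul 2
    have hsq : Tendsto (fun n => ∫⁻ x, ‖(mop (δ n) f G - mop 0 f G) x‖ₑ ^ 2) atTop
        (𝓝 (∫⁻ _ : E3, 0)) := by
      refine tendsto_lintegral_of_dominated_convergence' (fun x => ‖B x‖ₑ ^ 2)
        (fun n => ((aestronglyMeasurable_mop hf.1 hG.1 _).sub hm0.1).enorm.pow_const 2)
        (fun n => ?_) ?_ ?_
      · filter_upwards [ae_ne_zero] with x hx
        have hle : ∀ m : ℕ, |mop (δ m) f G x| ≤ ‖G x‖ + 3 / 2 * |sw 0 x * f x| := fun m => by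
          refine (abs_mop_le _ _ _ _).trans ?_
          rw [abs_mul, abs_mul, abs_of_nonneg (sw_nonneg _ _), abs_of_nonneg (sw_nonneg _ _)]
          gcongr
          exact sw_le_sw_zero _ hx
        gcongr
        rw [enorm_le_iff_norm_le]
        simp only [Pi.sub_apply, hB]
        rw [Real.norm_of_nonneg (r := 2 * _) (by positivity)]
        calc _ ≤ |mop (δ n) f G x| + |mop 0 f G x| := abs_sub _ _
          _ ≤ _ := by linarith [hle n, abs_mop_le 0 f G x]
      · rw [← eLpNorm_two_sq]
        exact (ENNReal.pow_lt_top hBm.2).ne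
      · filter_upwards [ae_ne_zero] with x hx
        have hs := tendsto_sw hδ0 hx
        have h3 : Tendsto (fun n => mop (δ n) f G x) atTop (𝓝 (mop 0 f G x)) :=
          (hs.mul_const _).add ((hs.add (((hδ0.pow 2).mul (hs.pow 3)).div_const 2)).mul_const _)
        have h4 := ((h3.sub_const (mop 0 f G x)).enorm).ennrpow_const 2
        simpa using h4
    simp only [← eLpNorm_two_sq, lintegral_zero] at hsq
    have h5 := hsq.ennrpow_const (1 / 2)
    have h6 : ∀ a : ℝ≥0∞, (a ^ 2) ^ (1 / 2 : ℝ) = a := fun a => by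
      rw [← ENNReal.rpow_natCast, ← ENNReal.rpow_mul]
      norm_num
    simp only [h6] at h5
    rwa [ENNReal.zero_rpow_of_pos (by norm_num)] at h5
  have h1 : Tendsto (fun n => 4 * eLpNorm (H n - G) 2 volume
      + eLpNorm (mop (δ n) f G - mop 0 f G) 2 volume) atTop (𝓝 0) := by
    simpa using (ENNReal.Tendsto.const_mul hlim (Or.inr (by simp : (4 : ℝ≥0∞) ≠ ⊤))).add h2
  refine tendsto_of_tendsto_of_tendsto_of_le_of_le tendsto_const_nhds h1 (fun n => zero_le)
    fun n => ?_
  have hsplit : mop (δ n) (u n) (H n) - mop 0 f G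
      = mop (δ n) (u n - f) (H n - G) + (mop (δ n) f G - mop 0 f G) := by
    rw [mop_sub]; ring
  rw [hsplit]
  refine (eLpNorm_add_le (aestronglyMeasurable_mop ((hu n).1.sub hf.1) ((hH n).1.sub hG.1) _)
    ((aestronglyMeasurable_mop hf.1 hG.1 _).sub hm0.1) (by norm_num)).trans ?_
  gcongr
  exact eLpNorm_mop_le ((hu n).sub hf) ((hH n).sub hG) ((hw n).sub h) (hδ n)

/-! ### Averages of plane waves over the unit ball -/

/-- The splitting `ℝ³ = ℝ × ℝ²`. -/
def split3 (z : E3) : ℝ × EuclideanSpace ℝ (Fin 2) := (z 0, WithLp.toLp 2 fun i => z i.succ)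

lemma measurePreserving_split3 : MeasurePreserving split3 volume volume := by
  have h1 := PiLp.volume_preserving_ofLp (Fin 3)
  have h2 := volume_preserving_piFinSuccAbove (fun _ : Fin 3 => ℝ) 0
  have h3 := (MeasurePreserving.id (volume : Measure ℝ)).prod (PiLp.volume_preserving_toLp (Fin 2))
  exact (h3.comp (h2.comp h1))

lemma norm_sq_split3 (z : E3) : ‖z‖ ^ 2 = (split3 z).1 ^ 2 + ‖(split3 z).2‖ ^ 2 := by
  simp [split3, EuclideanSpace.norm_sq_eq, Fin.sum_univ_three, add_assoc]

/-- Integration of a function of one coordinate over the unit ball, by slices. -/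
lemma integral_ball_coord {h : ℝ → ℂ} (hh : Continuous h) :
    ∫ z in Metric.ball (0 : E3) 1, h (z 0)
      = ∫ s in (-1 : ℝ)..1, ((Real.pi * (1 - s ^ 2) : ℝ) : ℂ) * h s := by
  set S : Set (ℝ × EuclideanSpace ℝ (Fin 2)) := {q | q.1 ^ 2 + ‖q.2‖ ^ 2 < 1} with hS
  have hSm : MeasurableSet S := measurableSet_lt (by fun_prop) measurable_const
  set F : ℝ × EuclideanSpace ℝ (Fin 2) → ℂ := S.indicator fun q => h q.1 with hF
  have hSb : S ⊆ Metric.closedBall 0 1 := by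
    rintro ⟨s, y⟩ hq
    simp only [hS, mem_ofPred_eq] at hq
    rw [mem_closedBall_zero_iff, Prod.norm_def, max_le_iff]
    refine ⟨?_, ?_⟩
    · rw [Real.norm_eq_abs, ← sq_le_one_iff_abs_le_one]; nlinarith [sq_nonneg ‖y‖]
    · nlinarith [norm_nonneg y, sq_nonneg s]
  have hFi : Integrable F := by
    rw [integrable_indicator_iff hSm]
    exact ((hh.comp continuous_fst).continuousOn.integrableOn_compact
      (isCompact_closedBall 0 1)).mono_set hSb
  have e1 : ∫ z in Metric.ball (0 : E3) 1, h (z 0) = ∫ z, F (split3 z) := by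
    rw [← integral_indicator Metric.isOpen_ball.measurableSet]
    congr 1; ext z
    have : z ∈ Metric.ball (0 : E3) 1 ↔ split3 z ∈ S := by
      rw [mem_ball_zero_iff, hS, mem_ofPred_eq, ← norm_sq_split3, sq_lt_one_iff₀ (norm_nonneg _)]
    by_cases hz : z ∈ Metric.ball (0 : E3) 1
    · rw [indicator_of_mem hz, hF, indicator_of_mem (this.1 hz)]; rfl
    · rw [indicator_of_notMem hz, hF, indicator_of_notMem (this.not.1 hz)]
  have e2 : ∫ z, F (split3 z) = ∫ q, F q := by
    rw [← measurePreserving_split3.map_eq] at hFi ⊢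
    exact (integral_map measurePreserving_split3.measurable.aemeasurable hFi.1).symm
  have e3 : ∫ q, F q = ∫ s, ∫ y, F (s, y) := by
    rw [Measure.volume_eq_prod] at hFi ⊢
    exact integral_prod _ hFi
  have e4 : ∀ s, ∫ y, F (s, y)
      = (Ioc (-1 : ℝ) 1).indicator (fun s => ((Real.pi * (1 - s ^ 2) : ℝ) : ℂ) * h s) s := by
    intro s
    have hb : ∀ y, F (s, y) = (Metric.ball (0 : EuclideanSpace ℝ (Fin 2)) √(1 - s ^ 2)).indicator
        (fun _ => h s) y := by
      intro y
      have : y ∈ Metric.ball (0 : EuclideanSpace ℝ (Fin 2)) √(1 - s ^ 2) ↔ (s, y) ∈ S := by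
        rw [mem_ball_zero_iff, hS, mem_ofPred_eq, Real.lt_sqrt (norm_nonneg _)]
        constructor <;> intro <;> linarith
      by_cases hy : y ∈ Metric.ball (0 : EuclideanSpace ℝ (Fin 2)) √(1 - s ^ 2)
      · rw [indicator_of_mem hy, hF, indicator_of_mem (this.1 hy)]
      · rw [indicator_of_notMem hy, hF, indicator_of_notMem (this.not.1 hy)]
    simp only [hb]
    rw [integral_indicator_const _ Metric.isOpen_ball.measurableSet, measureReal_def,
      EuclideanSpace.volume_ball_fin_two]
    by_cases hs : s ∈ Ioc (-1 : ℝ) 1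
    · rw [indicator_of_mem hs]
      have : 0 ≤ 1 - s ^ 2 := by nlinarith [hs.1, hs.2]
      rw [ENNReal.toReal_mul, ENNReal.toReal_pow, ENNReal.toReal_ofReal (Real.sqrt_nonneg _),
        ENNReal.toReal_ofReal Real.pi_pos.le, Real.sq_sqrt this]
      simp [mul_comm]
    · rw [indicator_of_notMem hs]
      have : 1 - s ^ 2 ≤ 0 := by
        by_contra hc
        push Not at hc
        have : |s| < 1 := by rw [← sq_lt_one_iff_abs_lt_one]; linarith
        rw [abs_lt] at this
        exact hs ⟨this.1, this.2.le⟩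
      rw [Real.sqrt_eq_zero_of_nonpos this]
      simp
  rw [e1, e2, e3]
  simp only [e4]
  rw [integral_indicator measurableSet_Ioc, intervalIntegral.integral_of_le (by norm_num)]

/-- Integration over the unit ball of a function of `⟪z, ξ⟫`, by rotation invariance. -/
lemma integral_ball_inner {h : ℝ → ℂ} (hh : Continuous h) (ξ : E3) :
    ∫ z in Metric.ball (0 : E3) 1, h (inner ℝ z ξ)
      = ∫ s in (-1 : ℝ)..1, ((Real.pi * (1 - s ^ 2) : ℝ) : ℂ) * h (s * ‖ξ‖) := by
  have hn : ‖‖ξ‖ • ej 0‖ = ‖ξ‖ := by simp [norm_smul, ej]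
  -- the reflection which maps `|ξ| e₀` to `ξ`
  set R := (Submodule.span ℝ {‖ξ‖ • ej 0 - ξ})ᗮ.reflection with hR
  have hRe : R (‖ξ‖ • ej 0) = ξ := Submodule.reflection_sub hn
  have hmp := R.measurePreserving
  rw [← integral_ball_coord (h := fun s => h (s * ‖ξ‖)) (by fun_prop),
    ← integral_indicator Metric.isOpen_ball.measurableSet,
    ← integral_indicator Metric.isOpen_ball.measurableSet,
    ← hmp.integral_comp R.toHomeomorph.measurableEmbedding]
  congr 1; ext z
  have hB : R z ∈ Metric.ball (0 : E3) 1 ↔ z ∈ Metric.ball (0 : E3) 1 := by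
    rw [mem_ball_zero_iff, mem_ball_zero_iff, LinearIsometryEquiv.norm_map]
  have : inner ℝ (R z) ξ = z 0 * ‖ξ‖ := by
    nth_rewrite 1 [← hRe]
    rw [LinearIsometryEquiv.inner_map_map, inner_smul_right, inner_ej, mul_comm]
  by_cases hz : z ∈ Metric.ball (0 : E3) 1
  · rw [indicator_of_mem hz, ← this]; exact indicator_of_mem (hB.2 hz) _
  · rw [indicator_of_notMem hz]; exact indicator_of_notMem (hB.not.2 hz) _

/-- The averaged plane wave in Kirchhoff's formula. -/
lemma integral_ball_plane_wave (t : ℝ) (ξ : E3) :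
    ∫ z in Metric.ball (0 : E3) 1, Complex.exp ((2 * Real.pi * t * inner ℝ z ξ : ℝ) * Complex.I)
        * (3 + (2 * Real.pi * t * inner ℝ z ξ : ℝ) * Complex.I)
      = ((4 * Real.pi * Real.sinc (t * (2 * Real.pi * ‖ξ‖)) : ℝ) : ℂ) := by
  set θ := t * (2 * Real.pi * ‖ξ‖) with hθ
  rw [integral_ball_inner (h := fun y => Complex.exp ((2 * Real.pi * t * y : ℝ) * Complex.I)
        * (3 + (2 * Real.pi * t * y : ℝ) * Complex.I)) (by fun_prop) ξ]
  -- up to a derivative, `π (1 - s²) (3 + i θ s) exp (i θ s)` equals `2 π exp (i θ s)`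
  have hd : ∀ s : ℝ, HasDerivAt (fun s : ℝ => (Real.pi : ℂ) * (((1 - s ^ 2) * s : ℝ) : ℂ)
      * Complex.exp ((θ * s : ℝ) * Complex.I))
      (((Real.pi * (1 - s ^ 2) : ℝ) : ℂ) * (Complex.exp ((2 * Real.pi * t * (s * ‖ξ‖) : ℝ)
        * Complex.I) * (3 + (2 * Real.pi * t * (s * ‖ξ‖) : ℝ) * Complex.I))
        - 2 * Real.pi * Complex.exp ((θ * s : ℝ) * Complex.I)) s := by
    intro s
    have h1 : HasDerivAt (fun s : ℝ => (((1 - s ^ 2) * s : ℝ) : ℂ)) ((1 - 3 * s ^ 2 : ℝ) : ℂ) s := by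
      have : HasDerivAt (fun s : ℝ => (1 - s ^ 2) * s) (1 - 3 * s ^ 2) s := by
        have := (((hasDerivAt_id s).pow 2).const_sub 1).mul (hasDerivAt_id s)
        refine this.congr_deriv ?_
        simp; ring
      exact this.ofReal_comp
    have h2 : HasDerivAt (fun s : ℝ => ((θ * s : ℝ) : ℂ) * Complex.I) ((θ : ℂ) * Complex.I) s := by
      have : HasDerivAt (fun s : ℝ => θ * s) θ s := by simpa using (hasDerivAt_id s).const_mul θ
      exact this.ofReal_comp.mul_const _
    have := (h1.const_mul (Real.pi : ℂ)).mul h2.cexp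
    refine this.congr_deriv ?_
    rw [show 2 * Real.pi * t * (s * ‖ξ‖) = θ * s by rw [hθ]; ring]
    push_cast
    ring
  have hcont : Continuous fun s : ℝ => ((Real.pi * (1 - s ^ 2) : ℝ) : ℂ)
      * (Complex.exp ((2 * Real.pi * t * (s * ‖ξ‖) : ℝ) * Complex.I)
        * (3 + (2 * Real.pi * t * (s * ‖ξ‖) : ℝ) * Complex.I)) := by fun_prop
  have hcont2 : Continuous fun s : ℝ => 2 * (Real.pi : ℂ) * Complex.exp ((θ * s : ℝ) * Complex.I) := by
    fun_prop
  have h3 := intervalIntegral.integral_eq_sub_of_hasDerivAt (a := -1) (b := 1) (fun s _ => hd s)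
    ((hcont.sub hcont2).intervalIntegrable _ _)
  rw [intervalIntegral.integral_sub (hcont.intervalIntegrable _ _) (hcont2.intervalIntegrable _ _)]
    at h3
  simp only [one_pow, sub_self, zero_mul, Complex.ofReal_zero, mul_zero, even_two, Even.neg_pow,
    sub_eq_zero] at h3
  rw [h3, intervalIntegral.integral_const_mul]
  rcases eq_or_ne θ 0 with h0 | h0
  · simp [h0]; ring
  · have h4 : ∀ s : ℝ, ((θ * s : ℝ) : ℂ) * Complex.I = (θ * Complex.I) * s := fun s => by
      push_cast; ring
    simp only [h4]
    rw [integral_exp_mul_complex (by simp [h0]), Real.sinc_of_ne_zero h0]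
    push_cast
    rw [Complex.sin]
    have : (θ : ℂ) ≠ 0 := by exact_mod_cast h0
    field_simp
    rw [Complex.I_sq]
    ring_nf

/-! ### The wave propagators on Schwartz functions -/

/-- The weight `(1 + |x|)⁻⁴`, which dominates the evolution of Schwartz functions. -/
def wt (x : E3) : ℝ := ((1 + ‖x‖) ^ 4)⁻¹

lemma wt_pos (x : E3) : 0 < wt x := by unfold wt; positivity

lemma continuous_wt : Continuous wt := by
  unfold wt
  exact Continuous.inv₀ (by fun_prop) fun x => by positivity

lemma wt_le_one (x : E3) : wt x ≤ 1 :=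
  inv_le_one_of_one_le₀ (one_le_pow₀ (by linarith [norm_nonneg x]))

lemma integrable_wt : Integrable wt := by
  have h : Integrable (fun x : E3 => (1 + ‖x‖) ^ (-(4 : ℝ))) :=
    integrable_one_add_norm (by simp; norm_num)
  refine h.congr (.of_forall fun x => ?_)
  simp only [wt]
  rw [Real.rpow_neg (by positivity)]
  norm_cast

/-- The operator with Fourier multiplier `m (2 π |ξ|)`. -/
def mult (m : ℝ → ℝ) (ψ : 𝓢(E3, ℂ)) : E3 → ℂ :=
  𝓕⁻ (fun ξ : E3 => ((m (2 * Real.pi * ‖ξ‖) : ℝ) : ℂ) * 𝓕 (ψ : E3 → ℂ) ξ)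

lemma mult_apply (m : ℝ → ℝ) (ψ : 𝓢(E3, ℂ)) (x : E3) :
    mult m ψ x = ∫ ξ : E3, Complex.exp ((2 * Real.pi * inner ℝ ξ x : ℝ) * Complex.I) *
      (((m (2 * Real.pi * ‖ξ‖) : ℝ) : ℂ) * 𝓕 (ψ : E3 → ℂ) ξ) := by
  rw [mult, Real.fourierInv_eq']
  rfl

lemma cosProp_eq_mult (t : ℝ) (ψ : 𝓢(E3, ℂ)) : cosProp t ψ = mult (fun a => Real.cos (t * a)) ψ :=
  rfl

lemma sinProp_eq_mult (t : ℝ) (ψ : 𝓢(E3, ℂ)) :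
    sinProp t ψ = mult (fun a => t * Real.sinc (t * a)) ψ := rfl

lemma continuous_fourier (ψ : 𝓢(E3, ℂ)) : Continuous (𝓕 (ψ : E3 → ℂ)) := by
  rw [← SchwartzMap.fourier_coe]; exact (𝓕 ψ).continuous

lemma integrable_pow_fourier (ψ : 𝓢(E3, ℂ)) (k : ℕ) :
    Integrable fun ξ : E3 => ‖ξ‖ ^ k * ‖𝓕 (ψ : E3 → ℂ) ξ‖ := by
  rw [← SchwartzMap.fourier_coe]; exact (𝓕 ψ).integrable_pow_mul volume k

lemma integrable_fourier (ψ : 𝓢(E3, ℂ)) : Integrable (𝓕 (ψ : E3 → ℂ)) := by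
  rw [← SchwartzMap.fourier_coe]; exact (𝓕 ψ).integrable

lemma fourier_laplacian (ψ : 𝓢(E3, ℂ)) (ξ : E3) :
    𝓕 ((Δ ψ : 𝓢(E3, ℂ)) : E3 → ℂ) ξ = -(((2 * Real.pi * ‖ξ‖) ^ 2 : ℝ) : ℂ) * 𝓕 (ψ : E3 → ℂ) ξ := by
  have h : 𝓕 (Δ ψ) = -(2 * Real.pi) ^ 2 •
      (SchwartzMap.smulLeftCLM ℂ fun x : E3 => ‖x‖ ^ 2) (𝓕 ψ) := by
    rw [SchwartzMap.laplacian_eq_fourierMultiplierCLM, FourierTransform.fourier_smul,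
      SchwartzMap.fourierMultiplierCLM_apply, FourierTransform.fourier_fourierInv_eq]
  rw [← SchwartzMap.fourier_coe, ← SchwartzMap.fourier_coe, h, smul_apply,
    SchwartzMap.smulLeftCLM_apply_apply (by fun_prop)]
  simp only [Complex.real_smul]
  push_cast
  ring

lemma fourierInv_fourier_apply (ψ : 𝓢(E3, ℂ)) (x : E3) :
    ∫ ξ : E3, Complex.exp ((2 * Real.pi * inner ℝ ξ x : ℝ) * Complex.I) * 𝓕 (ψ : E3 → ℂ) ξ
      = ψ x := by
  have h : 𝓕⁻ (𝓕 (ψ : E3 → ℂ)) x = ψ x := by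
    rw [← SchwartzMap.fourier_coe, ← SchwartzMap.fourierInv_coe,
      FourierTransform.fourierInv_fourier_eq]
  rw [← h, Real.fourierInv_eq']
  rfl

/-- Joint continuity of `(t, x) ↦ m(t, √-Δ) ψ (x)`; the growth condition is the one satisfied by the
symbols of the wave propagators. -/
lemma continuous_mult {m : ℝ → ℝ → ℝ} (hm : Continuous fun q : ℝ × ℝ => m q.1 q.2)
    (hb : ∀ t a, |m t a| ≤ 1 + |t|) (ψ : 𝓢(E3, ℂ)) :
    Continuous fun q : ℝ × E3 => mult (m q.1) ψ q.2 := by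
  have h : ∀ q : ℝ × E3, mult (m q.1) ψ q.2 = ((1 + |q.1| : ℝ) : ℂ) *
      ∫ ξ : E3, Complex.exp ((2 * Real.pi * inner ℝ ξ q.2 : ℝ) * Complex.I) *
      (((m q.1 (2 * Real.pi * ‖ξ‖) / (1 + |q.1|) : ℝ) : ℂ) * 𝓕 (ψ : E3 → ℂ) ξ) := by
    intro q
    rw [mult_apply, ← integral_const_mul]
    congr 1; ext ξ
    have : ((1 + |q.1| : ℝ) : ℂ) ≠ 0 := by
      exact_mod_cast (by positivity : (1 + |q.1| : ℝ) ≠ 0)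
    rw [Complex.ofReal_div]
    field_simp
  simp only [h]
  refine Continuous.mul (by fun_prop) ?_
  have hψ := continuous_fourier ψ
  refine continuous_of_dominated (bound := fun ξ => ‖𝓕 (ψ : E3 → ℂ) ξ‖) ?_ ?_
    (integrable_fourier ψ).norm ?_
  · intro q
    refine Continuous.aestronglyMeasurable ?_
    have : Continuous fun ξ : E3 => m q.1 (2 * Real.pi * ‖ξ‖) :=
      hm.comp (f := fun ξ : E3 => (q.1, 2 * Real.pi * ‖ξ‖)) (by fun_prop)
    fun_prop
  · refine fun q => .of_forall fun ξ => ?_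
    rw [norm_mul, Complex.norm_exp_ofReal_mul_I, one_mul, norm_mul, Complex.norm_real, Real.norm_eq_abs,
      abs_div, abs_of_pos (by positivity : 0 < 1 + |q.1|)]
    refine mul_le_of_le_one_left (norm_nonneg _) ?_
    rw [div_le_one (by positivity)]
    exact hb _ _
  · refine .of_forall fun ξ => ?_
    have : Continuous fun q : ℝ × E3 => m q.1 (2 * Real.pi * ‖ξ‖) :=
      hm.comp (f := fun q : ℝ × E3 => (q.1, 2 * Real.pi * ‖ξ‖)) (by fun_prop)
    have : Continuous fun q : ℝ × E3 => m q.1 (2 * Real.pi * ‖ξ‖) / (1 + |q.1|) :=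
      this.div (by fun_prop) fun q => by positivity
    fun_prop

/-- Differentiation in time of a family of Fourier multipliers; the linear growth of the derivative
is absorbed by the decay of the Fourier transform of `ψ`. -/
lemma hasDerivAt_mult {m m' : ℝ → ℝ → ℝ} (hm : ∀ t, Continuous (m t)) (hm' : ∀ t, Continuous (m' t))
    (hb : ∀ t a, |m t a| ≤ 1 + |t|) (hb' : ∀ t a, |m' t a| ≤ 1 + |a|)
    (hd : ∀ t a, HasDerivAt (fun s => m s a) (m' t a) t) (ψ : 𝓢(E3, ℂ)) (t : ℝ) (x : E3) :
    HasDerivAt (fun s => mult (m s) ψ x) (mult (m' t) ψ x) t := by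
  simp only [mult_apply]
  have hψ := continuous_fourier ψ
  have hmc : ∀ s, Continuous fun ξ : E3 => m s (2 * Real.pi * ‖ξ‖) := fun s =>
    (hm s).comp (by fun_prop)
  have hmc' : ∀ s, Continuous fun ξ : E3 => m' s (2 * Real.pi * ‖ξ‖) := fun s =>
    (hm' s).comp (by fun_prop)
  have hc : ∀ s, Continuous fun ξ : E3 =>
      Complex.exp ((2 * Real.pi * inner ℝ ξ x : ℝ) * Complex.I) *
      (((m s (2 * Real.pi * ‖ξ‖) : ℝ) : ℂ) * 𝓕 (ψ : E3 → ℂ) ξ) := fun s => by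
    have := hmc s; fun_prop
  have hc' : ∀ s, Continuous fun ξ : E3 =>
      Complex.exp ((2 * Real.pi * inner ℝ ξ x : ℝ) * Complex.I) *
      (((m' s (2 * Real.pi * ‖ξ‖) : ℝ) : ℂ) * 𝓕 (ψ : E3 → ℂ) ξ) := fun s => by
    have := hmc' s; fun_prop
  refine (hasDerivAt_integral_of_dominated_loc_of_deriv_le (s := univ)
    (F' := fun s ξ => Complex.exp ((2 * Real.pi * inner ℝ ξ x : ℝ) * Complex.I) *
      (((m' s (2 * Real.pi * ‖ξ‖) : ℝ) : ℂ) * 𝓕 (ψ : E3 → ℂ) ξ))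
    (bound := fun ξ => (1 + 2 * Real.pi * ‖ξ‖) * ‖𝓕 (ψ : E3 → ℂ) ξ‖) univ_mem
    (.of_forall fun s => (hc s).aestronglyMeasurable) ?_ (hc' t).aestronglyMeasurable ?_ ?_ ?_).2
  · refine ((integrable_fourier ψ).norm.const_mul (1 + |t|)).mono' (hc t).aestronglyMeasurable
      (.of_forall fun ξ => ?_)
    rw [norm_mul, Complex.norm_exp_ofReal_mul_I, one_mul, norm_mul, Complex.norm_real, Real.norm_eq_abs]
    gcongr
    exact hb _ _
  · refine .of_forall fun ξ s _ => ?_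
    rw [norm_mul, Complex.norm_exp_ofReal_mul_I, one_mul, norm_mul, Complex.norm_real, Real.norm_eq_abs]
    gcongr
    refine (hb' _ _).trans (le_of_eq ?_)
    rw [abs_of_nonneg (by positivity)]
  · refine ((integrable_fourier ψ).norm.add ((integrable_pow_fourier ψ 1).const_mul
      (2 * Real.pi))).congr (.of_forall fun ξ => ?_)
    simp only [Pi.add_apply]
    ring
  · refine .of_forall fun ξ s _ => ?_
    exact (((hd s _).ofReal_comp).mul_const _).const_mul _

lemma hasDerivAt_mul_sinc (a t : ℝ) :
    HasDerivAt (fun s => s * Real.sinc (s * a)) (Real.cos (t * a)) t := by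
  rcases eq_or_ne a 0 with rfl | ha
  · simpa using hasDerivAt_id' t
  · have h : (fun s => s * Real.sinc (s * a)) = fun s => Real.sin (s * a) / a := by
      ext s
      rcases eq_or_ne s 0 with rfl | hs
      · simp
      · rw [Real.sinc_of_ne_zero (mul_ne_zero hs ha)]; field_simp
    rw [h]
    have := (((hasDerivAt_id t).mul_const a).sin).div_const a
    refine this.congr_deriv ?_
    simp [ha]

lemma mul_mul_sinc (a t : ℝ) : a * (t * Real.sinc (t * a)) = Real.sin (t * a) := by
  rcases eq_or_ne (t * a) 0 with h | h
  · rcases mul_eq_zero.1 h with rfl | rfl <;> simp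
  · rw [Real.sinc_of_ne_zero h]
    have := mul_ne_zero_iff.1 h
    field_simp [this.1, this.2]

lemma abs_mul_sinc_le (a t : ℝ) : |t * Real.sinc (t * a)| ≤ |t| := by
  rw [abs_mul]
  exact mul_le_of_le_one_right (abs_nonneg _) (abs_le.2 ⟨Real.neg_one_le_sinc _, Real.sinc_le_one _⟩)

lemma continuous_cosProp (ψ : 𝓢(E3, ℂ)) : Continuous fun q : ℝ × E3 => cosProp q.1 ψ q.2 :=
  continuous_mult (m := fun t a => Real.cos (t * a)) (by fun_prop)
    (fun t a => (Real.abs_cos_le_one _).trans (by simp)) ψ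

lemma continuous_sinProp (ψ : 𝓢(E3, ℂ)) : Continuous fun q : ℝ × E3 => sinProp q.1 ψ q.2 :=
  continuous_mult (m := fun t a => t * Real.sinc (t * a))
    (continuous_fst.mul (Real.continuous_sinc.comp (by fun_prop)))
    (fun t a => (abs_mul_sinc_le a t).trans (by simp)) ψ

lemma hasDerivAt_sinProp (ψ : 𝓢(E3, ℂ)) (t : ℝ) (x : E3) :
    HasDerivAt (fun s => sinProp s ψ x) (cosProp t ψ x) t :=
  hasDerivAt_mult (m := fun t a => t * Real.sinc (t * a)) (m' := fun t a => Real.cos (t * a))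
    (fun t => continuous_const.mul (Real.continuous_sinc.comp (by fun_prop))) (by fun_prop)
    (fun t a => (abs_mul_sinc_le a t).trans (by simp))
    (fun t a => (Real.abs_cos_le_one _).trans (by simp)) (fun t a => hasDerivAt_mul_sinc a t) ψ t x

/-- The derivative `-√-Δ sin (t √-Δ)` of `cos (t √-Δ)`, written as `(sin (t √-Δ) / √-Δ) Δ`. -/
lemma hasDerivAt_cosProp (ψ : 𝓢(E3, ℂ)) (t : ℝ) (x : E3) :
    HasDerivAt (fun s => cosProp s ψ x) (sinProp t (Δ ψ) x) t := by
  have h : sinProp t (Δ ψ) x = mult (fun a => -(a * Real.sin (t * a))) ψ x := by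
    rw [sinProp_eq_mult, mult_apply, mult_apply]
    congr 1; ext ξ
    rw [fourier_laplacian, ← mul_mul_sinc]
    push_cast
    ring
  rw [h]
  refine hasDerivAt_mult (m := fun t a => Real.cos (t * a)) (m' := fun t a => -(a * Real.sin (t * a)))
    (by fun_prop) (by fun_prop) (fun t a => (Real.abs_cos_le_one _).trans (by simp)) (fun t a => ?_)
    (fun t a => ?_) ψ t x
  · rw [abs_neg, abs_mul]
    have := mul_le_of_le_one_right (abs_nonneg a) (Real.abs_sin_le_one (t * a))
    linarith
  · have := ((hasDerivAt_id t).mul_const a).cos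
    refine this.congr_deriv ?_
    simp; ring

lemma cosProp_zero (ψ : 𝓢(E3, ℂ)) (x : E3) : cosProp 0 ψ x = ψ x := by
  rw [cosProp_eq_mult, mult_apply, ← fourierInv_fourier_apply ψ x]
  simp

lemma sinProp_zero (ψ : 𝓢(E3, ℂ)) (x : E3) : sinProp 0 ψ x = 0 := by
  rw [sinProp_eq_mult, mult_apply]
  simp

open LineDeriv in
/-- Fourier inversion for a directional derivative. -/
lemma fourierInv_fourier_deriv (ψ : 𝓢(E3, ℂ)) (x z : E3) :
    ∫ ξ : E3, Complex.exp ((2 * Real.pi * inner ℝ ξ x : ℝ) * Complex.I) *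
      (((2 * Real.pi * inner ℝ z ξ : ℝ) : ℂ) * Complex.I * 𝓕 (ψ : E3 → ℂ) ξ)
      = fderiv ℝ ψ x z := by
  rw [← SchwartzMap.lineDerivOp_apply_eq_fderiv, ← fourierInv_fourier_apply]
  congr 1; ext ξ
  rw [← SchwartzMap.fourier_coe, ← SchwartzMap.fourier_coe, SchwartzMap.fourier_lineDerivOp_eq,
    smul_apply, SchwartzMap.smulLeftCLM_apply_apply (by fun_prop), real_inner_comm ξ z]
  simp only [Complex.real_smul, smul_eq_mul]
  push_cast
  ring

/-- Kirchhoff's formula for `sin (t √-Δ) / √-Δ`, with the spherical means written as integrals over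
the unit ball. -/
lemma sinProp_eq_integral_ball (t : ℝ) (ψ : 𝓢(E3, ℂ)) (x : E3) :
    sinProp t ψ x = ((t / (4 * Real.pi) : ℝ) : ℂ) * ∫ z in Metric.ball (0 : E3) 1,
      (3 * ψ (x + t • z) + t * fderiv ℝ ψ (x + t • z) z) := by
  have hψ := continuous_fourier ψ
  -- Write the right-hand side as a Fourier integral, exchange the integrals, and average the plane
  -- waves over the ball.
  set K : E3 → E3 → ℂ := fun z ξ =>
    Complex.exp ((2 * Real.pi * inner ℝ ξ x : ℝ) * Complex.I) * 𝓕 (ψ : E3 → ℂ) ξ *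
    (Complex.exp ((2 * Real.pi * t * inner ℝ z ξ : ℝ) * Complex.I)
        * (3 + (2 * Real.pi * t * inner ℝ z ξ : ℝ) * Complex.I)) with hK
  have hKc : Continuous fun q : E3 × E3 => K q.1 q.2 := by simp only [hK]; fun_prop
  have hKb : ∀ z ∈ Metric.ball (0 : E3) 1, ∀ ξ, ‖K z ξ‖ ≤
      (3 + 2 * Real.pi * |t| * ‖ξ‖) * ‖𝓕 (ψ : E3 → ℂ) ξ‖ := by
    intro z hz ξ
    rw [mem_ball_zero_iff] at hz
    simp only [hK]
    rw [norm_mul, norm_mul, norm_mul, Complex.norm_exp_ofReal_mul_I, Complex.norm_exp_ofReal_mul_I, one_mul,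
      one_mul, mul_comm]
    gcongr
    refine (norm_add_le _ _).trans ?_
    rw [norm_mul, Complex.norm_I, mul_one, Complex.norm_real, Real.norm_eq_abs, abs_mul, abs_mul,
      abs_of_pos (by positivity : 0 < 2 * Real.pi)]
    have h1 := abs_real_inner_le_norm z ξ
    have h2 : ‖z‖ * ‖ξ‖ ≤ ‖ξ‖ := mul_le_of_le_one_left (norm_nonneg _) hz.le
    have h3 : |inner ℝ z ξ| ≤ ‖ξ‖ := h1.trans h2
    simp only [Complex.norm_ofNat]
    gcongr
  have hg : Integrable fun ξ : E3 => (3 + 2 * Real.pi * |t| * ‖ξ‖) * ‖𝓕 (ψ : E3 → ℂ) ξ‖ := by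
    refine (((integrable_fourier ψ).norm.const_mul 3).add ((integrable_pow_fourier ψ 1).const_mul
      (2 * Real.pi * |t|))).congr (.of_forall fun ξ => ?_)
    simp only [Pi.add_apply]
    ring
  have hfin : IsFiniteMeasure (volume.restrict (Metric.ball (0 : E3) 1)) :=
    ⟨by rw [Measure.restrict_apply_univ]; exact measure_ball_lt_top⟩
  have hint : Integrable (fun q : E3 × E3 => K q.1 q.2)
      ((volume.restrict (Metric.ball (0 : E3) 1)).prod volume) := by
    have h1 : Integrable (fun q : E3 × E3 => (1 : ℝ) *
        ((3 + 2 * Real.pi * |t| * ‖q.2‖) * ‖𝓕 (ψ : E3 → ℂ) q.2‖))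
        ((volume.restrict (Metric.ball (0 : E3) 1)).prod volume) :=
      (integrable_const (1 : ℝ)).mul_prod hg
    refine h1.mono' hKc.aestronglyMeasurable ?_
    have : ∀ᵐ z ∂(volume.restrict (Metric.ball (0 : E3) 1)), z ∈ Metric.ball (0 : E3) 1 :=
      ae_restrict_mem Metric.isOpen_ball.measurableSet
    have h2 := Measure.quasiMeasurePreserving_fst (μ := volume.restrict (Metric.ball (0 : E3) 1))
      (ν := (volume : Measure E3)) |>.ae this
    filter_upwards [h2] with q hq
    rw [one_mul]
    exact hKb _ hq _
  have e1 : ∀ z ∈ Metric.ball (0 : E3) 1, ∫ ξ, K z ξ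
      = 3 * ψ (x + t • z) + t * fderiv ℝ ψ (x + t • z) z := by
    intro z _
    rw [← fourierInv_fourier_apply ψ, ← fourierInv_fourier_deriv, ← integral_const_mul,
      ← integral_const_mul, ← integral_add]
    · congr 1; ext ξ
      simp only [hK]
      have : Complex.exp ((2 * Real.pi * inner ℝ ξ (x + t • z) : ℝ) * Complex.I)
          = Complex.exp ((2 * Real.pi * inner ℝ ξ x : ℝ) * Complex.I) *
            Complex.exp ((2 * Real.pi * t * inner ℝ z ξ : ℝ) * Complex.I) := by
        rw [← Complex.exp_add, inner_add_right, inner_smul_right, real_inner_comm ξ z]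
        congr 1
        push_cast
        ring
      rw [this]
      push_cast
      ring
    · refine Integrable.const_mul ?_ _
      refine (integrable_fourier ψ).norm.mono' (by fun_prop) (.of_forall fun ξ => ?_)
      rw [norm_mul, Complex.norm_exp_ofReal_mul_I, one_mul]
    · refine Integrable.const_mul ?_ _
      refine ((integrable_pow_fourier ψ 1).const_mul (2 * Real.pi * ‖z‖)).mono' (by fun_prop)
        (.of_forall fun ξ => ?_)
      rw [norm_mul, Complex.norm_exp_ofReal_mul_I, one_mul, norm_mul, norm_mul, Complex.norm_I, mul_one,
        Complex.norm_real, Real.norm_eq_abs, abs_mul, abs_of_pos (by positivity : 0 < 2 * Real.pi)]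
      have h1 := abs_real_inner_le_norm z ξ
      calc 2 * Real.pi * |inner ℝ z ξ| * ‖𝓕 (ψ : E3 → ℂ) ξ‖
          ≤ 2 * Real.pi * (‖z‖ * ‖ξ‖) * ‖𝓕 (ψ : E3 → ℂ) ξ‖ := by gcongr
        _ = _ := by ring
  rw [← setIntegral_congr_fun Metric.isOpen_ball.measurableSet e1, integral_integral_swap hint,
    sinProp_eq_mult, mult_apply, ← integral_const_mul]
  congr 1; ext ξ
  simp only [hK]
  rw [integral_const_mul, integral_ball_plane_wave]
  have : (Real.pi : ℂ) ≠ 0 := by exact_mod_cast Real.pi_ne_zero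
  push_cast
  field_simp

lemma exists_schwartz_bound (ψ : 𝓢(E3, ℂ)) :
    ∃ C, 0 ≤ C ∧ ∀ x, ‖ψ x‖ ≤ C * wt x ∧ ‖fderiv ℝ ψ x‖ ≤ C * wt x := by
  set C := 2 ^ 4 * ((Finset.Iic (4, 1)).sup fun m => SchwartzMap.seminorm ℝ m.1 m.2) ψ
  have h0 := fun x => SchwartzMap.one_add_le_sup_seminorm_apply (𝕜 := ℝ) (m := (4, 1)) (k := 4)
    (n := 0) le_rfl (by norm_num) ψ x
  have h1 := fun x => SchwartzMap.one_add_le_sup_seminorm_apply (𝕜 := ℝ) (m := (4, 1)) (k := 4)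
    (n := 1) le_rfl le_rfl ψ x
  refine ⟨C, by positivity, fun x => ?_⟩
  have hx : 0 < (1 + ‖x‖) ^ 4 := by positivity
  rw [wt, ← div_eq_mul_inv, le_div_iff₀ hx, le_div_iff₀ hx]
  constructor
  · have := h0 x
    rwa [norm_iteratedFDeriv_zero, mul_comm] at this
  · have := h1 x
    rwa [norm_iteratedFDeriv_one, mul_comm] at this

lemma wt_add_le {x y : E3} {T : ℝ} (hy : ‖y‖ ≤ T) : wt (x + y) ≤ (1 + T) ^ 4 * wt x := by
  have hT : 0 ≤ T := (norm_nonneg y).trans hy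
  rw [wt, wt, ← div_eq_mul_inv, inv_le_comm₀ (by positivity) (by positivity), inv_div,
    div_le_iff₀ (by positivity), ← mul_pow]
  gcongr
  have h1 : ‖x‖ ≤ ‖x + y‖ + ‖y‖ := by simpa using norm_sub_le (x + y) y
  nlinarith [norm_nonneg (x + y)]

/-- By Kirchhoff's formula, `(sin (t √-Δ) / √-Δ) ψ (x)` only involves values of `ψ` at distance at most
`|t|` from `x`; hence the decay of `ψ` is preserved, locally uniformly in time. -/
lemma exists_sinProp_bound (ψ : 𝓢(E3, ℂ)) (T : ℝ) :
    ∃ C, 0 ≤ C ∧ ∀ t, |t| ≤ T → ∀ x, ‖sinProp t ψ x‖ ≤ C * wt x := by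
  rcases lt_or_ge T 0 with hT | hT
  · exact ⟨0, le_rfl, fun t ht => absurd (ht.trans_lt hT) (abs_nonneg t).not_gt⟩
  obtain ⟨C, hC0, hC⟩ := exists_schwartz_bound ψ
  refine ⟨T / (4 * Real.pi) * (((3 + T) * (C * (1 + T) ^ 4)) *
    volume.real (Metric.ball (0 : E3) 1)), by positivity, fun t ht x => ?_⟩
  rw [sinProp_eq_integral_ball, norm_mul, Complex.norm_real, Real.norm_eq_abs, abs_div,
    abs_of_pos (by positivity : 0 < 4 * Real.pi), mul_assoc]
  gcongr
  refine (norm_setIntegral_le_of_norm_le_const measure_ball_lt_top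
    (C := ((3 + T) * (C * (1 + T) ^ 4)) * wt x) fun z hz => ?_).trans (le_of_eq (by ring))
  rw [mem_ball_zero_iff] at hz
  have h1 : ‖t • z‖ ≤ T := by
    rw [norm_smul, Real.norm_eq_abs]
    nlinarith [abs_nonneg t, norm_nonneg z]
  have h2 := wt_add_le (x := x) h1
  have h3 : C * wt (x + t • z) ≤ C * ((1 + T) ^ 4 * wt x) := by gcongr
  have h4 := (hC (x + t • z)).1
  have h5 : ‖fderiv ℝ ψ (x + t • z) z‖ ≤ C * wt (x + t • z) :=
    ((fderiv ℝ ψ (x + t • z)).le_opNorm z).trans ((mul_le_of_le_one_right (norm_nonneg _) hz.le).trans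
      (hC (x + t • z)).2)
  refine (norm_add_le _ _).trans ?_
  rw [norm_mul, norm_mul, Complex.norm_real, Real.norm_eq_abs, Complex.norm_ofNat]
  calc 3 * ‖ψ (x + t • z)‖ + |t| * ‖fderiv ℝ ψ (x + t • z) z‖
      ≤ 3 * (C * ((1 + T) ^ 4 * wt x)) + T * (C * ((1 + T) ^ 4 * wt x)) := by
        gcongr
        · exact h4.trans h3
        · exact h5.trans h3
    _ = _ := by ring

/-- The decay of `cos (t √-Δ) ψ`, from its time derivative `(sin (t √-Δ) / √-Δ) Δψ`. -/
lemma exists_cosProp_bound (ψ : 𝓢(E3, ℂ)) (T : ℝ) :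
    ∃ C, 0 ≤ C ∧ ∀ t, |t| ≤ T → ∀ x, ‖cosProp t ψ x‖ ≤ C * wt x := by
  rcases lt_or_ge T 0 with hT | hT
  · exact ⟨0, le_rfl, fun t ht => absurd (ht.trans_lt hT) (abs_nonneg t).not_gt⟩
  obtain ⟨C, hC0, hC⟩ := exists_schwartz_bound ψ
  obtain ⟨D, hD0, hD⟩ := exists_sinProp_bound (Δ ψ) T
  refine ⟨C + D * T, by positivity, fun t ht x => ?_⟩
  have h1 : ∫ s in (0 : ℝ)..t, sinProp s (Δ ψ) x = cosProp t ψ x - ψ x := by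
    rw [← cosProp_zero]
    refine intervalIntegral.integral_eq_sub_of_hasDerivAt (fun s _ => hasDerivAt_cosProp ψ s x) ?_
    have := (continuous_sinProp (Δ ψ)).comp (f := fun s : ℝ => (s, x)) (by fun_prop)
    exact this.intervalIntegrable _ _
  have h2 : ‖∫ s in (0 : ℝ)..t, sinProp s (Δ ψ) x‖ ≤ D * wt x * |t - 0| := by
    refine intervalIntegral.norm_integral_le_of_norm_le_const fun s hs => hD s ?_ x
    refine le_trans ?_ ht
    rcases le_total 0 t with h | h
    · rw [uIoc_of_le h] at hs
      rw [abs_of_nonneg h, abs_of_nonneg hs.1.le]; exact hs.2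
    · rw [uIoc_of_ge h] at hs
      rw [abs_of_nonpos h, abs_of_nonpos hs.2]; linarith [hs.1]
  have h3 : cosProp t ψ x = ψ x + ∫ s in (0 : ℝ)..t, sinProp s (Δ ψ) x := by rw [h1]; ring
  rw [h3]
  refine (norm_add_le _ _).trans ?_
  rw [sub_zero] at h2
  have h4 : D * wt x * |t| ≤ D * wt x * T := by
    have := wt_pos x
    gcongr
  have := (hC x).1
  nlinarith

/-! ### From the integral equation to the weak wave equation -/

/-- Time dependent kernels that are jointly continuous and dominated by `wt`, locally uniformly in
time. -/
structure IsKernel (K : ℝ → E3 → ℂ) : Prop where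
  cont : Continuous fun q : ℝ × E3 => K q.1 q.2
  bound : ∀ T : ℝ, ∃ C, 0 ≤ C ∧ ∀ t, |t| ≤ T → ∀ x, ‖K t x‖ ≤ C * wt x

lemma isKernel_sinProp (ψ : 𝓢(E3, ℂ)) : IsKernel fun t => sinProp t ψ :=
  ⟨continuous_sinProp ψ, exists_sinProp_bound ψ⟩

lemma isKernel_cosProp (ψ : 𝓢(E3, ℂ)) : IsKernel fun t => cosProp t ψ :=
  ⟨continuous_cosProp ψ, exists_cosProp_bound ψ⟩

lemma IsKernel.continuous {K : ℝ → E3 → ℂ} (hK : IsKernel K) (t : ℝ) : Continuous (K t) :=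
  hK.cont.comp (f := fun x => (t, x)) (by fun_prop)

/-- Integrability against the weight `wt`. -/
def WInt (f : E3 → ℝ) : Prop := AEStronglyMeasurable f volume ∧ Integrable fun x => |f x| * wt x

lemma WInt.sub {f g : E3 → ℝ} (hf : WInt f) (hg : WInt g) : WInt (f - g) := by
  refine ⟨hf.1.sub hg.1, (hf.2.add hg.2).mono' ?_ (.of_forall fun x => ?_)⟩
  · exact ((hf.1.sub hg.1).norm).mul continuous_wt.aestronglyMeasurable
  · rw [norm_mul, Real.norm_eq_abs, Real.norm_eq_abs, abs_abs, abs_of_pos (wt_pos x)]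
    simp only [Pi.add_apply, Pi.sub_apply, ← add_mul]
    have := (wt_pos x).le
    gcongr
    exact abs_sub _ _

lemma norm_ofReal_mul_le {f : E3 → ℝ} {g : E3 → ℂ} {C : ℝ} (hg : ∀ x, ‖g x‖ ≤ C * wt x) (x : E3) :
    ‖(f x : ℂ) * g x‖ ≤ C * (|f x| * wt x) := by
  rw [norm_mul, Complex.norm_real, Real.norm_eq_abs]
  have := mul_le_mul_of_nonneg_left (hg x) (abs_nonneg (f x))
  linarith

lemma WInt.integrable_mul {f : E3 → ℝ} (hf : WInt f) {g : E3 → ℂ} (hgc : Continuous g) {C : ℝ}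
    (hg : ∀ x, ‖g x‖ ≤ C * wt x) : Integrable fun x => (f x : ℂ) * g x :=
  (hf.2.const_mul C).mono' ((Complex.continuous_ofReal.comp_aestronglyMeasurable hf.1).mul
    hgc.aestronglyMeasurable) (.of_forall fun x => norm_ofReal_mul_le hg x)

lemma WInt.norm_pairing_le {f : E3 → ℝ} (hf : WInt f) {g : E3 → ℂ} {C : ℝ}
    (hg : ∀ x, ‖g x‖ ≤ C * wt x) : ‖pairing f g‖ ≤ C * ∫ x, |f x| * wt x := by
  rw [pairing, ← integral_const_mul]
  exact norm_integral_le_of_norm_le (hf.2.const_mul C)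
    (.of_forall fun x => norm_ofReal_mul_le hg x)

lemma pairing_sub_left {f g : E3 → ℝ} (hf : WInt f) (hg : WInt g) {K : ℝ → E3 → ℂ}
    (hK : IsKernel K) (s : ℝ) : pairing (f - g) (K s) = pairing f (K s) - pairing g (K s) := by
  obtain ⟨C, -, hC⟩ := hK.bound |s|
  rw [pairing, pairing, pairing, ← integral_sub]
  · congr 1; ext x; simp [sub_mul]
  · exact hf.integrable_mul (hK.continuous s) (hC s le_rfl)
  · exact hg.integrable_mul (hK.continuous s) (hC s le_rfl)

lemma abs_le_of_mem_ball {s t : ℝ} (hs : s ∈ Metric.ball t 1) : |s| ≤ |t| + 1 := by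
  rw [Metric.mem_ball, Real.dist_eq] at hs
  have := abs_add_le (s - t) t
  rw [sub_add_cancel] at this
  linarith

lemma continuous_pairing {f : E3 → ℝ} (hf : WInt f) {K : ℝ → E3 → ℂ} (hK : IsKernel K) :
    Continuous fun s => pairing f (K s) := by
  refine continuous_iff_continuousAt.2 fun s => ?_
  obtain ⟨C, -, hC⟩ := hK.bound (|s| + 1)
  refine tendsto_integral_filter_of_dominated_convergence (fun x => C * (|f x| * wt x)) ?_ ?_
    (hf.2.const_mul C) ?_
  · exact .of_forall fun r => (Complex.continuous_ofReal.comp_aestronglyMeasurable hf.1).mul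
      (hK.continuous r).aestronglyMeasurable
  · filter_upwards [Metric.ball_mem_nhds s one_pos] with r hr
    exact .of_forall fun x => norm_ofReal_mul_le (hC r (abs_le_of_mem_ball hr)) x
  · refine .of_forall fun x => ?_
    have : Continuous fun s => (f x : ℂ) * K s x :=
      continuous_const.mul (hK.cont.comp (f := fun s => (s, x)) (by fun_prop))
    exact this.tendsto s

lemma hasDerivAt_pairing {f : E3 → ℝ} (hf : WInt f) {K K' : ℝ → E3 → ℂ} (hK : IsKernel K)
    (hK' : IsKernel K') (hd : ∀ t x, HasDerivAt (fun s => K s x) (K' t x) t) (t : ℝ) :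
    HasDerivAt (fun s => pairing f (K s)) (pairing f (K' t)) t := by
  obtain ⟨C, -, hC⟩ := hK.bound |t|
  obtain ⟨C', -, hC'⟩ := hK'.bound (|t| + 1)
  have hm : AEStronglyMeasurable (fun x => (f x : ℂ)) volume :=
    Complex.continuous_ofReal.comp_aestronglyMeasurable hf.1
  refine (hasDerivAt_integral_of_dominated_loc_of_deriv_le (Metric.ball_mem_nhds t one_pos)
    (F' := fun s x => (f x : ℂ) * K' s x)
    (bound := fun x => C' * (|f x| * wt x)) (.of_forall fun s => ?_) ?_ ?_ ?_
    (hf.2.const_mul C') ?_).2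
  · exact hm.mul (hK.continuous s).aestronglyMeasurable
  · exact hf.integrable_mul (hK.continuous t) (hC t le_rfl)
  · exact hm.mul (hK'.continuous t).aestronglyMeasurable
  · exact .of_forall fun x s hs => norm_ofReal_mul_le (hC' s (abs_le_of_mem_ball hs)) x
  · exact .of_forall fun x s _ => (hd s x).const_mul _

/-- Continuity of a path of functions in the weighted space `L¹(wt)`. -/
structure WCont (F : ℝ → E3 → ℝ) : Prop where
  wint : ∀ t, WInt (F t)
  cont : ∀ t, Tendsto (fun s => ∫ x, |F s x - F t x| * wt x) (𝓝 t) (𝓝 0)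

lemma continuous_pairing_prod {F : ℝ → E3 → ℝ} (hF : WCont F) {K : ℝ → E3 → ℂ} (hK : IsKernel K) :
    Continuous fun q : ℝ × ℝ => pairing (F q.1) (K q.2) := by
  refine continuous_iff_continuousAt.2 fun ⟨t, s⟩ => ?_
  obtain ⟨C, hC0, hC⟩ := hK.bound (|s| + 1)
  have h1 : Tendsto (fun q : ℝ × ℝ => pairing (F t) (K q.2)) (𝓝 (t, s)) (𝓝 (pairing (F t) (K s))) :=
    ((continuous_pairing (hF.wint t) hK).comp continuous_snd).tendsto (t, s)
  have h2 : Tendsto (fun q : ℝ × ℝ => pairing (F q.1) (K q.2) - pairing (F t) (K q.2))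
      (𝓝 (t, s)) (𝓝 0) := by
    have h3 : Tendsto (fun q : ℝ × ℝ => C * ∫ x, |F q.1 x - F t x| * wt x) (𝓝 (t, s)) (𝓝 0) := by
      have := ((hF.cont t).comp (continuous_fst.tendsto (t, s))).const_mul C
      simpa using this
    refine squeeze_zero_norm' ?_ h3
    have : ∀ᶠ q : ℝ × ℝ in 𝓝 (t, s), q.2 ∈ Metric.ball s 1 :=
      (continuous_snd.tendsto (t, s)).eventually (Metric.ball_mem_nhds s one_pos)
    filter_upwards [this] with q hq
    rw [← pairing_sub_left (hF.wint _) (hF.wint _) hK]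
    exact ((hF.wint _).sub (hF.wint _)).norm_pairing_le (hC _ (abs_le_of_mem_ball hq))
  have h4 := h2.add h1
  simpa [ContinuousAt] using h4

/-- Differentiating a convolution in time, in integrated form. -/
lemma integral_triangle {k k' : ℝ → ℝ → ℂ} (hk : Continuous fun q : ℝ × ℝ => k q.1 q.2)
    (hk' : Continuous fun q : ℝ × ℝ => k' q.1 q.2) (hd : ∀ τ s, HasDerivAt (k τ) (k' τ s) s)
    {t₀ t : ℝ} (ht : t₀ ≤ t) :
    ∫ τ in t₀..t, k τ (t - τ) = ∫ r in t₀..t, (k r 0 + ∫ τ in t₀..r, k' τ (r - τ)) := by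
  have hc1 : Continuous fun q : ℝ × ℝ => k' q.2 (q.1 - q.2) :=
    hk'.comp (f := fun q : ℝ × ℝ => (q.2, q.1 - q.2)) (by fun_prop)
  have e1 : ∀ τ, ∫ r in τ..t, k' τ (r - τ) = k τ (t - τ) - k τ 0 := by
    intro τ
    have h1 : ∀ r ∈ uIcc τ t, HasDerivAt (fun r => k τ (r - τ)) (k' τ (r - τ)) r := fun r _ => by
      have := (hd τ (r - τ)).scomp r ((hasDerivAt_id r).sub_const τ)
      simpa using! this
    rw [intervalIntegral.integral_eq_sub_of_hasDerivAt h1, sub_self]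
    exact (hc1.comp (f := fun r => (r, τ)) (by fun_prop)).intervalIntegrable _ _
  have hc2 : Continuous fun τ => k τ (t - τ) :=
    hk.comp (f := fun τ => (τ, t - τ)) (by fun_prop)
  have hc3 : Continuous fun τ => k τ 0 := hk.comp (f := fun τ => (τ, 0)) (by fun_prop)
  have hc4 : Continuous fun r => ∫ τ in t₀..r, k' τ (r - τ) :=
    intervalIntegral.continuous_parametric_intervalIntegral_of_continuous hc1 continuous_id
  rw [intervalIntegral.integral_add (hc3.intervalIntegrable _ _) (hc4.intervalIntegrable _ _),
    ← sub_eq_iff_eq_add', ← intervalIntegral.integral_sub (hc2.intervalIntegrable _ _)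
      (hc3.intervalIntegrable _ _)]
  simp only [← e1]
  rw [intervalIntegral.integral_of_le ht, intervalIntegral.integral_of_le ht]
  set G : ℝ → ℝ → ℂ := fun r τ => {q : ℝ × ℝ | q.2 < q.1}.indicator
    (fun q => k' q.2 (q.1 - q.2)) (r, τ) with hG
  have hSm : MeasurableSet {q : ℝ × ℝ | q.2 < q.1} := measurableSet_lt measurable_snd measurable_fst
  have hG1 : ∀ {r τ}, τ < r → G r τ = k' τ (r - τ) := fun {r τ} h =>
    indicator_of_mem (s := {q : ℝ × ℝ | q.2 < q.1}) (a := (r, τ)) h fun q => k' q.2 (q.1 - q.2)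
  have hG0 : ∀ {r τ}, ¬ τ < r → G r τ = 0 := fun {r τ} h =>
    indicator_of_notMem (s := {q : ℝ × ℝ | q.2 < q.1}) (a := (r, τ)) h fun q => k' q.2 (q.1 - q.2)
  have f1 : ∀ τ ∈ Ioc t₀ t, ∫ r in τ..t, k' τ (r - τ) = ∫ r in Ioc t₀ t, G r τ := by
    intro τ hτ
    rw [intervalIntegral.integral_of_le hτ.2, ← integral_indicator measurableSet_Ioc,
      ← integral_indicator measurableSet_Ioc]
    congr 1; ext r
    by_cases h : r ∈ Ioc τ t
    · have h' : r ∈ Ioc t₀ t := ⟨hτ.1.trans h.1, h.2⟩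
      rw [indicator_of_mem h, indicator_of_mem h', hG1 h.1]
    · rw [indicator_of_notMem h]
      by_cases h' : r ∈ Ioc t₀ t
      · rw [indicator_of_mem h', hG0 fun hc => h ⟨hc, h'.2⟩]
      · rw [indicator_of_notMem h']
  have f2 : ∀ r ∈ Ioc t₀ t, ∫ τ in t₀..r, k' τ (r - τ) = ∫ τ in Ioc t₀ t, G r τ := by
    intro r hr
    rw [intervalIntegral.integral_of_le hr.1.le, integral_Ioc_eq_integral_Ioo,
      ← integral_indicator measurableSet_Ioo,
      ← integral_indicator measurableSet_Ioc]
    congr 1; ext τ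
    by_cases h : τ ∈ Ioo t₀ r
    · have h' : τ ∈ Ioc t₀ t := ⟨h.1, h.2.le.trans hr.2⟩
      rw [indicator_of_mem h, indicator_of_mem h', hG1 h.2]
    · rw [indicator_of_notMem h]
      by_cases h' : τ ∈ Ioc t₀ t
      · rw [indicator_of_mem h', hG0 fun hc => h ⟨h'.1, hc⟩]
      · rw [indicator_of_notMem h']
  rw [setIntegral_congr_fun measurableSet_Ioc f1, setIntegral_congr_fun measurableSet_Ioc f2]
  refine (integral_integral_swap ?_).symm
  have h5 : IntegrableOn (fun q : ℝ × ℝ => k' q.2 (q.1 - q.2)) (Ioc t₀ t ×ˢ Ioc t₀ t) :=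
    (hc1.continuousOn.integrableOn_compact (isCompact_Icc.prod isCompact_Icc)).mono_set
      (prod_mono Ioc_subset_Icc_self Ioc_subset_Icc_self)
  have h6 := h5.indicator hSm
  rw [IntegrableOn, Measure.volume_eq_prod, ← Measure.prod_restrict] at h6
  exact h6

lemma integral_add_add {a b c : ℝ → ℂ} (ha : Continuous a) (hb : Continuous b) (hc : Continuous c)
    (s t : ℝ) : ∫ r in s..t, (a r + b r + c r)
      = (∫ r in s..t, a r) + (∫ r in s..t, b r) + ∫ r in s..t, c r := by
  rw [intervalIntegral.integral_add (f := fun r => a r + b r) ((ha.add hb).intervalIntegrable _ _)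
    (hc.intervalIntegrable _ _), intervalIntegral.integral_add (ha.intervalIntegrable _ _)
    (hb.intervalIntegrable _ _)]

/-- The integral equation implies that the wave equation holds in the sense of distributions, in
the form of a first order system integrated in time. -/
theorem weak_form_of_duhamel {t₀ t₁ : ℝ} (h01 : t₀ < t₁) {v₀ v₁ : E3 → ℝ} {v w F : ℝ → E3 → ℝ}
    (hv₀ : WInt v₀) (hv₁ : WInt v₁) (hF : WCont F)
    (hvel : ∀ ψ : 𝓢(E3, ℂ), ∀ t ∈ Icc t₀ t₁,
      HasDerivWithinAt (fun s => pairing (v s) ψ) (pairing (w t) ψ) (Icc t₀ t₁) t)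
    (hduh : ∀ t ∈ Icc t₀ t₁, ∀ ψ : 𝓢(E3, ℂ), pairing (v t) ψ = freeWave (t - t₀) v₀ v₁ ψ +
      ∫ τ in t₀..t, sinEvolution (t - τ) (F τ) ψ)
    (ψ : 𝓢(E3, ℂ)) {t : ℝ} (ht : t ∈ Icc t₀ t₁) :
    pairing (v t) ψ = pairing v₀ ψ + ∫ s in t₀..t, pairing (w s) ψ ∧
    pairing (w t) ψ = pairing v₁ ψ +
      ∫ s in t₀..t, (pairing (v s) (Δ ψ : 𝓢(E3, ℂ)) + pairing (F s) ψ) := by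
  -- `g` is the time derivative of the right-hand side of the integral equation
  set g : ℝ → ℂ := fun s => pairing v₀ (sinProp (s - t₀) (Δ ψ)) + pairing v₁ (cosProp (s - t₀) ψ) +
    ∫ τ in t₀..s, pairing (F τ) (cosProp (s - τ) ψ) with hg
  have hKS := isKernel_sinProp ψ
  have hKC := isKernel_cosProp ψ
  have hKS' := isKernel_sinProp (Δ ψ)
  have dS := hasDerivAt_sinProp ψ
  have dC := hasDerivAt_cosProp ψ
  have c1 := continuous_pairing_prod hF hKS
  have c2 := continuous_pairing_prod hF hKC
  have c3 := continuous_pairing_prod hF hKS'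
  have c4 : Continuous fun s => ∫ τ in t₀..s, pairing (F τ) (cosProp (s - τ) ψ) :=
    intervalIntegral.continuous_parametric_intervalIntegral_of_continuous
      (f := fun s τ => pairing (F τ) (cosProp (s - τ) ψ))
      (c2.comp (f := fun q : ℝ × ℝ => (q.2, q.1 - q.2)) (by fun_prop)) continuous_id
  have c5 : Continuous fun s => ∫ τ in t₀..s, pairing (F τ) (sinProp (s - τ) (Δ ψ)) :=
    intervalIntegral.continuous_parametric_intervalIntegral_of_continuous
      (f := fun s τ => pairing (F τ) (sinProp (s - τ) (Δ ψ)))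
      (c3.comp (f := fun q : ℝ × ℝ => (q.2, q.1 - q.2)) (by fun_prop)) continuous_id
  have cv0S : Continuous fun s => pairing v₀ (sinProp (s - t₀) (Δ ψ)) :=
    (continuous_pairing hv₀ hKS').comp (continuous_id.sub continuous_const)
  have cv1S : Continuous fun s => pairing v₁ (sinProp (s - t₀) (Δ ψ)) :=
    (continuous_pairing hv₁ hKS').comp (continuous_id.sub continuous_const)
  have cv0C : Continuous fun s => pairing v₀ (cosProp (s - t₀) (Δ ψ)) :=
    (continuous_pairing hv₀ (isKernel_cosProp (Δ ψ))).comp (continuous_id.sub continuous_const)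
  have cv1C : Continuous fun s => pairing v₁ (cosProp (s - t₀) ψ) :=
    (continuous_pairing hv₁ hKC).comp (continuous_id.sub continuous_const)
  have hgc : Continuous g := (cv0S.add cv1C).add c4
  have cF : Continuous fun s => pairing (F s) (cosProp 0 ψ) :=
    c2.comp (f := fun s : ℝ => (s, (0 : ℝ))) (by fun_prop)
  have hcos0 : cosProp 0 ψ = ψ := funext (cosProp_zero ψ)
  have shift : ∀ {k k' : ℝ → ℂ}, (∀ s, HasDerivAt k (k' s) s) → Continuous k' → ∀ t,
      k (t - t₀) = k 0 + ∫ s in t₀..t, k' (s - t₀) := by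
    intro k k' hk hk' t
    have h1 : ∀ r ∈ uIcc t₀ t, HasDerivAt (fun r => k (r - t₀)) (k' (r - t₀)) r := fun r _ => by
      have := (hk (r - t₀)).scomp r ((hasDerivAt_id r).sub_const t₀)
      simpa using! this
    rw [intervalIntegral.integral_eq_sub_of_hasDerivAt h1
      ((hk'.comp (continuous_id.sub continuous_const)).intervalIntegrable _ _), sub_self]
    ring
  have hv0C := shift (hasDerivAt_pairing hv₀ hKC hKS' dC) (continuous_pairing hv₀ hKS')
  have hv1S := shift (hasDerivAt_pairing hv₁ hKS hKC dS) (continuous_pairing hv₁ hKC)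
  have hv1C := shift (hasDerivAt_pairing hv₁ hKC hKS' dC) (continuous_pairing hv₁ hKS')
  have hv0S := shift (hasDerivAt_pairing hv₀ hKS' (isKernel_cosProp (Δ ψ))
    (hasDerivAt_sinProp (Δ ψ))) (continuous_pairing hv₀ (isKernel_cosProp (Δ ψ)))
  have hsin0 : ∀ (f : E3 → ℝ) (ψ : 𝓢(E3, ℂ)), pairing f (sinProp 0 ψ) = 0 := fun f ψ => by
    simp [pairing, sinProp_zero]
  -- the first component
  have hv : ∀ t ∈ Icc t₀ t₁, pairing (v t) ψ = pairing v₀ ψ + ∫ s in t₀..t, g s := by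
    intro t ht
    rw [hduh t ht ψ, freeWave, hv0C, sinEvolution, hv1S, hcos0, hsin0]
    have := integral_triangle c1 c2 (fun τ s => hasDerivAt_pairing (hF.wint τ) hKS hKC dS s) ht.1
    simp only [sinEvolution]
    rw [this]
    simp only [hsin0, hg]
    rw [integral_add_add cv0S cv1C c4]
    simp only [zero_add]
    ring
  -- the second component: `w` is the time derivative of `v` by assumption
  have hw : ∀ t ∈ Icc t₀ t₁, pairing (w t) ψ = g t := by
    intro t ht
    have h1 : HasDerivWithinAt (fun s => pairing (v s) ψ) (g t) (Icc t₀ t₁) t := by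
      have := ((intervalIntegral.integral_hasDerivAt_right (hgc.intervalIntegrable t₀ t)
        (hgc.stronglyMeasurableAtFilter _ _) hgc.continuousAt).const_add
          (pairing v₀ ψ)).hasDerivWithinAt (s := Icc t₀ t₁)
      exact this.congr hv (hv t ht)
    exact (uniqueDiffOn_Icc h01 t ht).eq_deriv _ (hvel ψ t ht) h1
  have hsub : ∀ s ∈ uIcc t₀ t, s ∈ Icc t₀ t₁ := fun s hs => by
    rw [uIcc_of_le ht.1] at hs
    exact ⟨hs.1, hs.2.trans ht.2⟩
  refine ⟨?_, ?_⟩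
  · rw [hv t ht]
    congr 1
    exact intervalIntegral.integral_congr fun s hs => (hw s (hsub s hs)).symm
  · rw [hw t ht]
    simp only [hg]
    have h2 := integral_triangle c2 c3
      (fun τ s => hasDerivAt_pairing (hF.wint τ) hKC hKS' dC s) ht.1
    rw [h2, hv1C, hv0S, hsin0, hcos0]
    have h3 : ∫ s in t₀..t, (pairing (v s) (Δ ψ : 𝓢(E3, ℂ)) + pairing (F s) ψ)
        = ∫ s in t₀..t, (pairing v₀ (cosProp (s - t₀) (Δ ψ)) + pairing v₁ (sinProp (s - t₀) (Δ ψ))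
          + (pairing (F s) ψ + ∫ τ in t₀..s, pairing (F τ) (sinProp (s - τ) (Δ ψ)))) := by
      refine intervalIntegral.integral_congr fun s hs => ?_
      beta_reduce
      rw [hduh s (hsub s hs) (Δ ψ), freeWave]
      simp only [sinEvolution]
      ring
    rw [hcos0] at cF
    rw [h3, integral_add_add (c := fun s => pairing (F s) ψ + ∫ τ in t₀..s, pairing (F τ)
      (sinProp (s - τ) (Δ ψ))) cv0C cv1S (cF.add c5)]
    ring

/-! ### Smoothing a path of functions -/

lemma memLp_wt {r : ℝ≥0∞} (hr : 1 ≤ r) : MemLp wt r volume := by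
  have hb : ∀ᵐ x, ‖wt x‖ ≤ 1 := .of_forall fun x => by
    rw [Real.norm_eq_abs, abs_of_pos (wt_pos x)]; exact wt_le_one x
  rcases eq_or_ne r ⊤ with rfl | hr'
  · exact memLp_top_of_bound continuous_wt.aestronglyMeasurable 1 hb
  · have h0 : r ≠ 0 := (zero_lt_one.trans_le hr).ne'
    rw [← integrable_norm_rpow_iff continuous_wt.aestronglyMeasurable h0 hr']
    refine integrable_wt.mono' ?_ (.of_forall fun x => ?_)
    · exact ((continuous_wt.norm).rpow_const fun x => .inr ENNReal.toReal_nonneg).aestronglyMeasurable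
    · rw [Real.norm_eq_abs, abs_of_nonneg (by positivity), Real.norm_eq_abs, abs_of_pos (wt_pos x)]
      have h1 : 1 ≤ r.toReal := by
        rw [← ENNReal.toReal_one]; exact ENNReal.toReal_mono hr' hr
      have := Real.rpow_le_rpow_of_exponent_ge (wt_pos x) (wt_le_one x) h1
      simpa using this

lemma lintegral_mul_wt_le {q r : ℝ≥0∞} [q.HolderTriple r 1] {f : E3 → ℝ}
    (hf : AEStronglyMeasurable f volume) :
    ∫⁻ x, ‖|f x| * wt x‖ₑ ≤ eLpNorm f q volume * eLpNorm wt r volume := by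
  have h := eLpNorm_smul_le_mul_eLpNorm (p := q) (q := r) (r := 1)
    continuous_wt.aestronglyMeasurable hf (μ := (volume : Measure E3))
  rw [eLpNorm_one_eq_lintegral_enorm] at h
  refine le_trans (lintegral_mono fun x => le_of_eq ?_) h
  simp [enorm_mul]

lemma wInt_of_memLp {q r : ℝ≥0∞} [q.HolderTriple r 1] (hr : 1 ≤ r) {f : E3 → ℝ}
    (hf : MemLp f q volume) : WInt f := by
  refine ⟨hf.1, (hf.1.norm).mul continuous_wt.aestronglyMeasurable, ?_⟩
  exact (lintegral_mul_wt_le (q := q) (r := r) hf.1).trans_lt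
    (ENNReal.mul_lt_top hf.2 (memLp_wt hr).2)

/-- Continuity in any `L^q` implies continuity in `L¹(wt)`, as `wt` lies in the dual space. -/
lemma wCont_of_tendsto {q r : ℝ≥0∞} [q.HolderTriple r 1] (hr : 1 ≤ r) {F : ℝ → E3 → ℝ}
    (hF : ∀ t, MemLp (F t) q volume)
    (hc : ∀ t, Tendsto (fun s => eLpNorm (F s - F t) q volume) (𝓝 t) (𝓝 0)) : WCont F := by
  refine ⟨fun t => wInt_of_memLp (r := r) hr (hF t), fun t => ?_⟩
  have h1 : Tendsto (fun s => eLpNorm (F s - F t) q volume * eLpNorm wt r volume) (𝓝 t) (𝓝 0) := by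
    have := ENNReal.Tendsto.mul_const (b := eLpNorm wt r volume) (hc t)
      (.inr (memLp_wt hr).2.ne)
    simpa using this
  have h2 := (ENNReal.tendsto_toReal ENNReal.zero_ne_top).comp h1
  rw [ENNReal.toReal_zero] at h2
  refine squeeze_zero (fun s => integral_nonneg fun x =>
    mul_nonneg (abs_nonneg _) (wt_pos x).le) (fun s => ?_) h2
  have hm : AEStronglyMeasurable (F s - F t) volume := (hF s).1.sub (hF t).1
  have h3 : ∫ x, |F s x - F t x| * wt x = ∫ x, ‖|(F s - F t) x| * wt x‖ := by
    congr 1; ext x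
    rw [norm_mul, Real.norm_eq_abs, Real.norm_eq_abs, abs_abs, abs_of_pos (wt_pos x)]
    rfl
  rw [h3, integral_norm_eq_lintegral_enorm (f := fun x => |(F s - F t) x| * wt x) (hm.norm.mul continuous_wt.aestronglyMeasurable)]
  exact ENNReal.toReal_mono (ENNReal.mul_ne_top (((hF s).sub (hF t)).2.ne) (memLp_wt hr).2.ne)
    (lintegral_mul_wt_le hm)

lemma WInt.locallyIntegrable {f : E3 → ℝ} (hf : WInt f) : LocallyIntegrable f volume := by
  have h1 : Integrable fun x => f x * wt x := by
    refine hf.2.mono' (hf.1.mul continuous_wt.aestronglyMeasurable) (.of_forall fun x => ?_)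
    rw [norm_mul, Real.norm_eq_abs, Real.norm_eq_abs, abs_of_pos (wt_pos x)]
  have h2 := LocallyIntegrable.mul_continuous (g := fun x => (wt x)⁻¹)
    (continuous_wt.inv₀ fun x => (wt_pos x).ne') h1.locallyIntegrable
  refine h2.congr (.of_forall fun x => ?_)
  simp only
  rw [mul_assoc, mul_inv_cancel₀ (wt_pos x).ne', mul_one]

/-- A real test function, as a complex Schwartz function. -/
def toS {χ : E3 → ℝ} (hχ : IsTest χ) : 𝓢(E3, ℂ) :=
  HasCompactSupport.toSchwartzMap (f := fun x => (χ x : ℂ))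
    (hχ.2.comp_left (g := fun r : ℝ => (r : ℂ)) rfl)
    (Complex.ofRealCLM.contDiff.comp hχ.1)

lemma toS_apply {χ : E3 → ℝ} (hχ : IsTest χ) (x : E3) : toS hχ x = (χ x : ℂ) := rfl

lemma lineDerivOp_toS {χ : E3 → ℝ} (hχ : IsTest χ) (j : Fin 3) :
    LineDeriv.lineDerivOp (ej j) (toS hχ) = toS (hχ.pd j) := by
  ext x
  rw [SchwartzMap.lineDerivOp_apply_eq_fderiv, toS_apply]
  have h := (Complex.ofRealCLM.hasFDerivAt (x := χ x)).comp x (hχ.differentiable x).hasFDerivAt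
  have h2 : (⇑(toS hχ) : E3 → ℂ) = Complex.ofRealCLM ∘ χ := rfl
  rw [h2, h.fderiv]
  rfl

/-- The Laplacian, as a sum of second partial derivatives. -/
def lapT (k : E3 → ℝ) (x : E3) : ℝ := pd 0 (pd 0 k) x + pd 1 (pd 1 k) x + pd 2 (pd 2 k) x

lemma laplacian_toS {χ : E3 → ℝ} (hχ : IsTest χ) (x : E3) :
    (Δ (toS hχ) : 𝓢(E3, ℂ)) x = (lapT χ x : ℂ) := by
  rw [SchwartzMap.laplacian_eq_sum (EuclideanSpace.basisFun (Fin 3) ℝ)]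
  have h : ∀ i, EuclideanSpace.basisFun (Fin 3) ℝ i = ej i := fun i => by
    rw [EuclideanSpace.basisFun_apply]; rfl
  simp only [h, lineDerivOp_toS, Fin.sum_univ_three, add_apply, toS_apply, lapT]
  push_cast
  rfl

lemma pairing_ofReal (f χ : E3 → ℝ) : pairing f (fun x => (χ x : ℂ)) = ((∫ x, f x * χ x : ℝ) : ℂ) := by
  rw [pairing, ← integral_complex_ofReal]
  simp

lemma moll_eq_pairing (k f : E3 → ℝ) (x : E3) :
    (moll k f x : ℂ) = pairing f (fun y => (k (x - y) : ℂ)) := by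
  rw [pairing_ofReal, moll_eq]
  simp only [mul_comm]

lemma isKernel_const {k : E3 → ℝ} (hk : IsTest k) : IsKernel fun _ y => (k y : ℂ) := by
  obtain ⟨C, hC0, hC⟩ := exists_schwartz_bound (toS hk)
  refine ⟨?_, fun T => ⟨C, hC0, fun t _ x => (hC x).1⟩⟩
  have := hk.continuous
  fun_prop

/-- Mollification turns continuity in `L¹(wt)` into pointwise continuity in time. -/
lemma WCont.continuous_moll {F : ℝ → E3 → ℝ} (hF : WCont F) {k : E3 → ℝ} (hk : IsTest k) (x : E3) :
    Continuous fun t => moll k (F t) x := by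
  have h1 := continuous_pairing_prod hF (isKernel_const (hk.comp_sub x))
  have h2 := Complex.continuous_re.comp (h1.comp (f := fun t : ℝ => (t, (0 : ℝ))) (by fun_prop))
  refine h2.congr fun t => ?_
  simp only [Function.comp]
  rw [← moll_eq_pairing, Complex.ofReal_re]

/-- The functions `(t, x) ↦ F t x` themselves are not assumed to be jointly measurable; their
mollifications are. -/
lemma WCont.measurable_moll {F : ℝ → E3 → ℝ} (hF : WCont F) {k : E3 → ℝ} (hk : IsTest k) :
    Measurable fun q : ℝ × E3 => moll k (F q.1) q.2 :=
  measurable_uncurry_of_continuous_of_measurable (u := fun t x => moll k (F t) x)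
    (fun x => hF.continuous_moll hk x)
    fun t => (contDiff_moll hk (hF.wint t).locallyIntegrable).continuous.measurable

lemma measurable_eLpNorm_prod {f : ℝ × E3 → ℝ} (hf : Measurable f) {q : ℝ≥0∞} (hq0 : q ≠ 0)
    (hq : q ≠ ⊤) : Measurable fun t => eLpNorm (fun x => f (t, x)) q volume := by
  simp only [eLpNorm_eq_lintegral_rpow_enorm_toReal hq0 hq]
  exact (Measurable.lintegral_prod_right' (f := fun z : ℝ × E3 => ‖f z‖ₑ ^ q.toReal)
    (hf.enorm.pow_const _)).pow_const _

/-- Norms as limits of norms of mollifications; this gives the measurability of norms in time. -/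
lemma eLpNorm_eq_liminf_moll {f : E3 → ℝ} (hf : LocallyIntegrable f volume) {q : ℝ≥0∞} (hq1 : 1 ≤ q)
    (hq : q ≠ ⊤) :
    eLpNorm f q volume = liminf (fun n => eLpNorm (moll (rho n) f) q volume) atTop := by
  refine le_antisymm (Lp.eLpNorm_lim_le_liminf_eLpNorm (fun n =>
    (contDiff_moll (isTest_rho n) hf).continuous.aestronglyMeasurable) f (ae_tendsto_moll_rho hf)) ?_
  refine liminf_le_of_le (by isBoundedDefault) fun b hb => ?_
  obtain ⟨n, hn⟩ := hb.exists
  exact hn.trans (eLpNorm_moll_rho_le n hq1 hq hf.aestronglyMeasurable)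

lemma WCont.measurable_eLpNorm {F : ℝ → E3 → ℝ} (hF : WCont F) {q : ℝ≥0∞} (hq1 : 1 ≤ q)
    (hq : q ≠ ⊤) : Measurable fun t => eLpNorm (F t) q volume := by
  have h : ∀ t, eLpNorm (F t) q volume
      = liminf (fun n => eLpNorm (moll (rho n) (F t)) q volume) atTop := fun t =>
    eLpNorm_eq_liminf_moll (hF.wint t).locallyIntegrable hq1 hq
  simp only [h]
  exact Measurable.liminf fun n => measurable_eLpNorm_prod (hF.measurable_moll (isTest_rho n))
    (zero_lt_one.trans_le hq1).ne' hq

lemma pairing_congr_ae {f g : E3 → ℝ} (h : f =ᵐ[volume] g) (ψ : E3 → ℂ) :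
    pairing f ψ = pairing g ψ := by
  refine integral_congr_ae ?_
  filter_upwards [h] with x hx
  rw [hx]

lemma moll_lapT {k f : E3 → ℝ} (hk : IsTest k) (hf : LocallyIntegrable f volume) (x : E3) :
    moll (lapT k) f x = lapT (moll k f) x := by
  have h : ∀ j, pd j (pd j (moll k f)) x = moll (pd j (pd j k)) f x := fun j => by
    rw [pd_moll hk hf, pd_moll (hk.pd j) hf]
  simp only [lapT, h]
  have hi : ∀ j, Integrable fun y => pd j (pd j k) (x - y) * f y := fun j =>
    (((hk.pd j).pd j).comp_sub x).integrable_mul hf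
  simp only [moll_eq]
  rw [← integral_add (hi 0) (hi 1), ← integral_add (f := fun y => _ + _) ((hi 0).add (hi 1)) (hi 2)]
  congr 1; ext y
  simp only [lapT]
  ring

/-- A solution of the linear wave equation `∂ₜ² v - Δ v = F` with `w = ∂ₜ v` of finite energy, on the
time interval `[t₀, t₁]`; the equation is required to hold after smoothing in space, and in
integrated form in time. For convenience all functions are defined for all times. -/
structure IsLinearSolution (t₀ t₁ : ℝ) (v w F : ℝ → E3 → ℝ) : Prop where
  mem_v : ∀ t, MemHDot1 (v t)
  mem_w : ∀ t, MemLp (w t) 2 volume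
  cont_v : WCont v
  cont_w : WCont w
  cont_F : WCont F
  bound : ∃ M : ℝ≥0, ∀ t, eLpNorm (weakGrad (v t)) 2 volume ≤ M ∧ eLpNorm (w t) 2 volume ≤ M
  int_F : ∫⁻ t in Icc t₀ t₁, eLpNorm (F t) 2 volume < ⊤
  eq_v : ∀ k, IsTest k → ∀ t ∈ Icc t₀ t₁, ∀ x,
    moll k (v t) x = moll k (v t₀) x + ∫ s in t₀..t, moll k (w s) x
  eq_w : ∀ k, IsTest k → ∀ t ∈ Icc t₀ t₁, ∀ x,
    moll k (w t) x = moll k (w t₀) x + ∫ s in t₀..t, (lapT (moll k (v s)) x + moll k (F s) x)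

/-- The weak equation, tested with the translates of a mollification kernel. -/
theorem moll_eq_of_duhamel {t₀ t₁ : ℝ} (h01 : t₀ < t₁) {v₀ v₁ : E3 → ℝ} {v w F : ℝ → E3 → ℝ}
    (hv₀ : v t₀ =ᵐ[volume] v₀) (hv₁ : w t₀ =ᵐ[volume] v₁)
    (hv : WCont v) (hw : WCont w) (hF : WCont F)
    (hvel : ∀ ψ : 𝓢(E3, ℂ), ∀ t ∈ Icc t₀ t₁,
      HasDerivWithinAt (fun s => pairing (v s) ψ) (pairing (w t) ψ) (Icc t₀ t₁) t)
    (hduh : ∀ t ∈ Icc t₀ t₁, ∀ ψ : 𝓢(E3, ℂ), pairing (v t) ψ = freeWave (t - t₀) v₀ v₁ ψ +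
      ∫ τ in t₀..t, sinEvolution (t - τ) (F τ) ψ)
    {k : E3 → ℝ} (hk : IsTest k) {t : ℝ} (ht : t ∈ Icc t₀ t₁) (x : E3) :
    moll k (v t) x = moll k (v t₀) x + ∫ s in t₀..t, moll k (w s) x ∧
    moll k (w t) x = moll k (w t₀) x + ∫ s in t₀..t, (lapT (moll k (v s)) x + moll k (F s) x) := by
  have hv₀' : WInt v₀ := ⟨(hv.wint t₀).1.congr hv₀, (hv.wint t₀).2.congr
    (by filter_upwards [hv₀] with x hx; rw [hx])⟩
  have hv₁' : WInt v₁ := ⟨(hw.wint t₀).1.congr hv₁, (hw.wint t₀).2.congr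
    (by filter_upwards [hv₁] with x hx; rw [hx])⟩
  set χ := fun y => k (x - y) with hχ
  have hkx : IsTest χ := hk.comp_sub x
  obtain ⟨h1, h2⟩ := weak_form_of_duhamel h01 hv₀' hv₁' hF hvel hduh (toS hkx) ht
  have hp : ∀ f, pairing f (toS hkx) = (moll k f x : ℂ) := fun f => (moll_eq_pairing k f x).symm
  have hlap : ∀ y, lapT χ y = lapT k (x - y) := by
    have e : ∀ (k : E3 → ℝ), IsTest k → ∀ j, pd j (fun y => k (x - y)) = fun y => - pd j k (x - y) :=
      fun k hk j => funext fun y => pd_comp_sub hk x y j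
    have e2 : ∀ (k : E3 → ℝ), IsTest k → ∀ j y, pd j (fun y => - k (x - y)) y = pd j k (x - y) := by
      intro k hk j y
      have h := congr_fun (e k hk j) y
      have h3 : pd j (fun y => - k (x - y)) y = - pd j (fun y => k (x - y)) y := by
        simp only [pd, fderiv_fun_neg]; rfl
      rw [h3, h, neg_neg]
    intro y
    simp only [lapT, hχ, e k hk]
    rw [e2 _ (hk.pd 0), e2 _ (hk.pd 1), e2 _ (hk.pd 2)]
  have hp2 : ∀ f, WInt f → pairing f (Δ (toS hkx) : 𝓢(E3, ℂ)) = (lapT (moll k f) x : ℂ) := by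
    intro f hf
    rw [← moll_lapT hk hf.locallyIntegrable, moll_eq_pairing]
    congr 1; ext y
    rw [laplacian_toS, hlap]
  rw [hp, ← pairing_congr_ae hv₀, hp] at h1
  rw [hp, ← pairing_congr_ae hv₁, hp] at h2
  simp only [hp] at h1 h2
  simp only [hp2 _ (hv.wint _)] at h2
  constructor
  · rw [intervalIntegral.integral_ofReal] at h1
    exact_mod_cast h1
  · have h3 : ∫ s in t₀..t, ((lapT (moll k (v s)) x : ℂ) + (moll k (F s) x : ℂ))
        = ((∫ s in t₀..t, (lapT (moll k (v s)) x + moll k (F s) x) : ℝ) : ℂ) := by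
      rw [← intervalIntegral.integral_ofReal]
      simp
    rw [h3] at h2
    exact_mod_cast h2

/-! ### The linear wave equation: energy identity and Morawetz estimate -/

lemma lintegral_enorm_mul_le {α : Type*} [MeasurableSpace α] {μ : Measure α} {f g : α → ℝ}
    (hf : AEStronglyMeasurable f μ) (hg : AEStronglyMeasurable g μ) :
    ∫⁻ x, ‖f x * g x‖ₑ ∂μ ≤ eLpNorm f 2 μ * eLpNorm g 2 μ := by
  have h := eLpNorm_smul_le_mul_eLpNorm (p := 2) (q := 2) (r := 1) hg hf
  rw [eLpNorm_one_eq_lintegral_enorm] at h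
  exact h

lemma abs_integral_mul_le {f g : E3 → ℝ} (hf : MemLp f 2 volume) (hg : MemLp g 2 volume) :
    |∫ x, f x * g x| ≤ (eLpNorm f 2 volume * eLpNorm g 2 volume).toReal := by
  have hi : Integrable fun x => f x * g x := hf.integrable_mul hg
  rw [← Real.norm_eq_abs]
  refine (norm_integral_le_integral_norm _).trans ?_
  rw [integral_norm_eq_lintegral_enorm hi.1]
  exact ENNReal.toReal_mono (ENNReal.mul_ne_top hf.2.ne hg.2.ne) (lintegral_enorm_mul_le hf.1 hg.1)

lemma tendsto_integral_mul {f g : E3 → ℝ} {fn gn : ℕ → E3 → ℝ} (hf : MemLp f 2 volume)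
    (hg : MemLp g 2 volume) (hfn : ∀ n, MemLp (fn n) 2 volume) (hgn : ∀ n, MemLp (gn n) 2 volume)
    (h1 : Tendsto (fun n => eLpNorm (fn n - f) 2 volume) atTop (𝓝 0))
    (h2 : Tendsto (fun n => eLpNorm (gn n - g) 2 volume) atTop (𝓝 0)) :
    Tendsto (fun n => ∫ x, fn n x * gn n x) atTop (𝓝 (∫ x, f x * g x)) := by
  refine tendsto_integral_of_L1 _ (hf.integrable_mul hg).1
    (.of_forall fun n => (hfn n).integrable_mul (hgn n)) ?_
  have h3 := tendsto_eLpNorm_of_tendsto_sub (by norm_num) (fun n => (hgn n).1) hg.1 h2 hg.2.ne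
  have h4 : Tendsto (fun n => eLpNorm (fn n - f) 2 volume * eLpNorm (gn n) 2 volume
      + eLpNorm f 2 volume * eLpNorm (gn n - g) 2 volume) atTop (𝓝 0) := by
    have := (ENNReal.Tendsto.mul h1 (.inr hg.2.ne) h3 (.inr ENNReal.zero_ne_top)).add
      (ENNReal.Tendsto.const_mul (a := eLpNorm f 2 volume) h2 (.inr hf.2.ne))
    simpa using this
  refine tendsto_of_tendsto_of_tendsto_of_le_of_le tendsto_const_nhds h4 (fun _ => bot_le) fun n => ?_
  calc ∫⁻ x, ‖fn n x * gn n x - f x * g x‖ₑ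
      ≤ ∫⁻ x, (‖(fn n - f) x * gn n x‖ₑ + ‖f x * (gn n - g) x‖ₑ) := by
        refine lintegral_mono fun x => ?_
        rw [show fn n x * gn n x - f x * g x = (fn n - f) x * gn n x + f x * (gn n - g) x by
          simp only [Pi.sub_apply]; ring]
        exact enorm_add_le _ _
    _ = (∫⁻ x, ‖(fn n - f) x * gn n x‖ₑ) + ∫⁻ x, ‖f x * (gn n - g) x‖ₑ :=
        lintegral_add_left' (((hfn n).1.sub hf.1).mul (hgn n).1).enorm _
    _ ≤ _ := add_le_add (lintegral_enorm_mul_le ((hfn n).1.sub hf.1) (hgn n).1)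
        (lintegral_enorm_mul_le hf.1 ((hgn n).1.sub hg.1))

lemma integrable_prod_mul {t₀ t₁ : ℝ} {a b : ℝ → E3 → ℝ}
    (ma : Measurable fun q : ℝ × E3 => a q.1 q.2) (mb : Measurable fun q : ℝ × E3 => b q.1 q.2)
    (ia : ∫⁻ t in Icc t₀ t₁, eLpNorm (a t) 2 volume < ⊤) {M : ℝ≥0}
    (hb : ∀ t, eLpNorm (b t) 2 volume ≤ M) :
    Integrable (fun q : ℝ × E3 => a q.1 q.2 * b q.1 q.2)
      ((volume.restrict (Icc t₀ t₁)).prod volume) := by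
  have mm : Measurable fun q : ℝ × E3 => a q.1 q.2 * b q.1 q.2 := ma.mul mb
  refine ⟨mm.aestronglyMeasurable, ?_⟩
  rw [HasFiniteIntegral, lintegral_prod _ mm.enorm.aemeasurable]
  have h : ∀ t, ∫⁻ x, ‖a t x * b t x‖ₑ ≤ eLpNorm (a t) 2 volume * M := fun t =>
    (lintegral_enorm_mul_le (ma.of_uncurry_left (x := t)).aestronglyMeasurable
      (mb.of_uncurry_left (x := t)).aestronglyMeasurable).trans (mul_le_mul_right (hb t) _)
  refine (lintegral_mono h).trans_lt ?_
  rw [lintegral_mul_const' _ _ ENNReal.coe_ne_top]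
  exact ENNReal.mul_lt_top ia ENNReal.coe_lt_top

lemma mul_sub_mul_eq_integral {t₀ t₁ : ℝ} (h01 : t₀ ≤ t₁) {a b a' b' : ℝ → ℝ} (ha' : Continuous a')
    (hb' : Continuous b') (ha : ∀ t ∈ Icc t₀ t₁, a t = a t₀ + ∫ s in t₀..t, a' s)
    (hb : ∀ t ∈ Icc t₀ t₁, b t = b t₀ + ∫ s in t₀..t, b' s) :
    a t₁ * b t₁ - a t₀ * b t₀ = ∫ t in Icc t₀ t₁, (a' t * b t + a t * b' t) := by
  have dA : ∀ t, HasDerivAt (fun t => a t₀ + ∫ s in t₀..t, a' s) (a' t) t := fun t =>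
    (intervalIntegral.integral_hasDerivAt_right (ha'.intervalIntegrable _ _)
      (ha'.stronglyMeasurableAtFilter _ _) ha'.continuousAt).const_add _
  have dB : ∀ t, HasDerivAt (fun t => b t₀ + ∫ s in t₀..t, b' s) (b' t) t := fun t =>
    (intervalIntegral.integral_hasDerivAt_right (hb'.intervalIntegrable _ _)
      (hb'.stronglyMeasurableAtFilter _ _) hb'.continuousAt).const_add _
  have h := intervalIntegral.integral_deriv_mul_eq_sub (a := t₀) (b := t₁) (fun t _ => dA t)
    (fun t _ => dB t) (ha'.intervalIntegrable _ _) (hb'.intervalIntegrable _ _)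
  have m0 : t₀ ∈ Icc t₀ t₁ := ⟨le_rfl, h01⟩
  have m1 : t₁ ∈ Icc t₀ t₁ := ⟨h01, le_rfl⟩
  rw [← ha _ m0, ← ha _ m1, ← hb _ m0, ← hb _ m1] at h
  rw [← h, intervalIntegral.integral_of_le h01, ← integral_Icc_eq_integral_Ioc]
  refine setIntegral_congr_fun measurableSet_Icc fun t ht => ?_
  simp only [← ha t ht, ← hb t ht]

/-- The product rule for `∫ a(t) b(t) dx`, in integrated form. -/
lemma integral_leibniz {t₀ t₁ : ℝ} (h01 : t₀ ≤ t₁) {a b a' b' : ℝ → E3 → ℝ}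
    (ma : Measurable fun q : ℝ × E3 => a q.1 q.2) (mb : Measurable fun q : ℝ × E3 => b q.1 q.2)
    (ma' : Measurable fun q : ℝ × E3 => a' q.1 q.2) (mb' : Measurable fun q : ℝ × E3 => b' q.1 q.2)
    (ca' : ∀ x, Continuous fun t => a' t x) (cb' : ∀ x, Continuous fun t => b' t x)
    (ha : ∀ t ∈ Icc t₀ t₁, ∀ x, a t x = a t₀ x + ∫ s in t₀..t, a' s x)
    (hb : ∀ t ∈ Icc t₀ t₁, ∀ x, b t x = b t₀ x + ∫ s in t₀..t, b' s x) {M : ℝ≥0}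
    (hMa : ∀ t, eLpNorm (a t) 2 volume ≤ M) (hMb : ∀ t, eLpNorm (b t) 2 volume ≤ M)
    (ia : ∫⁻ t in Icc t₀ t₁, eLpNorm (a' t) 2 volume < ⊤)
    (ib : ∫⁻ t in Icc t₀ t₁, eLpNorm (b' t) 2 volume < ⊤) :
    IntegrableOn (fun t => ∫ x, (a' t x * b t x + a t x * b' t x)) (Icc t₀ t₁) ∧
    (∫ x, a t₁ x * b t₁ x) - (∫ x, a t₀ x * b t₀ x)
      = ∫ t in Icc t₀ t₁, ∫ x, (a' t x * b t x + a t x * b' t x) := by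
  have h1 := integrable_prod_mul (t₀ := t₀) (t₁ := t₁) ma' mb ia hMb
  have h2 : Integrable (fun q : ℝ × E3 => a q.1 q.2 * b' q.1 q.2)
      ((volume.restrict (Icc t₀ t₁)).prod volume) :=
    (integrable_prod_mul (t₀ := t₀) (t₁ := t₁) mb' ma ib hMa).congr
      (.of_forall fun q => mul_comm _ _)
  have h3 := h1.add h2
  refine ⟨h3.integral_prod_left, ?_⟩
  have hL : ∀ {f : ℝ → E3 → ℝ}, (Measurable fun q : ℝ × E3 => f q.1 q.2) →
      (∀ t, eLpNorm (f t) 2 volume ≤ M) → ∀ t, MemLp (f t) 2 volume := fun mf hf t =>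
    ⟨(mf.of_uncurry_left (x := t)).aestronglyMeasurable, (hf t).trans_lt ENNReal.coe_lt_top⟩
  have hi : ∀ t, Integrable fun x => a t x * b t x := fun t =>
    (hL ma hMa t).integrable_mul (hL mb hMb t)
  rw [← integral_sub (hi _) (hi _), integral_integral_swap (f := fun t x => a' t x * b t x +
    a t x * b' t x) h3]
  congr 1; ext x
  exact mul_sub_mul_eq_integral h01 (ca' x) (cb' x) (fun t ht => ha t ht x) fun t ht => hb t ht x

/-- Passing to the limit in `∫∫ a b dx dt`, when `a` is bounded in `L¹ L²` and `b` in `L^∞ L²`. -/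
lemma tendsto_integral_integral_mul {t₀ t₁ : ℝ} {a b : ℝ → E3 → ℝ} {an bn : ℕ → ℝ → E3 → ℝ}
    {g : ℝ → ℝ≥0∞} (hg : Measurable g) (ig : ∫⁻ t in Icc t₀ t₁, g t < ⊤) {M : ℝ≥0}
    (ma : ∀ n, Measurable fun q : ℝ × E3 => an n q.1 q.2)
    (mb : ∀ n, Measurable fun q : ℝ × E3 => bn n q.1 q.2)
    (ba : ∀ n t, eLpNorm (an n t) 2 volume ≤ g t) (bb : ∀ n t, eLpNorm (bn n t) 2 volume ≤ M)
    (ha : ∀ᵐ t ∂volume.restrict (Icc t₀ t₁), MemLp (a t) 2 volume ∧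
      Tendsto (fun n => eLpNorm (an n t - a t) 2 volume) atTop (𝓝 0))
    (hb : ∀ᵐ t ∂volume.restrict (Icc t₀ t₁), MemLp (b t) 2 volume ∧
      Tendsto (fun n => eLpNorm (bn n t - b t) 2 volume) atTop (𝓝 0)) :
    IntegrableOn (fun t => ∫ x, a t x * b t x) (Icc t₀ t₁) ∧
    Tendsto (fun n => ∫ t in Icc t₀ t₁, ∫ x, an n t x * bn n t x) atTop
      (𝓝 (∫ t in Icc t₀ t₁, ∫ x, a t x * b t x)) := by
  have hfin : ∀ᵐ t ∂volume.restrict (Icc t₀ t₁), g t < ⊤ := ae_lt_top hg ig.ne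
  have hgi : Integrable (fun t => (g t * M).toReal) (volume.restrict (Icc t₀ t₁)) := by
    refine integrable_toReal_of_lintegral_ne_top (hg.mul_const _).aemeasurable ?_
    rw [lintegral_mul_const _ hg]
    exact ENNReal.mul_ne_top ig.ne ENNReal.coe_ne_top
  have hm : ∀ n, AEStronglyMeasurable (fun t => ∫ x, an n t x * bn n t x)
      (volume.restrict (Icc t₀ t₁)) := fun n =>
    ((ma n).mul (mb n)).stronglyMeasurable.integral_prod_right.aestronglyMeasurable
  have hL : ∀ᵐ t ∂volume.restrict (Icc t₀ t₁), ∀ n, MemLp (an n t) 2 volume ∧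
      MemLp (bn n t) 2 volume := by
    filter_upwards [hfin] with t ht n
    exact ⟨⟨((ma n).of_uncurry_left (x := t)).aestronglyMeasurable, (ba n t).trans_lt ht⟩,
      ⟨((mb n).of_uncurry_left (x := t)).aestronglyMeasurable,
        (bb n t).trans_lt ENNReal.coe_lt_top⟩⟩
  have hbd : ∀ᵐ t ∂volume.restrict (Icc t₀ t₁), ∀ n,
      ‖∫ x, an n t x * bn n t x‖ ≤ (g t * M).toReal := by
    filter_upwards [hfin, hL] with t ht hL n
    rw [Real.norm_eq_abs]
    refine (abs_integral_mul_le (hL n).1 (hL n).2).trans (ENNReal.toReal_mono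
      (ENNReal.mul_ne_top ht.ne ENNReal.coe_ne_top) (mul_le_mul' (ba n t) (bb n t)))
  have hlim : ∀ᵐ t ∂volume.restrict (Icc t₀ t₁), Tendsto (fun n => ∫ x, an n t x * bn n t x) atTop
      (𝓝 (∫ x, a t x * b t x)) := by
    filter_upwards [hL, ha, hb] with t hL ha hb
    exact tendsto_integral_mul ha.1 hb.1 (fun n => (hL n).1) (fun n => (hL n).2) ha.2 hb.2
  refine ⟨hgi.mono' (aestronglyMeasurable_of_tendsto_ae atTop hm hlim) ?_,
    tendsto_integral_of_dominated_convergence _ hm hgi (fun n => hbd.mono fun t ht => ht n) hlim⟩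
  filter_upwards [hbd, hlim] with t h1 h2
  exact le_of_tendsto h2.norm (.of_forall h1)

lemma integral_add_three {α : Type*} [MeasurableSpace α] {μ : Measure α} {f : Fin 3 → α → ℝ}
    (h : ∀ j, Integrable (f j) μ) :
    ∫ x, (f 0 x + f 1 x + f 2 x) ∂μ = (∫ x, f 0 x ∂μ) + (∫ x, f 1 x ∂μ) + ∫ x, f 2 x ∂μ := by
  rw [← integral_add (h 0) (h 1), ← integral_add (f := fun x => f 0 x + f 1 x) ((h 0).add (h 1)) (h 2)]

lemma integral_add_add_three {α : Type*} [MeasurableSpace α] {μ : Measure α} {g : α → ℝ}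
    {f : Fin 3 → α → ℝ} (hg : Integrable g μ) (h : ∀ j, Integrable (f j) μ) :
    ∫ x, (g x + (f 0 x + f 1 x + f 2 x)) ∂μ
      = (∫ x, g x ∂μ) + ((∫ x, f 0 x ∂μ) + (∫ x, f 1 x ∂μ) + ∫ x, f 2 x ∂μ) := by
  rw [← integral_add_three h, ← integral_add (g := fun x => f 0 x + f 1 x + f 2 x) hg
    (((h 0).add (h 1)).add (h 2))]

/-! ### The energy identity for the smoothed solution -/

namespace IsLinearSolution

variable {t₀ t₁ : ℝ} {v w F : ℝ → E3 → ℝ}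

lemma li_v (h : IsLinearSolution t₀ t₁ v w F) (t : ℝ) : LocallyIntegrable (v t) volume :=
  (h.cont_v.wint t).locallyIntegrable

lemma li_w (h : IsLinearSolution t₀ t₁ v w F) (t : ℝ) : LocallyIntegrable (w t) volume :=
  (h.cont_w.wint t).locallyIntegrable

lemma li_F (h : IsLinearSolution t₀ t₁ v w F) (t : ℝ) : LocallyIntegrable (F t) volume :=
  (h.cont_F.wint t).locallyIntegrable

lemma pd_eq_v (h : IsLinearSolution t₀ t₁ v w F) {k : E3 → ℝ} (hk : IsTest k) (j : Fin 3) (t : ℝ) :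
    pd j (moll k (v t)) = moll (pd j k) (v t) := pd_moll hk (h.li_v t) j

lemma pd_eq_w (h : IsLinearSolution t₀ t₁ v w F) {k : E3 → ℝ} (hk : IsTest k) (j : Fin 3) (t : ℝ) :
    pd j (moll k (w t)) = moll (pd j k) (w t) := pd_moll hk (h.li_w t) j

lemma exists_bound_w (h : IsLinearSolution t₀ t₁ v w F) {k : E3 → ℝ} (hk : IsTest k) :
    ∃ M : ℝ≥0, ∀ t, eLpNorm (moll k (w t)) 2 volume ≤ M := by
  obtain ⟨M, hM⟩ := h.bound
  have hk' : ∫⁻ x, ‖k x‖ₑ ≠ ⊤ := hk.integrable.2.ne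
  refine ⟨(∫⁻ x, ‖k x‖ₑ).toNNReal * M, fun t => ?_⟩
  refine (eLpNorm_moll_le hk.integrable (by norm_num) (by norm_num) (h.mem_w t).1).trans ?_
  rw [ENNReal.coe_mul, ENNReal.coe_toNNReal hk']
  gcongr
  exact (hM t).2

lemma exists_bound_pd_v (h : IsLinearSolution t₀ t₁ v w F) {k : E3 → ℝ} (hk : IsTest k) :
    ∃ M : ℝ≥0, ∀ t j, eLpNorm (moll (pd j k) (v t)) 2 volume ≤ M := by
  obtain ⟨M, hM⟩ := h.bound
  have hk' : ∫⁻ x, ‖k x‖ₑ ≠ ⊤ := hk.integrable.2.ne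
  refine ⟨(∫⁻ x, ‖k x‖ₑ).toNNReal * M, fun t j => ?_⟩
  obtain ⟨hG, hw⟩ := (h.mem_v t).weakGrad
  rw [← h.pd_eq_v hk, hw.pd_moll hk]
  refine (eLpNorm_moll_le hk.integrable (by norm_num) (by norm_num) (memLp_apply hG j).1).trans ?_
  rw [ENNReal.coe_mul, ENNReal.coe_toNNReal hk']
  gcongr
  refine le_trans (eLpNorm_mono fun x => ?_) (hM t).1
  exact abs_apply_le_norm _ _

lemma memLp_moll_w (h : IsLinearSolution t₀ t₁ v w F) {k : E3 → ℝ} (hk : IsTest k) (t : ℝ) :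
    MemLp (moll k (w t)) 2 volume := memLp_moll hk (by norm_num) (by norm_num) (h.mem_w t)

lemma memLp_pd_v (h : IsLinearSolution t₀ t₁ v w F) {k : E3 → ℝ} (hk : IsTest k) (j : Fin 3)
    (t : ℝ) : MemLp (moll (pd j k) (v t)) 2 volume := by
  obtain ⟨M, hM⟩ := h.exists_bound_pd_v hk
  exact ⟨(contDiff_moll (hk.pd j) (h.li_v t)).continuous.aestronglyMeasurable,
    (hM t j).trans_lt ENNReal.coe_lt_top⟩

lemma lapT_eq (h : IsLinearSolution t₀ t₁ v w F) {k : E3 → ℝ} (hk : IsTest k) (t : ℝ) :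
    lapT (moll k (v t)) = fun x => moll (pd 0 (pd 0 k)) (v t) x + moll (pd 1 (pd 1 k)) (v t) x
      + moll (pd 2 (pd 2 k)) (v t) x := by
  ext x
  simp only [lapT, h.pd_eq_v hk, h.pd_eq_v (hk.pd _)]

lemma exists_bound_lapT (h : IsLinearSolution t₀ t₁ v w F) {k : E3 → ℝ} (hk : IsTest k) :
    ∃ M : ℝ≥0, ∀ t, eLpNorm (lapT (moll k (v t))) 2 volume ≤ M := by
  choose M hM using fun j => h.exists_bound_pd_v (hk.pd j)
  refine ⟨M 0 + M 1 + M 2, fun t => ?_⟩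
  rw [h.lapT_eq hk]
  have m := fun j => (h.memLp_pd_v (hk.pd j) j t).1
  refine (eLpNorm_add_le ((m 0).add (m 1)) (m 2) (by norm_num)).trans ?_
  push_cast
  refine add_le_add ((eLpNorm_add_le (m 0) (m 1) (by norm_num)).trans ?_) (hM 2 t 2)
  exact add_le_add (hM 0 t 0) (hM 1 t 1)

lemma measurable_F (h : IsLinearSolution t₀ t₁ v w F) : Measurable fun t => eLpNorm (F t) 2 volume :=
  h.cont_F.measurable_eLpNorm (by norm_num) (by norm_num)

lemma ae_memLp_F (h : IsLinearSolution t₀ t₁ v w F) :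
    ∀ᵐ t ∂volume.restrict (Icc t₀ t₁), MemLp (F t) 2 volume := by
  filter_upwards [ae_lt_top h.measurable_F h.int_F.ne] with t ht
  exact ⟨(h.cont_F.wint t).1, ht⟩

lemma measurable_lapT (h : IsLinearSolution t₀ t₁ v w F) {k : E3 → ℝ} (hk : IsTest k) :
    Measurable fun q : ℝ × E3 => lapT (moll k (v q.1)) q.2 := by
  simp only [h.lapT_eq hk]
  have m := fun j => h.cont_v.measurable_moll ((hk.pd j).pd j)
  exact ((m 0).add (m 1)).add (m 2)

lemma continuous_lapT (h : IsLinearSolution t₀ t₁ v w F) {k : E3 → ℝ} (hk : IsTest k) (x : E3) :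
    Continuous fun t => lapT (moll k (v t)) x := by
  simp only [h.lapT_eq hk]
  have m := fun j => h.cont_v.continuous_moll ((hk.pd j).pd j) x
  exact ((m 0).add (m 1)).add (m 2)

lemma lintegral_rhs_lt_top (h : IsLinearSolution t₀ t₁ v w F) {k : E3 → ℝ} (hk : IsTest k) :
    ∫⁻ t in Icc t₀ t₁, eLpNorm (fun x => lapT (moll k (v t)) x + moll k (F t) x) 2 volume < ⊤ := by
  obtain ⟨M, hM⟩ := h.exists_bound_lapT hk
  have h1 : ∀ t, eLpNorm (fun x => lapT (moll k (v t)) x + moll k (F t) x) 2 volume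
      ≤ M + (∫⁻ x, ‖k x‖ₑ) * eLpNorm (F t) 2 volume := by
    intro t
    have m1 : AEStronglyMeasurable (lapT (moll k (v t))) volume :=
      ((h.measurable_lapT hk).comp (measurable_prodMk_left (x := t))).aestronglyMeasurable
    have m2 : AEStronglyMeasurable (moll k (F t)) volume :=
      (contDiff_moll hk (h.li_F t)).continuous.aestronglyMeasurable
    exact (eLpNorm_add_le m1 m2 (by norm_num)).trans (add_le_add (hM t)
      (eLpNorm_moll_le hk.integrable (by norm_num) (by norm_num) (h.cont_F.wint t).1))
  refine (lintegral_mono h1).trans_lt ?_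
  rw [lintegral_add_left measurable_const, lintegral_const_mul _ h.measurable_F]
  refine ENNReal.add_lt_top.2 ⟨?_, ENNReal.mul_lt_top hk.integrable.2 h.int_F⟩
  simp [ENNReal.mul_lt_top_iff]

lemma lintegral_lt_top_of_bound {f : ℝ → E3 → ℝ} {M : ℝ≥0} (hM : ∀ t, eLpNorm (f t) 2 volume ≤ M) :
    ∫⁻ t in Icc t₀ t₁, eLpNorm (f t) 2 volume < ⊤ := by
  refine (lintegral_mono hM).trans_lt ?_
  simp [ENNReal.mul_lt_top_iff]

/-- The energy identity for the smoothed solution. -/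
lemma energy_identity_moll (h : IsLinearSolution t₀ t₁ v w F) (h01 : t₀ ≤ t₁) {k : E3 → ℝ}
    (hk : IsTest k) :
    ((∫ x, moll k (w t₁) x * moll k (w t₁) x)
        + ∑ j, ∫ x, moll (pd j k) (v t₁) x * moll (pd j k) (v t₁) x)
      - ((∫ x, moll k (w t₀) x * moll k (w t₀) x)
        + ∑ j, ∫ x, moll (pd j k) (v t₀) x * moll (pd j k) (v t₀) x)
      = 2 * ∫ t in Icc t₀ t₁, ∫ x, moll k (F t) x * moll k (w t) x := by
  obtain ⟨M, hM⟩ := h.exists_bound_w hk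
  obtain ⟨N, hN⟩ := h.exists_bound_pd_v hk
  choose K hK using fun j => h.exists_bound_w (hk.pd j)
  have mw := h.cont_w.measurable_moll hk
  have mf : Measurable fun q : ℝ × E3 => lapT (moll k (v q.1)) q.2 + moll k (F q.1) q.2 :=
    (h.measurable_lapT hk).add (h.cont_F.measurable_moll hk)
  have cf : ∀ x, Continuous fun t => lapT (moll k (v t)) x + moll k (F t) x := fun x =>
    (h.continuous_lapT hk x).add (h.cont_F.continuous_moll hk x)
  obtain ⟨i1, e1⟩ := integral_leibniz h01 (a := fun t => moll k (w t)) (b := fun t => moll k (w t))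
    (a' := fun t x => lapT (moll k (v t)) x + moll k (F t) x)
    (b' := fun t x => lapT (moll k (v t)) x + moll k (F t) x) mw mw mf mf cf cf (h.eq_w k hk)
    (h.eq_w k hk) hM hM (h.lintegral_rhs_lt_top hk) (h.lintegral_rhs_lt_top hk)
  have e2 := fun j => integral_leibniz h01 (a := fun t => moll (pd j k) (v t))
    (b := fun t => moll (pd j k) (v t)) (a' := fun t => moll (pd j k) (w t))
    (b' := fun t => moll (pd j k) (w t))
    (h.cont_v.measurable_moll (hk.pd j)) (h.cont_v.measurable_moll (hk.pd j))
    (h.cont_w.measurable_moll (hk.pd j)) (h.cont_w.measurable_moll (hk.pd j))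
    (h.cont_w.continuous_moll (hk.pd j)) (h.cont_w.continuous_moll (hk.pd j))
    (h.eq_v _ (hk.pd j)) (h.eq_v _ (hk.pd j)) (fun t => hN t j) (fun t => hN t j)
    (lintegral_lt_top_of_bound (hK j)) (lintegral_lt_top_of_bound (hK j))
  have hs : ∀ A B : ℝ, ∀ a b : Fin 3 → ℝ, (A + ∑ j, a j) - (B + ∑ j, b j)
      = (A - B) + ((a 0 - b 0) + (a 1 - b 1) + (a 2 - b 2)) := fun A B a b => by
    simp only [Fin.sum_univ_three]; ring
  have e3 := integral_add_add_three i1 fun j => (e2 j).1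
  rw [hs, e1, (e2 0).2, (e2 1).2, (e2 2).2]
  refine e3.symm.trans ?_
  rw [← integral_const_mul]
  refine integral_congr_ae ?_
  filter_upwards [h.ae_memLp_F] with t ht
  have Lw := h.memLp_moll_w hk t
  have Lv := fun j => h.memLp_pd_v hk j t
  have Lww := fun j => h.memLp_moll_w (hk.pd j) t
  have Lvv := fun j => h.memLp_pd_v (hk.pd j) j t
  have LF : MemLp (moll k (F t)) 2 volume := memLp_moll hk (by norm_num) (by norm_num) ht
  -- integration by parts in each direction
  have hz : ∀ j, ∫ x, (moll (pd j (pd j k)) (v t) x * moll k (w t) x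
      + moll (pd j k) (v t) x * moll (pd j k) (w t) x) = 0 := by
    intro j
    refine integral_pd_eq_zero (j := j) (Z := fun x => moll (pd j k) (v t) x * moll k (w t) x) ?_
      ((Lv j).integrable_mul Lw) (((Lvv j).integrable_mul Lw).add ((Lv j).integrable_mul (Lww j)))
    have d1 := hasPD_of_contDiff (contDiff_moll (hk.pd j) (h.li_v t)) j
    have d2 := hasPD_of_contDiff (contDiff_moll hk (h.li_w t)) j
    rw [h.pd_eq_v (hk.pd j)] at d1
    rw [h.pd_eq_w hk] at d2
    exact d1.mul d2
  have iz : ∀ j, Integrable fun x => 2 * (moll (pd j (pd j k)) (v t) x * moll k (w t) x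
      + moll (pd j k) (v t) x * moll (pd j k) (w t) x) := fun j =>
    (((Lvv j).integrable_mul Lw).add ((Lv j).integrable_mul (Lww j))).const_mul 2
  have iF : Integrable fun x => moll k (F t) x * moll k (w t) x := LF.integrable_mul Lw
  have hsum : ∀ x, ((lapT (moll k (v t)) x + moll k (F t) x) * moll k (w t) x
      + moll k (w t) x * (lapT (moll k (v t)) x + moll k (F t) x))
      + ((moll (pd 0 k) (w t) x * moll (pd 0 k) (v t) x
          + moll (pd 0 k) (v t) x * moll (pd 0 k) (w t) x)
        + (moll (pd 1 k) (w t) x * moll (pd 1 k) (v t) x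
          + moll (pd 1 k) (v t) x * moll (pd 1 k) (w t) x)
        + (moll (pd 2 k) (w t) x * moll (pd 2 k) (v t) x
          + moll (pd 2 k) (v t) x * moll (pd 2 k) (w t) x))
      = 2 * (moll k (F t) x * moll k (w t) x)
        + (2 * (moll (pd 0 (pd 0 k)) (v t) x * moll k (w t) x
          + moll (pd 0 k) (v t) x * moll (pd 0 k) (w t) x)
        + 2 * (moll (pd 1 (pd 1 k)) (v t) x * moll k (w t) x
          + moll (pd 1 k) (v t) x * moll (pd 1 k) (w t) x)
        + 2 * (moll (pd 2 (pd 2 k)) (v t) x * moll k (w t) x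
          + moll (pd 2 k) (v t) x * moll (pd 2 k) (w t) x)) := by
    intro x
    rw [h.lapT_eq hk]
    ring
  have ip : ∀ j, Integrable fun x => moll (pd j k) (w t) x * moll (pd j k) (v t) x
          + moll (pd j k) (v t) x * moll (pd j k) (w t) x := fun j =>
    ((Lww j).integrable_mul (Lv j)).add ((Lv j).integrable_mul (Lww j))
  have ilap : MemLp (lapT (moll k (v t))) 2 volume := by
    rw [h.lapT_eq hk]
    exact ((Lvv 0).add (Lvv 1)).add (Lvv 2)
  have iq : Integrable fun x => (lapT (moll k (v t)) x + moll k (F t) x) * moll k (w t) x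
      + moll k (w t) x * (lapT (moll k (v t)) x + moll k (F t) x) :=
    ((ilap.add LF).integrable_mul Lw).add (Lw.integrable_mul (ilap.add LF))
  refine (integral_add_add_three iq ip).symm.trans ?_
  simp only [hsum]
  have e4 := integral_add_add_three (iF.const_mul 2) iz
  have e5 : ∀ j, ∫ x, 2 * (moll (pd j (pd j k)) (v t) x * moll k (w t) x
      + moll (pd j k) (v t) x * moll (pd j k) (w t) x) = 0 := fun j => by
    rw [integral_const_mul, hz, mul_zero]
  rw [e5 0, e5 1, e5 2, integral_const_mul, add_zero, add_zero, add_zero] at e4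
  exact e4

end IsLinearSolution

/-! ### The Morawetz estimate for linear solutions -/

namespace IsLinearSolution

variable {t₀ t₁ : ℝ} {v w F : ℝ → E3 → ℝ}

lemma gradient_moll_apply (h : IsLinearSolution t₀ t₁ v w F) {k : E3 → ℝ} (hk : IsTest k) (t : ℝ)
    (j : Fin 3) : (fun x => gradient (moll k (v t)) x j) = moll k (fun x => weakGrad (v t) x j) := by
  ext x
  rw [gradient_apply, (h.mem_v t).weakGrad.2.pd_moll hk]

lemma memLp_gradient_moll (h : IsLinearSolution t₀ t₁ v w F) {k : E3 → ℝ} (hk : IsTest k) (t : ℝ) :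
    MemLp (gradient (moll k (v t))) 2 volume := by
  have hm : AEStronglyMeasurable (gradient (moll k (v t))) volume :=
    (continuous_gradient (contDiff_moll hk (h.li_v t))).aestronglyMeasurable
  refine ⟨hm, (eLpNorm_le_sum_apply hm (by norm_num)).trans_lt (ENNReal.sum_lt_top.2 fun j _ => ?_)⟩
  rw [h.gradient_moll_apply hk]
  exact (memLp_moll hk (by norm_num) (by norm_num) (memLp_apply (h.mem_v t).weakGrad.1 j)).2

lemma memLp_six_moll (h : IsLinearSolution t₀ t₁ v w F) {k : E3 → ℝ} (hk : IsTest k) (t : ℝ) :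
    MemLp (moll k (v t)) 6 volume :=
  memLp_moll hk (by norm_num) (by norm_num) (h.mem_v t).1

lemma isWeakGradient_moll (h : IsLinearSolution t₀ t₁ v w F) {k : E3 → ℝ} (hk : IsTest k) (t : ℝ) :
    IsWeakGradient (moll k (v t)) (gradient (moll k (v t))) :=
  isWeakGradient_gradient (contDiff_moll hk (h.li_v t))

lemma mop_moll_v (h : IsLinearSolution t₀ t₁ v w F) {k : E3 → ℝ} (hk : IsTest k) (δ t : ℝ) (x : E3) :
    mop δ (moll k (v t)) (gradient (moll k (v t))) x =
    sw δ x * (x 0 * moll (pd 0 k) (v t) x + x 1 * moll (pd 1 k) (v t) x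
      + x 2 * moll (pd 2 k) (v t) x) + (sw δ x + δ ^ 2 * sw δ x ^ 3 / 2) * moll k (v t) x := by
  rw [mop_gradient, h.pd_eq_v hk, h.pd_eq_v hk, h.pd_eq_v hk]

lemma mop_moll_w (h : IsLinearSolution t₀ t₁ v w F) {k : E3 → ℝ} (hk : IsTest k) (δ t : ℝ) (x : E3) :
    mop δ (moll k (w t)) (gradient (moll k (w t))) x =
    sw δ x * (x 0 * moll (pd 0 k) (w t) x + x 1 * moll (pd 1 k) (w t) x
      + x 2 * moll (pd 2 k) (w t) x) + (sw δ x + δ ^ 2 * sw δ x ^ 3 / 2) * moll k (w t) x := by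
  rw [mop_gradient, h.pd_eq_w hk, h.pd_eq_w hk, h.pd_eq_w hk]

lemma measurable_lincomb {f : Fin 3 → ℝ × E3 → ℝ} {g : ℝ × E3 → ℝ} (hf : ∀ j, Measurable (f j))
    (hg : Measurable g) (δ : ℝ) : Measurable fun q : ℝ × E3 =>
    sw δ q.2 * (q.2 0 * f 0 q + q.2 1 * f 1 q + q.2 2 * f 2 q)
      + (sw δ q.2 + δ ^ 2 * sw δ q.2 ^ 3 / 2) * g q := by
  have hs : Measurable fun q : ℝ × E3 => sw δ q.2 := (measurable_sw δ).comp measurable_snd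
  have hc : ∀ j : Fin 3, Measurable fun q : ℝ × E3 => q.2 j := fun j =>
    (Continuous.measurable (by fun_prop))
  have h0 := hf 0
  have h1 := hf 1
  have h2 := hf 2
  have c0 := hc 0
  have c1 := hc 1
  have c2 := hc 2
  fun_prop

lemma measurable_mop_moll (h : IsLinearSolution t₀ t₁ v w F) {k : E3 → ℝ} (hk : IsTest k) (δ : ℝ) :
    Measurable fun q : ℝ × E3 => mop δ (moll k (v q.1)) (gradient (moll k (v q.1))) q.2 := by
  simp only [h.mop_moll_v hk]
  exact measurable_lincomb (fun j => h.cont_v.measurable_moll (hk.pd j)) (h.cont_v.measurable_moll hk) δ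

lemma measurable_mop_moll_w (h : IsLinearSolution t₀ t₁ v w F) {k : E3 → ℝ} (hk : IsTest k) (δ : ℝ) :
    Measurable fun q : ℝ × E3 => mop δ (moll k (w q.1)) (gradient (moll k (w q.1))) q.2 := by
  simp only [h.mop_moll_w hk]
  exact measurable_lincomb (fun j => h.cont_w.measurable_moll (hk.pd j)) (h.cont_w.measurable_moll hk) δ

lemma continuous_mop_moll_w (h : IsLinearSolution t₀ t₁ v w F) {k : E3 → ℝ} (hk : IsTest k) (δ : ℝ)
    (x : E3) : Continuous fun t => mop δ (moll k (w t)) (gradient (moll k (w t))) x := by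
  simp only [h.mop_moll_w hk]
  have c := fun j => h.cont_w.continuous_moll (hk.pd j) x
  have := c 0
  have := c 1
  have := c 2
  have := h.cont_w.continuous_moll hk x
  fun_prop

/-- The multiplier applied to `∂ₜ v = w`, in integrated form. -/
lemma mop_moll_eq (h : IsLinearSolution t₀ t₁ v w F) {k : E3 → ℝ} (hk : IsTest k) (δ : ℝ) {t : ℝ}
    (ht : t ∈ Icc t₀ t₁) (x : E3) : mop δ (moll k (v t)) (gradient (moll k (v t))) x
      = mop δ (moll k (v t₀)) (gradient (moll k (v t₀))) x
        + ∫ s in t₀..t, mop δ (moll k (w s)) (gradient (moll k (w s))) x := by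
  simp only [h.mop_moll_v hk, h.mop_moll_w hk]
  rw [h.eq_v k hk t ht, h.eq_v _ (hk.pd 0) t ht, h.eq_v _ (hk.pd 1) t ht, h.eq_v _ (hk.pd 2) t ht]
  have c := fun j => h.cont_w.continuous_moll (hk.pd j) x
  have c' := h.cont_w.continuous_moll hk x
  have i : ∀ {f : ℝ → ℝ}, Continuous f → IntervalIntegrable f volume t₀ t := fun hf =>
    hf.intervalIntegrable _ _
  rw [intervalIntegral.integral_add (i (by have := c 0; have := c 1; have := c 2; fun_prop))
    (i (by fun_prop)), intervalIntegral.integral_const_mul, intervalIntegral.integral_const_mul,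
    intervalIntegral.integral_add (i (by have := c 0; have := c 1; fun_prop))
    (i (by have := c 2; fun_prop)),
    intervalIntegral.integral_add (i (by have := c 0; fun_prop)) (i (by have := c 1; fun_prop)),
    intervalIntegral.integral_const_mul, intervalIntegral.integral_const_mul,
    intervalIntegral.integral_const_mul]
  ring

lemma eLpNorm_gradient_moll_rho_le (h : IsLinearSolution t₀ t₁ v w F) {M : ℝ≥0}
    (hM : ∀ t, eLpNorm (weakGrad (v t)) 2 volume ≤ M) (n : ℕ) (t : ℝ) :
    eLpNorm (gradient (moll (rho n) (v t))) 2 volume ≤ 3 * M := by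
  have hG := (h.mem_v t).weakGrad.1
  refine (eLpNorm_le_sum_apply (h.memLp_gradient_moll (isTest_rho n) t).1 (by norm_num)).trans ?_
  have h1 : ∀ j, eLpNorm (fun x => gradient (moll (rho n) (v t)) x j) 2 volume ≤ M := fun j => by
    rw [h.gradient_moll_apply (isTest_rho n)]
    refine (eLpNorm_moll_rho_le n (by norm_num) (by norm_num) (memLp_apply hG j).1).trans ?_
    exact (eLpNorm_mono fun x => abs_apply_le_norm _ _).trans (hM t)
  refine (Finset.sum_le_sum fun j _ => h1 j).trans (le_of_eq ?_)
  simp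

lemma exists_bound_mop_v (h : IsLinearSolution t₀ t₁ v w F) {k : E3 → ℝ} (hk : IsTest k) {δ : ℝ}
    (hδ : 0 ≤ δ) : ∃ M : ℝ≥0, ∀ t,
      eLpNorm (mop δ (moll k (v t)) (gradient (moll k (v t)))) 2 volume ≤ M := by
  obtain ⟨M, hM⟩ := h.exists_bound_pd_v hk
  refine ⟨4 * (3 * M), fun t => ?_⟩
  refine (eLpNorm_mop_le (h.memLp_six_moll hk t) (h.memLp_gradient_moll hk t)
    (h.isWeakGradient_moll hk t) hδ).trans ?_
  push_cast
  gcongr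
  refine (eLpNorm_le_sum_apply (h.memLp_gradient_moll hk t).1 (by norm_num)).trans ?_
  have h1 : ∀ j, eLpNorm (fun x => gradient (moll k (v t)) x j) 2 volume ≤ M := fun j => by
    simp only [gradient_apply, h.pd_eq_v hk]
    exact hM t j
  refine (Finset.sum_le_sum fun j _ => h1 j).trans (le_of_eq ?_)
  simp

/-- Since `w` is only in `L²`, the bound depends on the smoothing kernel and on `δ`. -/
lemma exists_bound_mop_w (h : IsLinearSolution t₀ t₁ v w F) {k : E3 → ℝ} (hk : IsTest k) {δ : ℝ}
    (hδ : 0 < δ) : ∃ M : ℝ≥0, ∀ t,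
      eLpNorm (mop δ (moll k (w t)) (gradient (moll k (w t)))) 2 volume ≤ M := by
  obtain ⟨M, hM⟩ := h.exists_bound_w hk
  choose N hN using fun j => h.exists_bound_w (hk.pd j)
  refine ⟨(∑ j, N j) + (3 / 2 * δ⁻¹).toNNReal * M, fun t => ?_⟩
  have hc : Continuous (gradient (moll k (w t))) :=
    continuous_gradient (contDiff_moll hk (h.li_w t))
  have h1 : eLpNorm (gradient (moll k (w t))) 2 volume ≤ ∑ j, (N j : ℝ≥0∞) := by
    refine (eLpNorm_le_sum_apply hc.aestronglyMeasurable (by norm_num)).trans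
      (Finset.sum_le_sum fun j _ => ?_)
    simp only [gradient_apply, h.pd_eq_w hk]
    exact hN j t
  have h2 : eLpNorm (fun x => 3 / 2 * |sw δ x * moll k (w t) x|) 2 volume
      ≤ (3 / 2 * δ⁻¹).toNNReal * M := by
    refine (eLpNorm_le_nnreal_smul_eLpNorm_of_ae_le_mul (g := moll k (w t))
      (c := (3 / 2 * δ⁻¹).toNNReal) (.of_forall fun x => ?_) 2).trans ?_
    · rw [← NNReal.coe_le_coe]
      push_cast
      rw [Real.coe_toNNReal _ (by positivity), norm_mul, Real.norm_eq_abs, Real.norm_eq_abs,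
        Real.norm_eq_abs, abs_abs, abs_mul, abs_of_nonneg (sw_nonneg δ x),
        abs_of_pos (by norm_num : (0 : ℝ) < 3 / 2), mul_assoc]
      have := sw_mul_le δ x
      rw [abs_of_pos hδ, ← le_div_iff₀ hδ, one_div] at this
      gcongr
    · rw [ENNReal.smul_def, smul_eq_mul]
      gcongr
      exact hM t
  push_cast
  have hm : AEStronglyMeasurable (moll k (w t)) volume :=
    (contDiff_moll hk (h.li_w t)).continuous.aestronglyMeasurable
  calc eLpNorm (mop δ (moll k (w t)) (gradient (moll k (w t)))) 2 volume
      ≤ eLpNorm (fun x => ‖gradient (moll k (w t)) x‖ + 3 / 2 * |sw δ x * moll k (w t) x|) 2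
        volume := eLpNorm_mono fun x => by
          rw [Real.norm_eq_abs, Real.norm_eq_abs]
          exact (abs_mop_le δ _ _ x).trans (le_abs_self _)
    _ ≤ eLpNorm (fun x => ‖gradient (moll k (w t)) x‖) 2 volume
        + eLpNorm (fun x => 3 / 2 * |sw δ x * moll k (w t) x|) 2 volume :=
        eLpNorm_add_le hc.norm.aestronglyMeasurable
          (((measurable_sw δ).aestronglyMeasurable.mul hm).norm.const_mul _) (by norm_num)
    _ ≤ _ := add_le_add ((eLpNorm_norm _).le.trans h1) h2

lemma lintegral_moll_F_lt_top (h : IsLinearSolution t₀ t₁ v w F) {k : E3 → ℝ} (hk : IsTest k) :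
    ∫⁻ t in Icc t₀ t₁, eLpNorm (moll k (F t)) 2 volume < ⊤ := by
  have h1 : ∀ t, eLpNorm (moll k (F t)) 2 volume ≤ (∫⁻ x, ‖k x‖ₑ) * eLpNorm (F t) 2 volume :=
    fun t => eLpNorm_moll_le hk.integrable (by norm_num) (by norm_num) (h.cont_F.wint t).1
  refine (lintegral_mono h1).trans_lt ?_
  rw [lintegral_const_mul _ h.measurable_F]
  exact ENNReal.mul_lt_top hk.integrable.2 h.int_F

/-- The Morawetz estimate for the smoothed solution and the smoothed multiplier. -/
lemma morawetz_moll (h : IsLinearSolution t₀ t₁ v w F) (h01 : t₀ ≤ t₁) {k : E3 → ℝ}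
    (hk : IsTest k) {δ : ℝ} (hδ : 0 < δ) :
    (∫ x, moll k (w t₁) x * mop δ (moll k (v t₁)) (gradient (moll k (v t₁))) x)
      - (∫ x, moll k (w t₀) x * mop δ (moll k (v t₀)) (gradient (moll k (v t₀))) x)
      ≤ ∫ t in Icc t₀ t₁, ∫ x, moll k (F t) x * mop δ (moll k (v t)) (gradient (moll k (v t))) x := by
  obtain ⟨M₁, hM₁⟩ := h.exists_bound_w hk
  obtain ⟨M₂, hM₂⟩ := h.exists_bound_mop_v hk hδ.le
  obtain ⟨K, hK⟩ := h.exists_bound_mop_w hk hδ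
  have mf : Measurable fun q : ℝ × E3 => lapT (moll k (v q.1)) q.2 + moll k (F q.1) q.2 :=
    (h.measurable_lapT hk).add (h.cont_F.measurable_moll hk)
  obtain ⟨i1, e1⟩ := integral_leibniz h01 (a := fun t => moll k (w t))
    (b := fun t => mop δ (moll k (v t)) (gradient (moll k (v t))))
    (a' := fun t x => lapT (moll k (v t)) x + moll k (F t) x)
    (b' := fun t => mop δ (moll k (w t)) (gradient (moll k (w t))))
    (h.cont_w.measurable_moll hk) (h.measurable_mop_moll hk δ) mf (h.measurable_mop_moll_w hk δ)
    (fun x => (h.continuous_lapT hk x).add (h.cont_F.continuous_moll hk x))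
    (h.continuous_mop_moll_w hk δ) (h.eq_w k hk) (fun t ht x => h.mop_moll_eq hk δ ht x)
    (M := max M₁ M₂) (fun t => (hM₁ t).trans (by exact_mod_cast le_max_left _ _))
    (fun t => (hM₂ t).trans (by exact_mod_cast le_max_right _ _)) (h.lintegral_rhs_lt_top hk)
    (lintegral_lt_top_of_bound hK)
  rw [e1]
  have i2 := (integrable_prod_mul (t₀ := t₀) (t₁ := t₁) (h.cont_F.measurable_moll hk)
    (h.measurable_mop_moll hk δ) (h.lintegral_moll_F_lt_top hk) hM₂).integral_prod_left
  refine integral_mono_ae i1 i2 ?_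
  filter_upwards [h.ae_memLp_F] with t ht
  have hu := contDiff_moll hk (h.li_v t)
  have Lw := h.memLp_moll_w hk t
  have Lpv : ∀ j, MemLp (pd j (moll k (v t))) 2 volume := fun j => by
    rw [h.pd_eq_v hk]; exact h.memLp_pd_v hk j t
  have Lpw : ∀ j, MemLp (pd j (moll k (w t))) 2 volume := fun j => by
    rw [h.pd_eq_w hk]; exact h.memLp_moll_w (hk.pd j) t
  have Lppv : ∀ i j, MemLp (pd i (pd j (moll k (v t)))) 2 volume := fun i j => by
    rw [h.pd_eq_v hk, h.pd_eq_v (hk.pd j)]; exact h.memLp_pd_v (hk.pd j) i t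
  have LF : MemLp (moll k (F t)) 2 volume := memLp_moll hk (by norm_num) (by norm_num) ht
  have Lhardy : MemLp (fun x => sw δ x * moll k (v t) x) 2 volume :=
    ⟨(measurable_sw δ).aestronglyMeasurable.mul hu.continuous.aestronglyMeasurable,
      (eLpNorm_hardy (h.memLp_six_moll hk t) (h.memLp_gradient_moll hk t)
        (h.isWeakGradient_moll hk t) hδ.le).trans_lt
        (ENNReal.mul_lt_top (by norm_num) (h.memLp_gradient_moll hk t).2)⟩
  have Lm := memLp_mop_gradient hδ Lhardy Lpv
  have Lmw := memLp_mop_gradient hδ ((bc_sw hδ).memLp Lw) Lpw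
  -- the contributions of `Δv` and of `∂ₜ` of the multiplier
  have s1 := integral_laplacian_mul_mop_nonpos hδ hu Lhardy Lpv Lppv
  have s2 := integral_mul_mop_self hδ (contDiff_moll hk (h.li_w t)) Lw Lpw
  have Llap : MemLp (lapT (moll k (v t))) 2 volume := ((Lppv 0 0).add (Lppv 1 1)).add (Lppv 2 2)
  have j1 : Integrable fun x => lapT (moll k (v t)) x * mop δ (moll k (v t)) (gradient (moll k (v t))) x :=
    Llap.integrable_mul Lm
  have j2 : Integrable fun x => moll k (F t) x * mop δ (moll k (v t)) (gradient (moll k (v t))) x :=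
    LF.integrable_mul Lm
  have j3 : Integrable fun x => moll k (w t) x * mop δ (moll k (w t)) (gradient (moll k (w t))) x :=
    Lw.integrable_mul Lmw
  simp only [add_mul]
  have j12 : Integrable fun x => lapT (moll k (v t)) x * mop δ (moll k (v t)) (gradient (moll k (v t))) x
    + moll k (F t) x * mop δ (moll k (v t)) (gradient (moll k (v t))) x := j1.add j2
  rw [integral_add j12 j3, integral_add j1 j2, s2]
  have s1' : ∫ x, lapT (moll k (v t)) x * mop δ (moll k (v t)) (gradient (moll k (v t))) x ≤ 0 := s1
  linarith

lemma tendsto_moll_w (h : IsLinearSolution t₀ t₁ v w F) (t : ℝ) :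
    Tendsto (fun n => eLpNorm (moll (rho n) (w t) - w t) 2 volume) atTop (𝓝 0) :=
  tendsto_eLpNorm_moll_rho_sub (by norm_num) (by norm_num) (h.mem_w t)

lemma tendsto_gradient_moll (h : IsLinearSolution t₀ t₁ v w F) (t : ℝ) :
    Tendsto (fun n => eLpNorm (gradient (moll (rho n) (v t)) - weakGrad (v t)) 2 volume) atTop
      (𝓝 0) := by
  have hG := (h.mem_v t).weakGrad.1
  have h1 : Tendsto (fun n => ∑ j, eLpNorm (moll (rho n) (fun x => weakGrad (v t) x j)
      - fun x => weakGrad (v t) x j) 2 volume) atTop (𝓝 0) := by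
    have := tendsto_finsetSum Finset.univ fun (j : Fin 3) _ =>
      tendsto_eLpNorm_moll_rho_sub (by norm_num) (by norm_num) (memLp_apply hG j)
    simpa using this
  refine tendsto_of_tendsto_of_tendsto_of_le_of_le tendsto_const_nhds h1 (fun _ => bot_le) fun n => ?_
  refine (eLpNorm_le_sum_apply ((h.memLp_gradient_moll (isTest_rho n) t).sub hG).1
    (by norm_num)).trans (Finset.sum_le_sum fun j _ => le_of_eq ?_)
  congr 1; ext x
  rw [Pi.sub_apply, ← h.gradient_moll_apply (isTest_rho n)]
  rfl

lemma tendsto_mop_moll (h : IsLinearSolution t₀ t₁ v w F) (t : ℝ) :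
    Tendsto (fun n : ℕ => eLpNorm (mop (1 / ((n : ℝ) + 1)) (moll (rho n) (v t))
      (gradient (moll (rho n) (v t))) - mop 0 (v t) (weakGrad (v t))) 2 volume) atTop (𝓝 0) :=
  tendsto_mop (h.mem_v t).1 (h.mem_v t).weakGrad.1 (h.mem_v t).weakGrad.2
    (fun n => by positivity) tendsto_one_div_add_atTop_nhds_zero_nat
    (fun n => h.memLp_six_moll (isTest_rho n) t) (fun n => h.memLp_gradient_moll (isTest_rho n) t)
    (fun n => h.isWeakGradient_moll (isTest_rho n) t) (h.tendsto_gradient_moll t)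

lemma memLp_mop_v (h : IsLinearSolution t₀ t₁ v w F) (t : ℝ) :
    MemLp (mop 0 (v t) (weakGrad (v t))) 2 volume :=
  memLp_mop (h.mem_v t).1 (h.mem_v t).weakGrad.1 (h.mem_v t).weakGrad.2 le_rfl

lemma ae_tendsto_moll_F (h : IsLinearSolution t₀ t₁ v w F) :
    ∀ᵐ t ∂volume.restrict (Icc t₀ t₁), MemLp (F t) 2 volume ∧
      Tendsto (fun n => eLpNorm (moll (rho n) (F t) - F t) 2 volume) atTop (𝓝 0) := by
  filter_upwards [h.ae_memLp_F] with t ht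
  exact ⟨ht, tendsto_eLpNorm_moll_rho_sub (by norm_num) (by norm_num) ht⟩

/-- The Morawetz estimate for finite energy solutions of the linear wave equation. -/
theorem morawetz (h : IsLinearSolution t₀ t₁ v w F) (h01 : t₀ ≤ t₁) :
    IntegrableOn (fun t => ∫ x, F t x * mop 0 (v t) (weakGrad (v t)) x) (Icc t₀ t₁) ∧
    (∫ x, w t₁ x * mop 0 (v t₁) (weakGrad (v t₁)) x)
      - (∫ x, w t₀ x * mop 0 (v t₀) (weakGrad (v t₀)) x)
      ≤ ∫ t in Icc t₀ t₁, ∫ x, F t x * mop 0 (v t) (weakGrad (v t)) x := by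
  obtain ⟨M, hM⟩ := h.bound
  obtain ⟨i, l⟩ := tendsto_integral_integral_mul (M := 4 * (3 * M)) h.measurable_F h.int_F
    (an := fun n t => moll (rho n) (F t))
    (bn := fun n t => mop (1 / ((n : ℝ) + 1)) (moll (rho n) (v t)) (gradient (moll (rho n) (v t))))
    (fun n => h.cont_F.measurable_moll (isTest_rho n))
    (fun n => h.measurable_mop_moll (isTest_rho n) _)
    (fun n t => eLpNorm_moll_rho_le n (by norm_num) (by norm_num) (h.cont_F.wint t).1)
    (fun n t => (eLpNorm_mop_le (h.memLp_six_moll (isTest_rho n) t)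
      (h.memLp_gradient_moll (isTest_rho n) t) (h.isWeakGradient_moll (isTest_rho n) t)
      (by positivity)).trans (by
        push_cast
        gcongr
        exact h.eLpNorm_gradient_moll_rho_le (fun t => (hM t).1) n t))
    h.ae_tendsto_moll_F (b := fun t => mop 0 (v t) (weakGrad (v t)))
    (.of_forall fun t => ⟨h.memLp_mop_v t, h.tendsto_mop_moll t⟩)
  refine ⟨i, ?_⟩
  have e := fun t => tendsto_integral_mul (h.mem_w t) (h.memLp_mop_v t)
    (fun n => h.memLp_moll_w (isTest_rho n) t)
    (fun n => memLp_mop (h.memLp_six_moll (isTest_rho n) t)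
      (h.memLp_gradient_moll (isTest_rho n) t) (h.isWeakGradient_moll (isTest_rho n) t)
      (by positivity : (0 : ℝ) ≤ 1 / ((n : ℝ) + 1))) (h.tendsto_moll_w t) (h.tendsto_mop_moll t)
  exact le_of_tendsto_of_tendsto' ((e t₁).sub (e t₀)) l fun n =>
    h.morawetz_moll h01 (isTest_rho n) (by positivity)

/-- The energy identity for finite energy solutions of the linear wave equation. -/
theorem energy_identity (h : IsLinearSolution t₀ t₁ v w F) (h01 : t₀ ≤ t₁) :
    IntegrableOn (fun t => ∫ x, F t x * w t x) (Icc t₀ t₁) ∧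
    ((∫ x, w t₁ x * w t₁ x) + ∑ j, ∫ x, weakGrad (v t₁) x j * weakGrad (v t₁) x j)
      - ((∫ x, w t₀ x * w t₀ x) + ∑ j, ∫ x, weakGrad (v t₀) x j * weakGrad (v t₀) x j)
      = 2 * ∫ t in Icc t₀ t₁, ∫ x, F t x * w t x := by
  obtain ⟨M, hM⟩ := h.bound
  obtain ⟨i, l⟩ := tendsto_integral_integral_mul (M := M) h.measurable_F h.int_F
    (an := fun n t => moll (rho n) (F t)) (bn := fun n t => moll (rho n) (w t))
    (fun n => h.cont_F.measurable_moll (isTest_rho n))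
    (fun n => h.cont_w.measurable_moll (isTest_rho n))
    (fun n t => eLpNorm_moll_rho_le n (by norm_num) (by norm_num) (h.cont_F.wint t).1)
    (fun n t => (eLpNorm_moll_rho_le n (by norm_num) (by norm_num) (h.mem_w t).1).trans (hM t).2)
    h.ae_tendsto_moll_F (b := w) (.of_forall fun t => ⟨h.mem_w t, h.tendsto_moll_w t⟩)
  refine ⟨i, ?_⟩
  have e1 := fun t => tendsto_integral_mul (h.mem_w t) (h.mem_w t)
    (fun n => h.memLp_moll_w (isTest_rho n) t) (fun n => h.memLp_moll_w (isTest_rho n) t)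
    (h.tendsto_moll_w t) (h.tendsto_moll_w t)
  have e2 : ∀ t j, Tendsto (fun n => ∫ x, moll (pd j (rho n)) (v t) x * moll (pd j (rho n)) (v t) x)
      atTop (𝓝 (∫ x, weakGrad (v t) x j * weakGrad (v t) x j)) := by
    intro t j
    have hG := memLp_apply (h.mem_v t).weakGrad.1 j
    have hl := tendsto_eLpNorm_moll_rho_sub (by norm_num) (by norm_num) hG
    have hm := fun n => memLp_moll (isTest_rho n) (by norm_num) (by norm_num) hG
    have := tendsto_integral_mul hG hG hm hm hl hl
    refine this.congr fun n => ?_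
    rw [← h.pd_eq_v (isTest_rho n), (h.mem_v t).weakGrad.2.pd_moll (isTest_rho n)]
  have e3 := fun t => (e1 t).add (tendsto_finsetSum Finset.univ fun j _ => e2 t j)
  refine tendsto_nhds_unique ((e3 t₁).sub (e3 t₀)) ((l.const_mul 2).congr fun n => ?_)
  exact (h.energy_identity_moll h01 (isTest_rho n)).symm

end IsLinearSolution

/-! ### The power nonlinearity -/

/-- The power nonlinearity `|a| ^ (p - 1) a`. -/
def npow (p a : ℝ) : ℝ := |a| ^ (p - 1) * a

lemma abs_npow {p : ℝ} (hp : 3 ≤ p) (a : ℝ) : |npow p a| = |a| ^ p := by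
  rw [npow, abs_mul, abs_of_nonneg (by positivity)]
  rcases eq_or_ne a 0 with rfl | ha
  · rw [abs_zero, mul_zero, Real.zero_rpow (by linarith)]
  · rw [Real.rpow_sub_one (abs_ne_zero.2 ha)]
    field_simp

lemma npow_mul_self {p : ℝ} (hp : 3 ≤ p) (a : ℝ) : npow p a * a = |a| ^ (p + 1) := by
  rw [npow, mul_assoc, ← abs_mul_abs_self a, ← mul_assoc]
  rcases eq_or_ne a 0 with rfl | ha
  · rw [abs_zero, mul_zero, Real.zero_rpow (by linarith)]
  · have h := abs_pos.2 ha
    rw [Real.rpow_sub_one h.ne', Real.rpow_add_one h.ne']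
    field_simp

lemma continuous_npow {p : ℝ} (hp : 3 ≤ p) : Continuous (npow p) := by
  unfold npow
  exact (continuous_abs.rpow_const fun x => .inr (by linarith)).mul continuous_id

lemma hasDerivAt_npow {p : ℝ} (hp : 3 ≤ p) (a : ℝ) : HasDerivAt (npow p) (p * |a| ^ (p - 1)) a := by
  have h := (hasDerivAt_abs_rpow a (p := p - 1) (by linarith)).mul (hasDerivAt_id a)
  refine h.congr_deriv ?_
  rcases eq_or_ne a 0 with rfl | ha
  · simp [Real.zero_rpow (by linarith : p - 1 ≠ 0)]
  · have hs : a * a = |a| ^ (2 : ℝ) := by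
      rw [← abs_mul_abs_self, show (2 : ℝ) = ((2 : ℕ) : ℝ) by norm_num, Real.rpow_natCast]; ring
    have : |a| ^ (p - 1 - 2) * (a * a) = |a| ^ (p - 1) := by
      rw [hs, ← Real.rpow_add (abs_pos.2 ha)]
      congr 1; ring
    simp only [id, mul_one]
    rw [mul_assoc, mul_assoc, this]
    ring

lemma hasDerivAt_abs_rpow_add_one {p : ℝ} (hp : 3 ≤ p) (a : ℝ) :
    HasDerivAt (fun a : ℝ => |a| ^ (p + 1)) ((p + 1) * npow p a) a := by
  refine (hasDerivAt_abs_rpow a (p := p + 1) (by linarith)).congr_deriv ?_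
  rw [npow, show p + 1 - 2 = p - 1 by ring, mul_assoc]

lemma abs_npow_sub_le {p : ℝ} (hp : 3 ≤ p) (a b : ℝ) :
    |npow p a - npow p b| ≤ p * (|a| ^ (p - 1) + |b| ^ (p - 1)) * |a - b| := by
  refine Convex.norm_image_sub_le_of_norm_hasDerivWithin_le (f := npow p) (s := uIcc b a)
    (fun x _ => (hasDerivAt_npow hp x).hasDerivWithinAt) (fun x hx => ?_) (convex_uIcc b a)
    left_mem_uIcc right_mem_uIcc
  rw [Real.norm_eq_abs, abs_mul, abs_of_pos (by linarith : 0 < p), abs_of_nonneg (by positivity)]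
  gcongr
  have h1 : |x| ≤ max |b| |a| := by
    rcases mem_uIcc.1 hx with h | h
    · exact abs_le_max_abs_abs h.1 h.2
    · rw [max_comm]; exact abs_le_max_abs_abs h.1 h.2
  rcases le_max_iff.1 h1 with h | h
  · have := Real.rpow_le_rpow (abs_nonneg x) h (by linarith : 0 ≤ p - 1)
    have : 0 ≤ |a| ^ (p - 1) := by positivity
    linarith
  · have := Real.rpow_le_rpow (abs_nonneg x) h (by linarith : 0 ≤ p - 1)
    have : 0 ≤ |b| ^ (p - 1) := by positivity
    linarith

/-- The tangent line inequality for the convex function `|a| ^ (p + 1)`. -/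
lemma rpow_sub_rpow_le {p : ℝ} (hp : 3 ≤ p) (a b : ℝ) :
    |a| ^ (p + 1) - |b| ^ (p + 1) ≤ (p + 1) * (npow p a * (a - b)) := by
  -- Young's inequality for `b` and `|a| ^ (p - 1) a`
  have hc : (p + 1).HolderConjugate ((p + 1) / p) := by
    rw [Real.holderConjugate_iff]
    refine ⟨by linarith, ?_⟩
    have : p ≠ 0 := by linarith
    have : p + 1 ≠ 0 := by linarith
    field_simp
    ring
  have h := Real.young_inequality b (npow p a) hc
  have hp0 : p ≠ 0 := by linarith
  rw [abs_npow hp, ← Real.rpow_mul (abs_nonneg a), mul_div_cancel₀ _ hp0] at h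
  have h2 := npow_mul_self hp a
  have h3 : |b| ^ (p + 1) / (p + 1) + |a| ^ (p + 1) / ((p + 1) / p)
      = (|b| ^ (p + 1) + p * |a| ^ (p + 1)) / (p + 1) := by
    have : p + 1 ≠ 0 := by linarith
    field_simp
  rw [h3, le_div_iff₀ (by linarith)] at h
  linarith [congrArg (fun z => (p + 1) * z) h2]

lemma eLpNorm_npow {p Q : ℝ} (hp : 3 ≤ p) (hQ : p ≤ Q) (f : E3 → ℝ) :
    eLpNorm (fun x => npow p (f x)) (ENNReal.ofReal (Q / p)) volume
      = eLpNorm f (ENNReal.ofReal Q) volume ^ p := by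
  have hp0 : 0 < p := by linarith
  have h := eLpNorm_norm_rpow (p := ENNReal.ofReal (Q / p)) (μ := (volume : Measure E3)) f hp0
  rw [← ENNReal.ofReal_mul (div_nonneg (by linarith) hp0.le), div_mul_cancel₀ _ hp0.ne'] at h
  rw [← h]
  refine eLpNorm_congr_norm_ae (.of_forall fun x => ?_)
  rw [Real.norm_eq_abs, abs_npow hp, Real.norm_eq_abs, Real.norm_eq_abs,
    abs_of_nonneg (Real.rpow_nonneg (abs_nonneg _) _)]

lemma eLpNorm_npow_sub_le {p Q : ℝ} (hp : 3 ≤ p) (hQ : p ≤ Q) {f g : E3 → ℝ}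
    (hf : AEStronglyMeasurable f volume) (hg : AEStronglyMeasurable g volume) :
    eLpNorm (fun x => npow p (f x) - npow p (g x)) (ENNReal.ofReal (Q / p)) volume
      ≤ ENNReal.ofReal p * (eLpNorm f (ENNReal.ofReal Q) volume ^ (p - 1)
        + eLpNorm g (ENNReal.ofReal Q) volume ^ (p - 1))
        * eLpNorm (f - g) (ENNReal.ofReal Q) volume := by
  have hp1 : 0 < p - 1 := by linarith
  have hQ0 : 0 < Q := by linarith
  have hp0 : 0 < p := by linarith
  have ht : (ENNReal.ofReal (Q / (p - 1))).HolderTriple (ENNReal.ofReal Q) (ENNReal.ofReal (Q / p)) := by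
    refine Real.HolderTriple.ennrealOfReal ⟨?_, by positivity, by positivity⟩
    field_simp
    ring
  have h1 : ∀ {f : E3 → ℝ}, AEStronglyMeasurable f volume →
      AEStronglyMeasurable (fun x => ‖f x‖ ^ (p - 1)) volume := fun hf =>
    (Real.continuous_rpow_const hp1.le).comp_aestronglyMeasurable hf.norm
  have h2 : ∀ f : E3 → ℝ, eLpNorm (fun x => ‖f x‖ ^ (p - 1)) (ENNReal.ofReal (Q / (p - 1))) volume
      = eLpNorm f (ENNReal.ofReal Q) volume ^ (p - 1) := fun f => by
    rw [eLpNorm_norm_rpow f hp1, ← ENNReal.ofReal_mul (by positivity), div_mul_cancel₀ _ hp1.ne']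
  have hQ1 : 1 ≤ ENNReal.ofReal (Q / (p - 1)) := by
    rw [ENNReal.one_le_ofReal, le_div_iff₀ hp1]; linarith
  calc eLpNorm (fun x => npow p (f x) - npow p (g x)) (ENNReal.ofReal (Q / p)) volume
      ≤ eLpNorm ((p • fun x => ‖f x‖ ^ (p - 1) + ‖g x‖ ^ (p - 1)) • (f - g))
          (ENNReal.ofReal (Q / p)) volume := by
        refine eLpNorm_mono fun x => ?_
        simp only [Pi.smul_apply', Pi.smul_apply, Pi.sub_apply, smul_eq_mul]
        rw [norm_mul, norm_mul, Real.norm_eq_abs p, abs_of_pos hp0]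
        refine (abs_npow_sub_le hp _ _).trans (le_of_eq ?_)
        rw [Real.norm_eq_abs (_ + _), abs_of_nonneg (add_nonneg (Real.rpow_nonneg (norm_nonneg _) _)
          (Real.rpow_nonneg (norm_nonneg _) _))]
        rfl
    _ ≤ _ := eLpNorm_smul_le_mul_eLpNorm (p := ENNReal.ofReal (Q / (p - 1)))
        (hf.sub hg) (((h1 hf).add (h1 hg)).const_smul p)
    _ ≤ _ := by
        rw [eLpNorm_const_smul, Real.enorm_eq_ofReal hp0.le, ← h2 f, ← h2 g]
        gcongr
        exact eLpNorm_add_le (h1 hf) (h1 hg) hQ1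

/-- Continuity of the power nonlinearity from `L^Q` to `L^(Q/p)`. -/
lemma tendsto_eLpNorm_npow_sub {ι : Type*} {l : Filter ι} {p Q : ℝ} (hp : 3 ≤ p) (hQ : p ≤ Q)
    {f : ι → E3 → ℝ} {g : E3 → ℝ} (hf : ∀ i, AEStronglyMeasurable (f i) volume)
    (hg : MemLp g (ENNReal.ofReal Q) volume)
    (h : Tendsto (fun i => eLpNorm (f i - g) (ENNReal.ofReal Q) volume) l (𝓝 0)) :
    Tendsto (fun i => eLpNorm (fun x => npow p (f i x) - npow p (g x)) (ENNReal.ofReal (Q / p)) volume)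
      l (𝓝 0) := by
  set A := eLpNorm g (ENNReal.ofReal Q) volume
  have hA : A ≠ ⊤ := hg.2.ne
  have hp1 : 0 < p - 1 := by linarith
  have hQ1 : 1 ≤ ENNReal.ofReal Q := by rw [ENNReal.one_le_ofReal]; linarith
  have h1 : Tendsto (fun i => ENNReal.ofReal p * ((A + eLpNorm (f i - g) (ENNReal.ofReal Q) volume)
      ^ (p - 1) + A ^ (p - 1)) * eLpNorm (f i - g) (ENNReal.ofReal Q) volume) l (𝓝 0) := by
    have e1 : Tendsto (fun i => (A + eLpNorm (f i - g) (ENNReal.ofReal Q) volume) ^ (p - 1)) l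
        (𝓝 (A ^ (p - 1))) := by
      have := (tendsto_const_nhds (x := A)).add h
      rw [add_zero] at this
      exact (ENNReal.continuous_rpow_const.tendsto A).comp this
    have hA' : A ^ (p - 1) ≠ ⊤ := ENNReal.rpow_ne_top_of_nonneg hp1.le hA
    have e2 := ENNReal.Tendsto.const_mul (a := ENNReal.ofReal p)
      (e1.add (tendsto_const_nhds (x := A ^ (p - 1)))) (.inr ENNReal.ofReal_ne_top)
    have e3 := ENNReal.Tendsto.mul e2 (.inr ENNReal.zero_ne_top) h
      (.inr (ENNReal.mul_ne_top ENNReal.ofReal_ne_top (ENNReal.add_ne_top.2 ⟨hA', hA'⟩)))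
    simpa using e3
  refine tendsto_of_tendsto_of_tendsto_of_le_of_le tendsto_const_nhds h1 (fun _ => bot_le) fun i => ?_
  refine (eLpNorm_npow_sub_le hp hQ (hf i) hg.1).trans ?_
  have h2 : eLpNorm (f i) (ENNReal.ofReal Q) volume
      ≤ A + eLpNorm (f i - g) (ENNReal.ofReal Q) volume := by
    have := eLpNorm_add_le hg.1 ((hf i).sub hg.1) hQ1
    rwa [add_sub_cancel] at this
  gcongr

/-- A function which is locally bounded on a compact set is bounded on it. -/
lemma exists_bound_of_eventually_le {f : ℝ → ℝ≥0∞} {K : Set ℝ} (hK : IsCompact K)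
    (h : ∀ t ∈ K, ∃ M : ℝ≥0, ∀ᶠ s in 𝓝[K] t, f s ≤ M) : ∃ M : ℝ≥0, ∀ t ∈ K, f t ≤ M := by
  refine hK.induction_on (p := fun S => ∃ M : ℝ≥0, ∀ t ∈ S, f t ≤ M) ⟨0, by simp⟩
    (fun S S' hSS' ⟨M, hM⟩ => ⟨M, fun t ht => hM t (hSS' ht)⟩) ?_ fun t ht => ?_
  · rintro S S' ⟨M, hM⟩ ⟨M', hM'⟩
    refine ⟨max M M', fun t ht => ?_⟩
    rcases ht with ht | ht
    · exact (hM t ht).trans (by exact_mod_cast le_max_left _ _)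
    · exact (hM' t ht).trans (by exact_mod_cast le_max_right _ _)
  · obtain ⟨M, hM⟩ := h t ht
    exact ⟨_, hM, M, fun s hs => hs⟩

/-! ### Solutions of the nonlinear equation as solutions of a linear equation -/

/-- The projection of the real line to `[t₀, t₁]`. -/
def clampTime (t₀ t₁ t : ℝ) : ℝ := max t₀ (min t t₁)

lemma continuous_clampTime (t₀ t₁ : ℝ) : Continuous (clampTime t₀ t₁) := by
  unfold clampTime; fun_prop

lemma clampTime_mem {t₀ t₁ : ℝ} (h : t₀ ≤ t₁) (t : ℝ) : clampTime t₀ t₁ t ∈ Icc t₀ t₁ :=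
  ⟨le_max_left _ _, max_le h (min_le_right _ _)⟩

lemma clampTime_eq {t₀ t₁ t : ℝ} (h : t ∈ Icc t₀ t₁) : clampTime t₀ t₁ t = t := by
  rw [clampTime, min_eq_left h.2, max_eq_right h.1]

lemma tendsto_clampTime {t₀ t₁ : ℝ} (h : t₀ ≤ t₁) {I : Set ℝ} (hI : Icc t₀ t₁ ⊆ I) (t : ℝ) :
    Tendsto (clampTime t₀ t₁) (𝓝 t) (𝓝[I] (clampTime t₀ t₁ t)) :=
  tendsto_nhdsWithin_iff.2 ⟨(continuous_clampTime t₀ t₁).tendsto t,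
    .of_forall fun s => hI (clampTime_mem h s)⟩

lemma nonlinearity_eq (φ : E3 → ℝ) (κ p : ℝ) (v : ℝ → E3 → ℝ) (t : ℝ) (x : E3) :
    nonlinearity φ κ p v t x = -(φ x * Real.exp (-κ * t)) * npow p (v t x) := by
  rw [nonlinearity, npow]; ring

lemma eLpNorm_weight_mul_le {φ : E3 → ℝ} (hφ : ∀ x, 0 ≤ φ x ∧ φ x ≤ 1) (c : ℝ) (f : E3 → ℝ)
    (q : ℝ≥0∞) : eLpNorm (fun x => φ x * (c * f x)) q volume ≤ ‖c‖ₑ * eLpNorm f q volume := by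
  rw [← eLpNorm_const_smul]
  refine eLpNorm_mono fun x => ?_
  rw [norm_mul, Pi.smul_apply, smul_eq_mul, Real.norm_eq_abs, abs_of_nonneg (hφ x).1]
  exact mul_le_of_le_one_left (norm_nonneg _) (hφ x).2

namespace IsSolution

variable {φ : E3 → ℝ} {κ p t₀ : ℝ} {I : Set ℝ} {v₀ v₁ : E3 → ℝ} {v w : ℝ → E3 → ℝ}

/-- Continuity in `Ḣ¹` gives continuity in `L⁶`, by Sobolev's inequality. -/
lemma tendsto_six (h : IsSolution φ κ p t₀ I v₀ v₁ v w) {t : ℝ} (ht : t ∈ I) :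
    Tendsto (fun s => eLpNorm (v s - v t) 6 volume) (𝓝[I] t) (𝓝 0) := by
  obtain ⟨C, hC⟩ := exists_sobolev
  have h1 := ENNReal.Tendsto.const_mul (a := (C : ℝ≥0∞)) (h.continuous_hDot1 t ht)
    (.inr ENNReal.coe_ne_top)
  rw [mul_zero] at h1
  refine tendsto_of_tendsto_of_tendsto_of_le_of_le' tendsto_const_nhds h1 (.of_forall fun _ => bot_le)
    ?_
  filter_upwards [self_mem_nhdsWithin] with s hs
  have h2 := (h.mem_hDot1 s hs).sub (h.mem_hDot1 t ht)
  exact hC _ _ h2.1 h2.weakGrad.1 h2.weakGrad.2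

lemma exists_bound (h : IsSolution φ κ p t₀ I v₀ v₁ v w) {t₁ : ℝ} (hI : Icc t₀ t₁ ⊆ I) :
    ∃ M : ℝ≥0, ∀ t ∈ Icc t₀ t₁, eLpNorm (weakGrad (v t)) 2 volume ≤ M ∧ eLpNorm (w t) 2 volume ≤ M := by
  have key : ∀ {E : Type} [NormedAddCommGroup E] {f : ℝ → E3 → E} {g : ℝ → ℝ → E3 → E},
      (∀ t ∈ I, MemLp (f t) 2 volume) →
      (∀ t ∈ I, ∀ s ∈ I, AEStronglyMeasurable (g s t) volume ∧ f s =ᵐ[volume] g s t + f t) →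
      (∀ t ∈ I, Tendsto (fun s => eLpNorm (g s t) 2 volume) (𝓝[I] t) (𝓝 0)) →
      ∃ M : ℝ≥0, ∀ t ∈ Icc t₀ t₁, eLpNorm (f t) 2 volume ≤ M := by
    intro E _ f g hf hg hlim
    refine exists_bound_of_eventually_le isCompact_Icc fun t ht => ?_
    refine ⟨1 + (eLpNorm (f t) 2 volume).toNNReal, ?_⟩
    have h1 := (hlim t (hI ht)).mono_left (nhdsWithin_mono t hI)
    filter_upwards [h1.eventually_le_const zero_lt_one, self_mem_nhdsWithin] with s hs hsI
    obtain ⟨hm, he⟩ := hg t (hI ht) s (hI hsI)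
    rw [eLpNorm_congr_ae he]
    refine (eLpNorm_add_le hm (hf t (hI ht)).1 (by norm_num)).trans ?_
    rw [ENNReal.coe_add, ENNReal.coe_toNNReal (hf t (hI ht)).2.ne]
    exact add_le_add hs le_rfl
  obtain ⟨M, hM⟩ := key (f := fun t => weakGrad (v t)) (g := fun s t => weakGrad (v s - v t))
    (fun t ht => (h.mem_hDot1 t ht).weakGrad.1)
    (fun t ht s hs => ⟨((h.mem_hDot1 s hs).sub (h.mem_hDot1 t ht)).weakGrad.1.1, by
      filter_upwards [weakGrad_sub (h.mem_hDot1 s hs) (h.mem_hDot1 t ht)] with x hx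
      rw [Pi.add_apply, hx, Pi.sub_apply, sub_add_cancel]⟩) h.continuous_hDot1
  obtain ⟨N, hN⟩ := key (f := w) (g := fun s t => w s - w t) h.mem_velocity
    (fun t ht s hs => ⟨((h.mem_velocity s hs).sub (h.mem_velocity t ht)).1, by
      rw [sub_add_cancel]⟩) h.continuous_velocity
  exact ⟨max M N, fun t ht => ⟨(hM t ht).trans (by exact_mod_cast le_max_left _ _),
    (hN t ht).trans (by exact_mod_cast le_max_right _ _)⟩⟩

variable {t₁ : ℝ}

lemma wCont_v (h : IsSolution φ κ p t₀ I v₀ v₁ v w) (h01 : t₀ ≤ t₁) (hI : Icc t₀ t₁ ⊆ I) :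
    WCont fun t => v (clampTime t₀ t₁ t) := by
  have hf : Fact ((1 : ℝ≥0∞) ≤ 6) := ⟨by norm_num⟩
  have hc : ENNReal.HolderTriple 6 (ENNReal.conjExponent 6) 1 :=
    ENNReal.HolderConjugate.conjExponent hf.out
  refine wCont_of_tendsto (q := 6) (r := ENNReal.conjExponent 6) ?_
    (fun t => (h.mem_hDot1 _ (hI (clampTime_mem h01 t))).1)
    fun t => (h.tendsto_six (hI (clampTime_mem h01 t))).comp (tendsto_clampTime h01 hI t)
  have hc' : ENNReal.HolderConjugate (ENNReal.conjExponent 6) 6 := hc.symm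
  exact ENNReal.HolderConjugate.one_le _ 6

lemma wCont_w (h : IsSolution φ κ p t₀ I v₀ v₁ v w) (h01 : t₀ ≤ t₁) (hI : Icc t₀ t₁ ⊆ I) :
    WCont fun t => w (clampTime t₀ t₁ t) :=
  wCont_of_tendsto (q := 2) (r := 2) (by norm_num)
    (fun t => h.mem_velocity _ (hI (clampTime_mem h01 t)))
    fun t => (h.continuous_velocity _ (hI (clampTime_mem h01 t))).comp (tendsto_clampTime h01 hI t)

/-- The nonlinearity is continuous in time with values in `L^(6/p)`, as `p ≤ 6`. -/
lemma wCont_F (h : IsSolution φ κ p t₀ I v₀ v₁ v w) (hp3 : 3 ≤ p) (hp5 : p < 5)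
    (hφc : Continuous φ) (hφ : ∀ x, 0 ≤ φ x ∧ φ x ≤ 1) (h01 : t₀ ≤ t₁) (hI : Icc t₀ t₁ ⊆ I) :
    WCont fun t => nonlinearity φ κ p v (clampTime t₀ t₁ t) := by
  have hp0 : 0 < p := by linarith
  have h6p : 0 < 6 - p := by linarith
  have h6 : ENNReal.ofReal 6 = 6 := by norm_num
  have ht : (ENNReal.ofReal (6 / p)).HolderTriple (ENNReal.ofReal (6 / (6 - p))) 1 := by
    rw [← ENNReal.ofReal_one]
    refine Real.HolderTriple.ennrealOfReal ⟨?_, by positivity, by positivity⟩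
    field_simp
    ring
  have hr : 1 ≤ ENNReal.ofReal (6 / (6 - p)) := by
    rw [ENNReal.one_le_ofReal, le_div_iff₀ h6p]; linarith
  have hq : 1 ≤ ENNReal.ofReal (6 / p) := by
    rw [ENNReal.one_le_ofReal, le_div_iff₀ hp0]; linarith
  set c := clampTime t₀ t₁ with hc
  have hcI : ∀ t, c t ∈ I := fun t => hI (clampTime_mem h01 t)
  have hv : ∀ t, MemLp (v (c t)) (ENNReal.ofReal 6) volume := fun t => by
    rw [h6]; exact (h.mem_hDot1 _ (hcI t)).1
  have hN : ∀ t, MemLp (fun x => npow p (v (c t) x)) (ENNReal.ofReal (6 / p)) volume := fun t => by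
    refine ⟨(continuous_npow hp3).comp_aestronglyMeasurable (hv t).1, ?_⟩
    rw [eLpNorm_npow hp3 (by linarith)]
    exact ENNReal.rpow_lt_top_of_nonneg hp0.le (hv t).2.ne
  have hF : ∀ t, nonlinearity φ κ p v (c t)
      = fun x => φ x * (-Real.exp (-κ * c t) * npow p (v (c t) x)) := fun t => by
    ext x; rw [nonlinearity_eq]; ring
  have hm : ∀ {a : ℝ} {f : E3 → ℝ}, AEStronglyMeasurable f volume →
      AEStronglyMeasurable (fun x => φ x * (a * f x)) volume := fun hf =>
    hφc.aestronglyMeasurable.mul (hf.const_mul _)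
  refine wCont_of_tendsto (q := ENNReal.ofReal (6 / p)) hr (fun t => ?_) fun t => ?_
  · rw [hF]
    exact ⟨hm (hN t).1, (eLpNorm_weight_mul_le hφ _ _ _).trans_lt
      (ENNReal.mul_lt_top enorm_lt_top (hN t).2)⟩
  · have l1 := tendsto_eLpNorm_npow_sub hp3 (by linarith : p ≤ 6) (fun s => (hv s).1) (hv t)
      (l := 𝓝 t) (by
        rw [h6]
        exact (h.tendsto_six (hcI t)).comp (tendsto_clampTime h01 hI t))
    have hcc : Continuous fun s => Real.exp (-κ * c s) := by
      have := continuous_clampTime t₀ t₁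
      fun_prop
    have l2 : Tendsto (fun s => ‖-Real.exp (-κ * c s)‖ₑ) (𝓝 t) (𝓝 ‖-Real.exp (-κ * c t)‖ₑ) :=
      (continuous_enorm.comp hcc.neg).tendsto t
    have l3 : Tendsto (fun s => ‖Real.exp (-κ * c t) - Real.exp (-κ * c s)‖ₑ) (𝓝 t) (𝓝 0) := by
      have := (continuous_enorm.comp (continuous_const.sub hcc)).tendsto (x := t)
        (f := fun s => ‖Real.exp (-κ * c t) - Real.exp (-κ * c s)‖ₑ)
      simpa using this
    have l4 := (ENNReal.Tendsto.mul l2 (.inr ENNReal.zero_ne_top) l1 (.inr enorm_ne_top)).add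
      (ENNReal.Tendsto.mul_const (b := eLpNorm (fun x => npow p (v (c t) x))
        (ENNReal.ofReal (6 / p)) volume) l3 (.inr (hN t).2.ne))
    rw [mul_zero, zero_mul, add_zero] at l4
    refine tendsto_of_tendsto_of_tendsto_of_le_of_le tendsto_const_nhds l4 (fun _ => bot_le) fun s => ?_
    have e : nonlinearity φ κ p v (c s) - nonlinearity φ κ p v (c t)
        = (fun x => φ x * (-Real.exp (-κ * c s) * (npow p (v (c s) x) - npow p (v (c t) x))))
        + fun x => φ x * ((Real.exp (-κ * c t) - Real.exp (-κ * c s)) * npow p (v (c t) x)) := by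
      rw [hF, hF]; ext x; simp only [Pi.sub_apply, Pi.add_apply]; ring
    simp only [e]
    exact (eLpNorm_add_le (hm ((hN s).1.sub (hN t).1)) (hm (hN t).1) hq).trans
      (add_le_add (eLpNorm_weight_mul_le hφ _ _ _) (eLpNorm_weight_mul_le hφ _ _ _))

/-- The Strichartz norm controls the nonlinearity in `L¹ L²`. -/
lemma lintegral_rpow_lt_top (h : IsSolution φ κ p t₀ I v₀ v₁ v w) (hp3 : 3 ≤ p) (hp5 : p < 5)
    (h01 : t₀ ≤ t₁) (hI : Icc t₀ t₁ ⊆ I) :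
    ∫⁻ t in Icc t₀ t₁, eLpNorm (v (clampTime t₀ t₁ t)) (ENNReal.ofReal (2 * p)) volume ^ p < ⊤ := by
  have hp0 : 0 < p := by linarith
  have hm : Measurable fun t => eLpNorm (v (clampTime t₀ t₁ t)) (ENNReal.ofReal (2 * p)) volume :=
    (h.wCont_v h01 hI).measurable_eLpNorm (by rw [ENNReal.one_le_ofReal]; linarith)
      ENNReal.ofReal_ne_top
  have h1 := h.strichartz t₀ t₁ hI
  rw [mixedNorm] at h1
  have h2 : (fun t => eLpNorm (v t) (ENNReal.ofReal (2 * p)) volume) =ᵐ[volume.restrict (Icc t₀ t₁)]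
      fun t => eLpNorm (v (clampTime t₀ t₁ t)) (ENNReal.ofReal (2 * p)) volume := by
    filter_upwards [ae_restrict_mem measurableSet_Icc] with t ht
    rw [clampTime_eq ht]
  rw [eLpNorm_congr_ae h2] at h1
  -- `p ≤ 2p / (p - 3)` because `p ≤ 5`; for `p = 3` the quotient is `⊤`
  have hq : ENNReal.ofReal p ≤ ENNReal.ofReal (2 * p) / ENNReal.ofReal (p - 3) := by
    rw [ENNReal.le_div_iff_mul_le (.inr (by simpa using hp0)) (.inl ENNReal.ofReal_ne_top),
      ← ENNReal.ofReal_mul hp0.le]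
    exact ENNReal.ofReal_le_ofReal (by nlinarith)
  have h3 : MemLp (fun t => eLpNorm (v (clampTime t₀ t₁ t)) (ENNReal.ofReal (2 * p)) volume)
      (ENNReal.ofReal p) (volume.restrict (Icc t₀ t₁)) :=
    MemLp.mono_exponent ⟨hm.aestronglyMeasurable, h1⟩ hq
  have h4 := lintegral_rpow_enorm_lt_top_of_eLpNorm_lt_top (by simpa using hp0)
    ENNReal.ofReal_ne_top h3.2
  rw [ENNReal.toReal_ofReal hp0.le] at h4
  exact h4

lemma eLpNorm_nonlinearity_le (hp3 : 3 ≤ p) (hφ : ∀ x, 0 ≤ φ x ∧ φ x ≤ 1) (t : ℝ) :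
    eLpNorm (nonlinearity φ κ p v t) 2 volume
      ≤ ENNReal.ofReal (Real.exp (-κ * t)) * eLpNorm (v t) (ENNReal.ofReal (2 * p)) volume ^ p := by
  have hp0 : 0 < p := by linarith
  have hF : nonlinearity φ κ p v t
      = fun x => φ x * (-Real.exp (-κ * t) * npow p (v t x)) := by
    ext x; rw [nonlinearity_eq]; ring
  have h2 : ENNReal.ofReal (2 * p / p) = 2 := by
    rw [mul_div_cancel_right₀ _ hp0.ne']; norm_num
  have h := eLpNorm_npow hp3 (by linarith : p ≤ 2 * p) (v t)
  rw [h2] at h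
  rw [hF, ← h]
  refine (eLpNorm_weight_mul_le hφ _ _ _).trans (le_of_eq ?_)
  rw [enorm_neg, Real.enorm_eq_ofReal (Real.exp_pos _).le]

lemma exp_clampTime_le (hκ : 0 ≤ κ) (h01 : t₀ ≤ t₁) (t : ℝ) :
    Real.exp (-κ * clampTime t₀ t₁ t) ≤ Real.exp (-κ * t₀) := by
  rw [Real.exp_le_exp]
  have := (clampTime_mem h01 t).1
  nlinarith

/-- On a compact interval `[t₀, t₁]`, and extended to all times by freezing its values outside, a
solution of the nonlinear equation solves the linear wave equation whose right-hand side is the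
nonlinearity. -/
theorem isLinearSolution (h : IsSolution φ κ p t₀ I v₀ v₁ v w) (hp3 : 3 ≤ p) (hp5 : p < 5)
    (hκ : 0 ≤ κ) (hφc : Continuous φ) (hφ : ∀ x, 0 ≤ φ x ∧ φ x ≤ 1) (h01 : t₀ < t₁)
    (hI : Icc t₀ t₁ ⊆ I) :
    IsLinearSolution t₀ t₁ (fun t => v (clampTime t₀ t₁ t)) (fun t => w (clampTime t₀ t₁ t))
      (fun t => nonlinearity φ κ p v (clampTime t₀ t₁ t)) := by
  have hc0 : clampTime t₀ t₁ t₀ = t₀ := clampTime_eq ⟨le_rfl, h01.le⟩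
  have hvel : ∀ ψ : 𝓢(E3, ℂ), ∀ t ∈ Icc t₀ t₁,
      HasDerivWithinAt (fun s => pairing (v (clampTime t₀ t₁ s)) ψ)
        (pairing (w (clampTime t₀ t₁ t)) ψ) (Icc t₀ t₁) t := by
    intro ψ t ht
    rw [clampTime_eq ht]
    exact ((h.velocity ψ t (hI ht)).mono hI).congr (fun s hs => by rw [clampTime_eq hs])
      (by rw [clampTime_eq ht])
  have hduh : ∀ t ∈ Icc t₀ t₁, ∀ ψ : 𝓢(E3, ℂ), pairing (v (clampTime t₀ t₁ t)) ψ
      = freeWave (t - t₀) v₀ v₁ ψ +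
        ∫ τ in t₀..t, sinEvolution (t - τ) (nonlinearity φ κ p v (clampTime t₀ t₁ τ)) ψ := by
    intro t ht ψ
    rw [clampTime_eq ht, h.duhamel t (hI ht) ψ]
    congr 1
    refine intervalIntegral.integral_congr fun τ hτ => ?_
    rw [uIcc_of_le ht.1] at hτ
    simp only [clampTime_eq (show τ ∈ Icc t₀ t₁ from ⟨hτ.1, hτ.2.trans ht.2⟩)]
  have cv := h.wCont_v h01.le hI
  have cw := h.wCont_w h01.le hI
  have cF := h.wCont_F (κ := κ) hp3 hp5 hφc hφ h01.le hI
  have key := fun k (hk : IsTest k) t ht x => moll_eq_of_duhamel h01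
    (v := fun t => v (clampTime t₀ t₁ t)) (w := fun t => w (clampTime t₀ t₁ t))
    (F := fun t => nonlinearity φ κ p v (clampTime t₀ t₁ t)) (v₀ := v₀) (v₁ := v₁)
    (by simp only [hc0]; exact h.initial) (by simp only [hc0]; exact h.initial_velocity)
    cv cw cF hvel hduh (k := k) hk (t := t) ht x
  refine ⟨fun t => h.mem_hDot1 _ (hI (clampTime_mem h01.le t)),
    fun t => h.mem_velocity _ (hI (clampTime_mem h01.le t)), cv, cw, cF, ?_, ?_,
    fun k hk t ht x => (key k hk t ht x).1, fun k hk t ht x => (key k hk t ht x).2⟩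
  · obtain ⟨M, hM⟩ := h.exists_bound hI
    exact ⟨M, fun t => hM _ (clampTime_mem h01.le t)⟩
  · have h1 : ∀ t, eLpNorm (nonlinearity φ κ p v (clampTime t₀ t₁ t)) 2 volume
        ≤ ENNReal.ofReal (Real.exp (-κ * t₀))
          * eLpNorm (v (clampTime t₀ t₁ t)) (ENNReal.ofReal (2 * p)) volume ^ p := fun t =>
      (eLpNorm_nonlinearity_le hp3 hφ _).trans
        (mul_le_mul' (ENNReal.ofReal_le_ofReal (exp_clampTime_le hκ h01.le t)) le_rfl)
    refine (lintegral_mono h1).trans_lt ?_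
    rw [lintegral_const_mul' _ _ ENNReal.ofReal_ne_top]
    exact ENNReal.mul_lt_top ENNReal.ofReal_lt_top (h.lintegral_rpow_lt_top hp3 hp5 h01.le hI)

end IsSolution

/-! ### The potential energy -/

/-- The change of the potential energy density at a point; the derivative of `exp (-κ t)` contributes
with a favourable sign. -/
lemma potential_sub_le {κ p t₀ t₁ : ℝ} (hp : 3 ≤ p) (hκ : 0 ≤ κ) (h01 : t₀ ≤ t₁) {u u' : ℝ → ℝ}
    (hu' : Continuous u') (hu : ∀ t ∈ Icc t₀ t₁, u t = u t₀ + ∫ s in t₀..t, u' s) :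
    Real.exp (-κ * t₁) * |u t₁| ^ (p + 1) - Real.exp (-κ * t₀) * |u t₀| ^ (p + 1)
      ≤ (p + 1) * ∫ t in Icc t₀ t₁, Real.exp (-κ * t) * npow p (u t) * u' t := by
  set A : ℝ → ℝ := fun t => u t₀ + ∫ s in t₀..t, u' s with hA
  have dA : ∀ t, HasDerivAt A (u' t) t := fun t =>
    (intervalIntegral.integral_hasDerivAt_right (hu'.intervalIntegrable _ _)
      (hu'.stronglyMeasurableAtFilter _ _) hu'.continuousAt).const_add _
  have cA : Continuous A := continuous_iff_continuousAt.2 fun t => (dA t).continuousAt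
  have cN : Continuous fun t => npow p (A t) := (continuous_npow hp).comp cA
  have cP : Continuous fun t => |A t| ^ (p + 1) :=
    cA.abs.rpow_const fun _ => .inr (by linarith)
  have dE : ∀ t, HasDerivAt (fun t => Real.exp (-κ * t)) (-κ * Real.exp (-κ * t)) t := fun t => by
    have := ((hasDerivAt_id t).const_mul (-κ)).exp
    simpa [mul_comm] using this
  have dP : ∀ t, HasDerivAt (fun t => |A t| ^ (p + 1)) ((p + 1) * npow p (A t) * u' t) t := fun t =>
    (hasDerivAt_abs_rpow_add_one hp (A t)).comp t (dA t)
  have h := intervalIntegral.integral_deriv_mul_eq_sub (a := t₀) (b := t₁) (fun t _ => dE t)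
    (fun t _ => dP t) (Continuous.intervalIntegrable (by fun_prop) _ _)
    (Continuous.intervalIntegrable (by fun_prop) _ _)
  have e0 : A t₀ = u t₀ := (hu t₀ ⟨le_rfl, h01⟩).symm
  have e1 : A t₁ = u t₁ := (hu t₁ ⟨h01, le_rfl⟩).symm
  rw [e0, e1] at h
  rw [← h, intervalIntegral.integral_of_le h01, ← integral_Icc_eq_integral_Ioc, ← integral_const_mul]
  refine setIntegral_mono_on (Continuous.integrableOn_Icc (by fun_prop)) ?_ measurableSet_Icc
    fun t ht => ?_
  · have : Continuous fun t => (p + 1) * (Real.exp (-κ * t) * npow p (A t) * u' t) := by fun_prop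
    refine (this.integrableOn_Icc).congr_fun (fun t ht => ?_) measurableSet_Icc
    simp only [hA, ← hu t ht]
  · rw [hu t ht]
    have h3 : 0 ≤ κ * Real.exp (-κ * t) * |A t| ^ (p + 1) := by positivity
    simp only [hA] at h3 ⊢
    nlinarith

/-- On a finite measure space, convergence in `L⁶` implies convergence of the integrals of `|u|^s` for
`s ≤ 6`. -/
lemma tendsto_integral_rpow {μ : Measure E3} [IsFiniteMeasure μ] {s : ℝ} (hs1 : 1 ≤ s) (hs6 : s ≤ 6)
    {u : ℕ → E3 → ℝ} {f : E3 → ℝ} (hu : ∀ n, MemLp (u n) 6 μ) (hf : MemLp f 6 μ)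
    (h : Tendsto (fun n => eLpNorm (u n - f) 6 μ) atTop (𝓝 0)) :
    Tendsto (fun n => ∫ x, |u n x| ^ s ∂μ) atTop (𝓝 (∫ x, |f x| ^ s ∂μ)) := by
  have hs0 : 0 < s := by linarith
  have hS : ENNReal.ofReal s ≤ 6 := by
    rw [show (6 : ℝ≥0∞) = ENNReal.ofReal 6 by norm_num]; exact ENNReal.ofReal_le_ofReal hs6
  have hS1 : 1 ≤ ENNReal.ofReal s := by rwa [ENNReal.one_le_ofReal]
  have hus := fun n => (hu n).mono_exponent hS
  have hfs := hf.mono_exponent hS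
  have key : ∀ {g : E3 → ℝ}, MemLp g (ENNReal.ofReal s) μ →
      ∫ x, |g x| ^ s ∂μ = (eLpNorm g (ENNReal.ofReal s) μ).toReal ^ s := by
    intro g hg
    have h1 := hg.eLpNorm_eq_integral_rpow_norm (by simpa using hs0) ENNReal.ofReal_ne_top
    rw [ENNReal.toReal_ofReal hs0.le] at h1
    have h2 : 0 ≤ ∫ x, ‖g x‖ ^ s ∂μ := integral_nonneg fun x => by positivity
    rw [h1, ENNReal.toReal_ofReal (by positivity), ← Real.rpow_mul h2, inv_mul_cancel₀ hs0.ne',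
      Real.rpow_one]
    rfl
  have l1 : Tendsto (fun n => eLpNorm (u n - f) (ENNReal.ofReal s) μ) atTop (𝓝 0) := by
    have := ENNReal.Tendsto.mul_const (b := μ univ ^ (1 / (ENNReal.ofReal s).toReal
      - 1 / (6 : ℝ≥0∞).toReal)) h (.inr ?_)
    · rw [zero_mul] at this
      exact tendsto_of_tendsto_of_tendsto_of_le_of_le tendsto_const_nhds this (fun _ => bot_le)
        fun n => eLpNorm_le_eLpNorm_mul_rpow_measure_univ hS ((hu n).1.sub hf.1)
    · refine ENNReal.rpow_ne_top_of_nonneg ?_ (measure_ne_top μ _)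
      rw [ENNReal.toReal_ofReal hs0.le, ENNReal.toReal_ofNat, sub_nonneg]
      exact one_div_le_one_div_of_le hs0 hs6
  have l2 : Tendsto (fun n => (eLpNorm (u n) (ENNReal.ofReal s) μ).toReal) atTop
      (𝓝 (eLpNorm f (ENNReal.ofReal s) μ).toReal) := by
    rw [tendsto_iff_dist_tendsto_zero]
    have l3 := (ENNReal.tendsto_toReal ENNReal.zero_ne_top).comp l1
    rw [ENNReal.toReal_zero] at l3
    refine squeeze_zero (fun n => dist_nonneg) (fun n => ?_) l3
    have hd := (hus n).sub hfs
    have a1 : eLpNorm (u n) (ENNReal.ofReal s) μ ≤ eLpNorm (u n - f) (ENNReal.ofReal s) μ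
        + eLpNorm f (ENNReal.ofReal s) μ := by
      have := eLpNorm_add_le hd.1 hfs.1 hS1
      rwa [sub_add_cancel] at this
    have a2 : eLpNorm f (ENNReal.ofReal s) μ ≤ eLpNorm (u n - f) (ENNReal.ofReal s) μ
        + eLpNorm (u n) (ENNReal.ofReal s) μ := by
      rw [eLpNorm_sub_comm]
      have := eLpNorm_add_le (hfs.sub (hus n)).1 (hus n).1 hS1
      rwa [sub_add_cancel] at this
    have b1 := ENNReal.toReal_mono (ENNReal.add_ne_top.2 ⟨hd.2.ne, hfs.2.ne⟩) a1
    have b2 := ENNReal.toReal_mono (ENNReal.add_ne_top.2 ⟨hd.2.ne, (hus n).2.ne⟩) a2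
    rw [ENNReal.toReal_add hd.2.ne hfs.2.ne] at b1
    rw [ENNReal.toReal_add hd.2.ne (hus n).2.ne] at b2
    rw [Real.dist_eq, abs_le, Function.comp]
    constructor <;> linarith
  simp only [key (hus _), key hfs]
  exact ((Real.continuous_rpow_const hs0.le).tendsto _).comp l2

/-- For an integrable weight `0 ≤ m ≤ 1`, the weighted `L^s` integrals with `s ≤ 6` are continuous on
`L⁶`. -/
lemma integral_weight_rpow {m : E3 → ℝ} (hmm : Measurable m) (hmi : Integrable m)
    (hm : ∀ x, 0 ≤ m x ∧ m x ≤ 1) {s : ℝ} (hs1 : 1 ≤ s) (hs6 : s ≤ 6) {f : E3 → ℝ}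
    (hf : MemLp f 6 volume) : Integrable (fun x => m x * |f x| ^ s) ∧
    ∀ u : ℕ → E3 → ℝ, (∀ n, MemLp (u n) 6 volume) →
      Tendsto (fun n => eLpNorm (u n - f) 6 volume) atTop (𝓝 0) →
      Tendsto (fun n => ∫ x, m x * |u n x| ^ s) atTop (𝓝 (∫ x, m x * |f x| ^ s)) := by
  have hd : Measurable fun x => ENNReal.ofReal (m x) := hmm.ennreal_ofReal
  set μ := (volume : Measure E3).withDensity fun x => ENNReal.ofReal (m x) with hμ
  have hfin : IsFiniteMeasure μ := isFiniteMeasure_withDensity_ofReal hmi.2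
  have hle : μ ≤ volume := by
    have h := withDensity_mono (μ := (volume : Measure E3)) (f := fun x => ENNReal.ofReal (m x))
      (g := 1) (.of_forall fun x => by simpa using (hm x).2)
    rwa [withDensity_one] at h
  have hint : ∀ g : E3 → ℝ, ∫ x, g x ∂μ = ∫ x, m x * g x := fun g => by
    rw [hμ, integral_withDensity_eq_integral_toReal_smul hd (.of_forall fun x => ENNReal.ofReal_lt_top)]
    refine integral_congr_ae (.of_forall fun x => ?_)
    simp only [ENNReal.toReal_ofReal (hm x).1, smul_eq_mul]
  have hL : ∀ {g : E3 → ℝ}, MemLp g 6 volume → MemLp g 6 μ := fun hg => hg.mono_measure hle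
  refine ⟨?_, fun u hu hl => ?_⟩
  · have hS : ENNReal.ofReal s ≤ 6 := by
      rw [show (6 : ℝ≥0∞) = ENNReal.ofReal 6 by norm_num]; exact ENNReal.ofReal_le_ofReal hs6
    have h1 := ((hL hf).mono_exponent hS).integrable_norm_rpow (by simpa using by linarith)
      ENNReal.ofReal_ne_top
    rw [ENNReal.toReal_ofReal (by linarith), hμ, integrable_withDensity_iff_integrable_smul' hd
      (.of_forall fun x => ENNReal.ofReal_lt_top)] at h1
    refine h1.congr (.of_forall fun x => ?_)
    simp only [ENNReal.toReal_ofReal (hm x).1, smul_eq_mul, Real.norm_eq_abs]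
  · have h2 := tendsto_integral_rpow hs1 hs6 (fun n => hL (hu n)) (hL hf)
      (tendsto_of_tendsto_of_tendsto_of_le_of_le tendsto_const_nhds hl (fun _ => bot_le)
        fun n => eLpNorm_mono_measure _ hle)
    simpa only [hint] using h2

namespace IsSolution

variable {φ : E3 → ℝ} {κ p t₀ : ℝ} {I : Set ℝ} {v₀ v₁ : E3 → ℝ} {v w : ℝ → E3 → ℝ} {t₁ : ℝ}

/-- The finite space-time norm puts `v t` in `L^(2p)` for almost every time. -/
lemma ae_memLp (h : IsSolution φ κ p t₀ I v₀ v₁ v w) (hp3 : 3 ≤ p) (hp5 : p < 5)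
    (h01 : t₀ ≤ t₁) (hI : Icc t₀ t₁ ⊆ I) : ∀ᵐ t ∂volume.restrict (Icc t₀ t₁),
      MemLp (v (clampTime t₀ t₁ t)) (ENNReal.ofReal (2 * p)) volume := by
  have hm : Measurable fun t => eLpNorm (v (clampTime t₀ t₁ t)) (ENNReal.ofReal (2 * p)) volume :=
    (h.wCont_v h01 hI).measurable_eLpNorm (by rw [ENNReal.one_le_ofReal]; linarith)
      ENNReal.ofReal_ne_top
  filter_upwards [ae_lt_top (hm.pow_const p) (h.lintegral_rpow_lt_top hp3 hp5 h01 hI).ne] with t ht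
  exact ⟨(h.mem_hDot1 _ (hI (clampTime_mem h01 t))).1.1,
    (ENNReal.rpow_lt_top_iff_of_pos (by linarith)).1 ht⟩

/-- The change of the potential energy, localised by an integrable weight. -/
lemma potential_energy_weight (h : IsSolution φ κ p t₀ I v₀ v₁ v w) (hp3 : 3 ≤ p) (hp5 : p < 5)
    (hκ : 0 ≤ κ) (hφc : Continuous φ) (hφ : ∀ x, 0 ≤ φ x ∧ φ x ≤ 1) (h01 : t₀ < t₁)
    (hI : Icc t₀ t₁ ⊆ I) {m : E3 → ℝ} (hmm : Measurable m) (hmi : Integrable m)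
    (hm : ∀ x, 0 ≤ m x ∧ m x ≤ 1) :
    IntegrableOn (fun t => ∫ x, m x * (Real.exp (-κ * clampTime t₀ t₁ t) *
      npow p (v (clampTime t₀ t₁ t) x)) * w (clampTime t₀ t₁ t) x) (Icc t₀ t₁) ∧
    Real.exp (-κ * t₁) * (∫ x, m x * |v t₁ x| ^ (p + 1))
      - Real.exp (-κ * t₀) * (∫ x, m x * |v t₀ x| ^ (p + 1))
      ≤ (p + 1) * ∫ t in Icc t₀ t₁, ∫ x, m x * (Real.exp (-κ * clampTime t₀ t₁ t) *
      npow p (v (clampTime t₀ t₁ t) x)) * w (clampTime t₀ t₁ t) x := by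
  have hL := h.isLinearSolution hp3 hp5 hκ hφc hφ h01 hI
  obtain ⟨M, hM⟩ := hL.bound
  set c := clampTime t₀ t₁ with hc
  have hp0 : 0 < p := by linarith
  have h2 : ENNReal.ofReal (2 * p / p) = 2 := by
    rw [mul_div_cancel_right₀ _ hp0.ne']; norm_num
  have hp2 : p ≤ 2 * p := by linarith
  have h2p : 1 ≤ ENNReal.ofReal (2 * p) := by rw [ENNReal.one_le_ofReal]; linarith
  set g : ℝ → ℝ≥0∞ := fun t => ENNReal.ofReal (Real.exp (-κ * t₀))
    * eLpNorm (v (c t)) (ENNReal.ofReal (2 * p)) volume ^ p with hg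
  have mg : Measurable g := (((h.wCont_v h01.le hI).measurable_eLpNorm h2p
    ENNReal.ofReal_ne_top).pow_const p).const_mul _
  have ig : ∫⁻ t in Icc t₀ t₁, g t < ⊤ := by
    rw [lintegral_const_mul' _ _ ENNReal.ofReal_ne_top]
    exact ENNReal.mul_lt_top ENNReal.ofReal_lt_top (h.lintegral_rpow_lt_top hp3 hp5 h01.le hI)
  set an : ℕ → ℝ → E3 → ℝ := fun n t x => m x * (Real.exp (-κ * c t) *
    npow p (moll (rho n) (v (c t)) x)) with han
  set bn : ℕ → ℝ → E3 → ℝ := fun n t => moll (rho n) (w (c t)) with hbn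
  have cc : Continuous c := continuous_clampTime t₀ t₁
  have mu := fun n => hL.cont_v.measurable_moll (isTest_rho n)
  have man : ∀ n, Measurable fun q : ℝ × E3 => an n q.1 q.2 := fun n => by
    have e1 : Measurable fun q : ℝ × E3 => m q.2 := hmm.comp measurable_snd
    have e2 : Measurable fun q : ℝ × E3 => Real.exp (-κ * c q.1) :=
      Continuous.measurable (by fun_prop)
    exact e1.mul (e2.mul ((continuous_npow hp3).measurable.comp (mu n)))
  have mbn : ∀ n, Measurable fun q : ℝ × E3 => bn n q.1 q.2 := fun n =>
    hL.cont_w.measurable_moll (isTest_rho n)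
  have ban : ∀ n t, eLpNorm (an n t) 2 volume ≤ g t := by
    intro n t
    refine (eLpNorm_weight_mul_le hm _ _ _).trans ?_
    have e1 := eLpNorm_npow hp3 hp2 (moll (rho n) (v (c t)))
    rw [h2] at e1
    rw [e1, Real.enorm_eq_ofReal (Real.exp_pos _).le]
    exact mul_le_mul' (ENNReal.ofReal_le_ofReal (exp_clampTime_le hκ h01.le t))
      (ENNReal.rpow_le_rpow (eLpNorm_moll_rho_le n h2p ENNReal.ofReal_ne_top
        (hL.mem_v t).1.1) hp0.le)
  have bbn : ∀ n t, eLpNorm (bn n t) 2 volume ≤ M := fun n t =>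
    (eLpNorm_moll_rho_le n (by norm_num) (by norm_num) (hL.mem_w t).1).trans (hM t).2
  obtain ⟨i, l⟩ := tendsto_integral_integral_mul mg ig man mbn ban bbn
    (a := fun t x => m x * (Real.exp (-κ * c t) * npow p (v (c t) x)))
    (b := fun t => w (c t)) (by
      filter_upwards [h.ae_memLp hp3 hp5 h01.le hI] with t ht
      have e1 := tendsto_eLpNorm_npow_sub hp3 hp2 (f := fun n => moll (rho n) (v (c t)))
        (fun n => (contDiff_moll (isTest_rho n) (hL.li_v t)).continuous.aestronglyMeasurable) ht
        (tendsto_eLpNorm_moll_rho_sub h2p ENNReal.ofReal_ne_top ht)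
      rw [h2] at e1
      refine ⟨⟨?_, ?_⟩, ?_⟩
      · exact hmm.aestronglyMeasurable.mul
          (((continuous_npow hp3).comp_aestronglyMeasurable ht.1).const_mul _)
      · refine (eLpNorm_weight_mul_le hm _ _ _).trans_lt (ENNReal.mul_lt_top enorm_lt_top ?_)
        have e2 := eLpNorm_npow hp3 hp2 (v (c t))
        rw [h2] at e2
        rw [e2]
        exact ENNReal.rpow_lt_top_of_nonneg hp0.le ht.2.ne
      · have e3 := ENNReal.Tendsto.const_mul (a := ‖Real.exp (-κ * c t)‖ₑ) e1 (.inr enorm_ne_top)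
        rw [mul_zero] at e3
        refine tendsto_of_tendsto_of_tendsto_of_le_of_le tendsto_const_nhds e3 (fun _ => bot_le)
          fun n => ?_
        refine le_trans (le_of_eq ?_) (eLpNorm_weight_mul_le hm _ _ _)
        congr 1; ext x
        simp only [han, Pi.sub_apply]
        ring)
    (.of_forall fun t => ⟨hL.mem_w t, hL.tendsto_moll_w t⟩)
  refine ⟨i, ?_⟩
  have hs1 : 1 ≤ p + 1 := by linarith
  have hs6 : p + 1 ≤ 6 := by linarith
  have hc0 : c t₀ = t₀ := clampTime_eq ⟨le_rfl, h01.le⟩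
  have hc1 : c t₁ = t₁ := clampTime_eq ⟨h01.le, le_rfl⟩
  have lim : ∀ t, Tendsto (fun n => ∫ x, m x * |moll (rho n) (v (c t)) x| ^ (p + 1)) atTop
      (𝓝 (∫ x, m x * |v (c t) x| ^ (p + 1))) := fun t =>
    (integral_weight_rpow hmm hmi hm hs1 hs6 (hL.mem_v t).1).2 _
      (fun n => hL.memLp_six_moll (isTest_rho n) t)
      (tendsto_eLpNorm_moll_rho_sub (by norm_num) (by norm_num) (hL.mem_v t).1)
  have lim0 := lim t₀
  have lim1 := lim t₁
  rw [hc0] at lim0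
  rw [hc1] at lim1
  -- it suffices to compare the smoothed quantities, where the inequality holds pointwise in `x`
  refine le_of_tendsto_of_tendsto' ((lim1.const_mul _).sub (lim0.const_mul _)) (l.const_mul (p + 1))
    fun n => ?_
  have ii := fun t => (integral_weight_rpow hmm hmi hm hs1 hs6 (hL.memLp_six_moll (isTest_rho n) t)).1
  have ii0 := ii t₀
  have ii1 := ii t₁
  rw [hc0] at ii0
  rw [hc1] at ii1
  have hprod := integrable_prod_mul (t₀ := t₀) (t₁ := t₁) (man n) (mbn n)
    ((lintegral_mono (ban n)).trans_lt ig) (bbn n)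
  rw [← integral_const_mul, ← integral_const_mul, ← integral_sub (ii1.const_mul _) (ii0.const_mul _),
    integral_integral_swap (f := fun t x => an n t x * bn n t x) hprod, ← integral_const_mul]
  refine integral_mono ((ii1.const_mul _).sub (ii0.const_mul _)) (hprod.integral_prod_right.const_mul _)
    fun x => ?_
  have e := potential_sub_le hp3 hκ h01.le (u := fun t => moll (rho n) (v (c t)) x)
    (u' := fun t => moll (rho n) (w (c t)) x) (hL.cont_w.continuous_moll (isTest_rho n) x)
    (fun t ht => hL.eq_v _ (isTest_rho n) t ht x)
  have e' : ∫ t in Icc t₀ t₁, an n t x * bn n t x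
      = m x * ∫ t in Icc t₀ t₁, Real.exp (-κ * t) * npow p (moll (rho n) (v (c t)) x)
        * moll (rho n) (w (c t)) x := by
    rw [← integral_const_mul]
    refine setIntegral_congr_fun measurableSet_Icc fun t ht => ?_
    simp only [han, hbn, hc, clampTime_eq ht]
    ring
  simp only [hc0, hc1] at e
  have e2 := mul_le_mul_of_nonneg_left e (hm x).1
  simp only [e']
  linarith

end IsSolution

/-- Fatou's lemma, in terms of real integrals. -/
lemma lintegral_ofReal_le_of_tendsto {α : Type*} [MeasurableSpace α] {μ : Measure α}
    {f : ℕ → α → ℝ} {g : α → ℝ} {a : ℕ → ℝ} {A : ℝ} (hf : ∀ n, Integrable (f n) μ)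
    (h0 : ∀ n, 0 ≤ᵐ[μ] f n) (hlim : ∀ᵐ x ∂μ, Tendsto (fun n => f n x) atTop (𝓝 (g x)))
    (hb : ∀ n, ∫ x, f n x ∂μ ≤ a n) (ha : Tendsto a atTop (𝓝 A)) :
    0 ≤ A ∧ ∫⁻ x, ENNReal.ofReal (g x) ∂μ ≤ ENNReal.ofReal A := by
  refine ⟨ge_of_tendsto' ha fun n => (integral_nonneg_of_ae (h0 n)).trans (hb n), ?_⟩
  calc ∫⁻ x, ENNReal.ofReal (g x) ∂μ
      = ∫⁻ x, liminf (fun n => ENNReal.ofReal (f n x)) atTop ∂μ := by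
        refine lintegral_congr_ae ?_
        filter_upwards [hlim] with x hx
        exact ((ENNReal.continuous_ofReal.tendsto _).comp hx).liminf_eq.symm
    _ ≤ liminf (fun n => ∫⁻ x, ENNReal.ofReal (f n x) ∂μ) atTop :=
        lintegral_liminf_le' fun n => (hf n).1.aemeasurable.ennreal_ofReal
    _ ≤ liminf (fun n => ENNReal.ofReal (a n)) atTop := by
        refine liminf_le_liminf (.of_forall fun n => ?_)
        rw [← ofReal_integral_eq_lintegral_ofReal (hf n) (h0 n)]
        exact ENNReal.ofReal_le_ofReal (hb n)
    _ = ENNReal.ofReal A := ((ENNReal.continuous_ofReal.tendsto _).comp ha).liminf_eq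

lemma integral_le_of_tendsto {α : Type*} [MeasurableSpace α] {μ : Measure α}
    {f : ℕ → α → ℝ} {g : α → ℝ} {a : ℕ → ℝ} {A : ℝ} (hf : ∀ n, Integrable (f n) μ)
    (h0 : ∀ n, 0 ≤ᵐ[μ] f n) (hlim : ∀ᵐ x ∂μ, Tendsto (fun n => f n x) atTop (𝓝 (g x)))
    (hb : ∀ n, ∫ x, f n x ∂μ ≤ a n) (ha : Tendsto a atTop (𝓝 A)) :
    Integrable g μ ∧ ∫ x, g x ∂μ ≤ A := by
  have hg0 : 0 ≤ᵐ[μ] g := by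
    filter_upwards [hlim, ae_all_iff.2 h0] with x hx hx0
    exact ge_of_tendsto' hx hx0
  have hgm : AEStronglyMeasurable g μ := aestronglyMeasurable_of_tendsto_ae atTop
    (fun n => (hf n).1) hlim
  obtain ⟨hA, h⟩ := lintegral_ofReal_le_of_tendsto hf h0 hlim hb ha
  refine ⟨⟨hgm, ?_⟩, ?_⟩
  · rw [hasFiniteIntegral_iff_ofReal hg0]
    exact h.trans_lt ENNReal.ofReal_lt_top
  · rw [integral_eq_lintegral_of_nonneg_ae hg0 hgm]
    exact ENNReal.toReal_le_of_le_ofReal hA h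

namespace IsSolution

variable {φ : E3 → ℝ} {κ p t₀ : ℝ} {I : Set ℝ} {v₀ v₁ : E3 → ℝ} {v w : ℝ → E3 → ℝ} {t₁ : ℝ}

/-- The initial potential energy is finite, by the assumption on the data. -/
lemma integrable_potential (h : IsSolution φ κ p t₀ I v₀ v₁ v w) (hφc : Continuous φ)
    (hφ : ∀ x, 0 ≤ φ x) : Integrable fun x => φ x * |v t₀ x| ^ (p + 1) := by
  have hm : AEMeasurable (v t₀) volume := (h.mem_hDot1 _ h.mem_interval).1.1.aemeasurable
  refine ⟨(hφc.measurable.aemeasurable.mul (hm.abs.pow_const _)).aestronglyMeasurable, ?_⟩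
  rw [hasFiniteIntegral_iff_ofReal (.of_forall fun x =>
    mul_nonneg (hφ x) (Real.rpow_nonneg (abs_nonneg _) _))]
  refine lt_of_eq_of_lt (lintegral_congr_ae ?_) h.data_weighted
  filter_upwards [h.initial] with x hx
  rw [hx]

/-- The change of the potential energy. -/
lemma potential_energy (h : IsSolution φ κ p t₀ I v₀ v₁ v w) (hp3 : 3 ≤ p) (hp5 : p < 5)
    (hκ : 0 ≤ κ) (hφc : Continuous φ) (hφ : ∀ x, 0 ≤ φ x ∧ φ x ≤ 1) (h01 : t₀ < t₁)
    (hI : Icc t₀ t₁ ⊆ I) : Integrable (fun x => φ x * |v t₁ x| ^ (p + 1)) ∧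
    Real.exp (-κ * t₁) * (∫ x, φ x * |v t₁ x| ^ (p + 1))
      - Real.exp (-κ * t₀) * (∫ x, φ x * |v t₀ x| ^ (p + 1))
      ≤ -((p + 1) * ∫ t in Icc t₀ t₁, ∫ x, nonlinearity φ κ p v (clampTime t₀ t₁ t) x
        * w (clampTime t₀ t₁ t) x) := by
  have hL := h.isLinearSolution hp3 hp5 hκ hφc hφ h01 hI
  obtain ⟨M, hM⟩ := hL.bound
  have hs1 : 1 ≤ p + 1 := by linarith
  have hs6 : p + 1 ≤ 6 := by linarith
  set c := clampTime t₀ t₁ with hc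
  set m : ℕ → E3 → ℝ := fun n x => chi n x * φ x with hm
  have cm : ∀ n, Continuous (m n) := fun n => (isTest_chi n).continuous.mul hφc
  have mi : ∀ n, Integrable (m n) := fun n =>
    (cm n).integrable_of_hasCompactSupport (isTest_chi n).2.mul_right
  have m1 : ∀ n x, 0 ≤ m n x ∧ m n x ≤ 1 := fun n x =>
    ⟨mul_nonneg (chi_nonneg n x) (hφ x).1, mul_le_one₀ (chi_le_one n x) (hφ x).1 (hφ x).2⟩
  have key := fun n => h.potential_energy_weight hp3 hp5 hκ hφc hφ h01 hI (cm n).measurable (mi n)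
    (m1 n)
  have eF : ∀ n t x, m n x * (Real.exp (-κ * c t) * npow p (v (c t) x)) * w (c t) x
      = -(chi n x * (nonlinearity φ κ p v (c t) x * w (c t) x)) := fun n t x => by
    rw [nonlinearity_eq]; simp only [hm]; ring
  simp only [← hc, eF, integral_neg] at key
  -- the limit on the right-hand side
  have lim : Tendsto (fun n => ∫ t in Icc t₀ t₁, ∫ x, chi n x * (nonlinearity φ κ p v (c t) x
      * w (c t) x)) atTop (𝓝 (∫ t in Icc t₀ t₁, ∫ x, nonlinearity φ κ p v (c t) x * w (c t) x)) := by
    refine tendsto_integral_of_dominated_convergence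
      (fun t => (eLpNorm (nonlinearity φ κ p v (c t)) 2 volume).toReal * M) (fun n => ?_) ?_
      (fun n => ?_) ?_
    · exact (key n).1.1.neg.congr (.of_forall fun t => by simp)
    · exact (integrable_toReal_of_lintegral_ne_top
        (hL.cont_F.measurable_eLpNorm (by norm_num) (by norm_num)).aemeasurable hL.int_F.ne).mul_const _
    · filter_upwards [hL.ae_memLp_F] with t ht
      have e1 : ∀ x, chi n x * (nonlinearity φ κ p v (c t) x * w (c t) x)
        = (chi n x * (1 * nonlinearity φ κ p v (c t) x)) * w (c t) x := fun x => by ring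
      have e2 := eLpNorm_weight_mul_le (fun x => ⟨chi_nonneg n x, chi_le_one n x⟩) 1
        (nonlinearity φ κ p v (c t)) 2
      rw [enorm_one, one_mul] at e2
      have e3 : MemLp (fun x => chi n x * (1 * nonlinearity φ κ p v (c t) x)) 2 volume :=
        ⟨(isTest_chi n).continuous.aestronglyMeasurable.mul (ht.1.const_mul _), e2.trans_lt ht.2⟩
      simp only [e1]
      rw [Real.norm_eq_abs]
      refine (abs_integral_mul_le e3 (hL.mem_w t)).trans ?_
      rw [ENNReal.toReal_mul]
      exact mul_le_mul (ENNReal.toReal_mono ht.2.ne e2)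
        (ENNReal.toReal_mono ENNReal.coe_ne_top (hM t).2) ENNReal.toReal_nonneg
        ENNReal.toReal_nonneg
    · filter_upwards [hL.ae_memLp_F] with t ht
      have i := (ht.integrable_mul (hL.mem_w t))
      refine tendsto_integral_of_dominated_convergence
        (fun x => ‖nonlinearity φ κ p v (c t) x * w (c t) x‖)
        (fun n => (isTest_chi n).continuous.aestronglyMeasurable.mul i.1) i.norm
        (fun n => .of_forall fun x => ?_) (.of_forall fun x => ?_)
      · rw [norm_mul, Real.norm_eq_abs, abs_of_nonneg (chi_nonneg n x)]
        exact mul_le_of_le_one_left (norm_nonneg _) (chi_le_one n x)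
      · simpa using (tendsto_chi x).mul_const (nonlinearity φ κ p v (c t) x * w (c t) x)
  set R := ∫ t in Icc t₀ t₁, ∫ x, nonlinearity φ κ p v (c t) x * w (c t) x with hR
  set P₀ := ∫ x, φ x * |v t₀ x| ^ (p + 1) with hP₀
  have h6 : MemLp (v t₁) 6 volume := (h.mem_hDot1 _ (hI ⟨h01.le, le_rfl⟩)).1
  have h60 : MemLp (v t₀) 6 volume := (h.mem_hDot1 _ h.mem_interval).1
  have hnn : ∀ n s x, 0 ≤ m n x * |v s x| ^ (p + 1) := fun n s x =>
    mul_nonneg (m1 n x).1 (Real.rpow_nonneg (abs_nonneg _) _)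
  obtain ⟨i, l⟩ := integral_le_of_tendsto (f := fun n x => Real.exp (-κ * t₁)
    * (m n x * |v t₁ x| ^ (p + 1))) (g := fun x => Real.exp (-κ * t₁)
    * (φ x * |v t₁ x| ^ (p + 1)))
    (a := fun n => Real.exp (-κ * t₀) * P₀ + (p + 1) * -∫ t in Icc t₀ t₁, ∫ x,
      chi n x * (nonlinearity φ κ p v (c t) x * w (c t) x))
    (fun n => (integral_weight_rpow (cm n).measurable (mi n) (m1 n) hs1 hs6 h6).1.const_mul _)
    (fun n => .of_forall fun x => mul_nonneg (Real.exp_pos _).le (hnn n _ x))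
    (.of_forall fun x => by
      have := (((tendsto_chi x).mul_const (φ x)).mul_const (|v t₁ x| ^ (p + 1))).const_mul
        (Real.exp (-κ * t₁))
      simpa [hm] using this)
    (fun n => by
      have e1 : ∫ x, m n x * |v t₀ x| ^ (p + 1) ≤ P₀ := by
        refine integral_mono (integral_weight_rpow (cm n).measurable (mi n) (m1 n) hs1 hs6 h60).1
          (h.integrable_potential hφc fun x => (hφ x).1) fun x => ?_
        exact mul_le_mul_of_nonneg_right (mul_le_of_le_one_left (hφ x).1 (chi_le_one n x))
          (Real.rpow_nonneg (abs_nonneg _) _)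
      have e2 := mul_le_mul_of_nonneg_left e1 (Real.exp_pos (-κ * t₀)).le
      have e3 := (key n).2
      rw [integral_const_mul]
      linarith)
    ((lim.neg.const_mul (p + 1)).const_add _)
  refine ⟨?_, ?_⟩
  · refine (i.const_mul (Real.exp (-κ * t₁))⁻¹).congr (.of_forall fun x => ?_)
    simp only [← mul_assoc, inv_mul_cancel₀ (Real.exp_pos (-κ * t₁)).ne', one_mul]
  · rw [integral_const_mul] at l
    linarith

end IsSolution

/-! ### The energy -/

/-- The kinetic energy `½ (‖u'‖₂² + ‖∇u‖₂²)` of a state. -/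
def kinetic (u u' : E3 → ℝ) : ℝ :=
  1 / 2 * ((∫ x, u' x * u' x) + ∑ j, ∫ x, weakGrad u x j * weakGrad u x j)

lemma kinetic_eq {u u' : E3 → ℝ} (hu : MemHDot1 u) : kinetic u u'
    = 1 / 2 * ((∫ x, u' x * u' x) + ∫ x, ‖weakGrad u x‖ ^ 2) := by
  have h : ∀ j, MemLp (fun x => weakGrad u x j) 2 volume := fun j => memLp_apply hu.weakGrad.1 j
  have h2 : ∀ j, Integrable fun x => weakGrad u x j * weakGrad u x j := fun j =>
    (h j).integrable_mul (h j)
  rw [kinetic, ← integral_finsetSum _ fun j _ => h2 j]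
  congr 2
  refine integral_congr_ae (.of_forall fun x => ?_)
  simp only [EuclideanSpace.norm_sq_eq, Real.norm_eq_abs, sq_abs]
  exact Finset.sum_congr rfl fun j _ => (sq _).symm

lemma energy_eq {φ : E3 → ℝ} {κ p t : ℝ} {u u' : E3 → ℝ} (hp : 3 ≤ p) (hφ : ∀ x, 0 ≤ φ x)
    (hu : MemHDot1 u) (hu' : MemLp u' 2 volume) (hi : Integrable fun x => φ x * |u x| ^ (p + 1)) :
    energy φ κ p t u u' = ENNReal.ofReal (kinetic u u'
      + Real.exp (-κ * t) * (∫ x, φ x * |u x| ^ (p + 1)) / (p + 1)) := by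
  have i1 : Integrable fun x => ‖weakGrad u x‖ ^ 2 := hu.weakGrad.1.integrable_norm_pow two_ne_zero
  have i2 : Integrable fun x => u' x * u' x := hu'.integrable_mul hu'
  have e : ∀ x, 1 / 2 * ‖weakGrad u x‖ ^ 2 + 1 / 2 * |u' x| ^ 2 +
      Real.exp (-κ * t) * φ x * (|u x| ^ (p + 1) / (p + 1))
      = 1 / 2 * ‖weakGrad u x‖ ^ 2 + 1 / 2 * (u' x * u' x)
        + Real.exp (-κ * t) / (p + 1) * (φ x * |u x| ^ (p + 1)) := fun x => by
    rw [sq_abs]; ring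
  have h0 : ∀ x, 0 ≤ 1 / 2 * ‖weakGrad u x‖ ^ 2 + 1 / 2 * (u' x * u' x)
      + Real.exp (-κ * t) / (p + 1) * (φ x * |u x| ^ (p + 1)) := fun x => by
    have := hφ x
    have := mul_self_nonneg (u' x)
    positivity
  simp only [energy, e]
  have i3 : Integrable fun x => 1 / 2 * ‖weakGrad u x‖ ^ 2 + 1 / 2 * (u' x * u' x)
      + Real.exp (-κ * t) / (p + 1) * (φ x * |u x| ^ (p + 1)) :=
    ((i1.const_mul _).add (i2.const_mul _)).add (hi.const_mul _)
  rw [← ofReal_integral_eq_lintegral_ofReal i3 (.of_forall h0),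
    integral_add (f := fun x => 1 / 2 * ‖weakGrad u x‖ ^ 2 + 1 / 2 * (u' x * u' x))
      ((i1.const_mul _).add (i2.const_mul _)) (hi.const_mul _),
    integral_add (i1.const_mul _) (i2.const_mul _), integral_const_mul, integral_const_mul,
    integral_const_mul, kinetic_eq hu]
  congr 1
  ring

/-- By Hardy's inequality, the boundary terms in the Morawetz identity are controlled by the kinetic
energy. -/
lemma abs_integral_mul_mop_le {u u' : E3 → ℝ} (hu : MemHDot1 u) (hu' : MemLp u' 2 volume) :
    |∫ x, u' x * mop 0 u (weakGrad u) x| ≤ 4 * kinetic u u' := by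
  have hG := hu.weakGrad.1
  refine (abs_integral_mul_le hu' (memLp_mop hu.1 hG hu.weakGrad.2 le_rfl)).trans ?_
  have h1 : (eLpNorm u' 2 volume * eLpNorm (mop 0 u (weakGrad u)) 2 volume).toReal
      ≤ (eLpNorm u' 2 volume).toReal * (4 * (eLpNorm (weakGrad u) 2 volume).toReal) := by
    rw [ENNReal.toReal_mul]
    refine mul_le_mul_of_nonneg_left ?_ ENNReal.toReal_nonneg
    have := ENNReal.toReal_mono (ENNReal.mul_ne_top (by simp) hG.2.ne)
      (eLpNorm_mop_le hu.1 hG hu.weakGrad.2 le_rfl)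
    simpa [ENNReal.toReal_mul] using this
  have sq : ∀ {E : Type} [NormedAddCommGroup E] {f : E3 → E}, MemLp f 2 volume →
      (eLpNorm f 2 volume).toReal ^ 2 = ∫ x, ‖f x‖ ^ 2 := fun {E _ f} hf => by
    rw [← ENNReal.toReal_pow, eLpNorm_two_sq_eq_ofReal hf, ENNReal.toReal_ofReal
      (integral_nonneg fun x => by positivity)]
  have s1 := sq hu'
  have s2 := sq hG
  simp only [Real.norm_eq_abs, sq_abs] at s1
  simp only [pow_two (u' _)] at s1
  rw [kinetic_eq hu, ← s1, ← s2]
  nlinarith [sq_nonneg ((eLpNorm u' 2 volume).toReal - (eLpNorm (weakGrad u) 2 volume).toReal)]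

namespace IsSolution

variable {φ : E3 → ℝ} {κ p t₀ : ℝ} {I : Set ℝ} {v₀ v₁ : E3 → ℝ} {v w : ℝ → E3 → ℝ} {t₁ : ℝ}

/-- The energy does not increase, hence it controls the kinetic energy at later times. -/
lemma kinetic_le (h : IsSolution φ κ p t₀ I v₀ v₁ v w) (hp3 : 3 ≤ p) (hp5 : p < 5)
    (hκ : 0 ≤ κ) (hφc : Continuous φ) (hφ : ∀ x, 0 ≤ φ x ∧ φ x ≤ 1) (h01 : t₀ < t₁)
    (hI : Icc t₀ t₁ ⊆ I) : kinetic (v t₁) (w t₁) ≤ kinetic (v t₀) (w t₀)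
      + Real.exp (-κ * t₀) * (∫ x, φ x * |v t₀ x| ^ (p + 1)) / (p + 1) := by
  have e1 := ((h.isLinearSolution hp3 hp5 hκ hφc hφ h01 hI).energy_identity h01.le).2
  have e2 := (h.potential_energy hp3 hp5 hκ hφc hφ h01 hI).2
  simp only [clampTime_eq (show t₀ ∈ Icc t₀ t₁ from ⟨le_rfl, h01.le⟩),
    clampTime_eq (show t₁ ∈ Icc t₀ t₁ from ⟨h01.le, le_rfl⟩)] at e1
  have e3 : 0 ≤ Real.exp (-κ * t₁) * (∫ x, φ x * |v t₁ x| ^ (p + 1)) :=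
    mul_nonneg (Real.exp_pos _).le (integral_nonneg fun x =>
      mul_nonneg (hφ x).1 (Real.rpow_nonneg (abs_nonneg _) _))
  set R := ∫ t in Icc t₀ t₁, ∫ x, nonlinearity φ κ p v (clampTime t₀ t₁ t) x
        * w (clampTime t₀ t₁ t) x
  have hp : 0 < p + 1 := by linarith
  have e4 : R ≤ Real.exp (-κ * t₀) * (∫ x, φ x * |v t₀ x| ^ (p + 1)) / (p + 1) := by
    rw [le_div_iff₀ hp]
    linarith
  unfold kinetic
  linarith

/-- The interaction of the nonlinearity with the Morawetz multiplier is controlled by the energy. -/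
lemma neg_integral_mop_le (h : IsSolution φ κ p t₀ I v₀ v₁ v w) (hp3 : 3 ≤ p) (hp5 : p < 5)
    (hκ : 0 ≤ κ) (hφc : Continuous φ) (hφ : ∀ x, 0 ≤ φ x ∧ φ x ≤ 1) (h01 : t₀ < t₁)
    (hI : Icc t₀ t₁ ⊆ I) :
    ENNReal.ofReal (-∫ t in Icc t₀ t₁, ∫ x, nonlinearity φ κ p v (clampTime t₀ t₁ t) x
        * mop 0 (v (clampTime t₀ t₁ t)) (weakGrad (v (clampTime t₀ t₁ t))) x)
      ≤ 8 * energy φ κ p t₀ (v t₀) (w t₀) := by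
  have m0 : t₀ ∈ I := h.mem_interval
  have m1 : t₁ ∈ I := hI ⟨h01.le, le_rfl⟩
  have e1 := ((h.isLinearSolution hp3 hp5 hκ hφc hφ h01 hI).morawetz h01.le).2
  simp only [clampTime_eq (show t₀ ∈ Icc t₀ t₁ from ⟨le_rfl, h01.le⟩),
    clampTime_eq (show t₁ ∈ Icc t₀ t₁ from ⟨h01.le, le_rfl⟩)] at e1
  have e2 := h.kinetic_le hp3 hp5 hκ hφc hφ h01 hI
  have b0 := abs_le.1 (abs_integral_mul_mop_le (h.mem_hDot1 _ m0) (h.mem_velocity _ m0))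
  have b1 := abs_le.1 (abs_integral_mul_mop_le (h.mem_hDot1 _ m1) (h.mem_velocity _ m1))
  have e3 : 0 ≤ Real.exp (-κ * t₀) * (∫ x, φ x * |v t₀ x| ^ (p + 1)) / (p + 1) :=
    div_nonneg (mul_nonneg (Real.exp_pos _).le (integral_nonneg fun x =>
      mul_nonneg (hφ x).1 (Real.rpow_nonneg (abs_nonneg _) _))) (by linarith)
  rw [energy_eq hp3 (fun x => (hφ x).1) (h.mem_hDot1 _ m0) (h.mem_velocity _ m0)
    (h.integrable_potential hφc fun x => (hφ x).1),
    show (8 : ℝ≥0∞) = ENNReal.ofReal 8 by norm_num, ← ENNReal.ofReal_mul (by norm_num)]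
  refine ENNReal.ofReal_le_ofReal ?_
  linarith

end IsSolution

/-! ### The weight and scaling -/

lemma inner_gradient_eq_fderiv (f : E3 → ℝ) (x y : E3) :
    inner ℝ y (gradient f x) = fderiv ℝ f x y := by
  rw [real_inner_comm, gradient, InnerProductSpace.toDual_symm_apply]

lemma hasDerivAt_comp_smul {f : E3 → ℝ} {c : ℝ → ℝ} {c' μ : ℝ} {x : E3}
    (hf : DifferentiableAt ℝ f (c μ • x)) (hc : HasDerivAt c c' μ) :
    HasDerivAt (fun μ => f (c μ • x)) (c' * fderiv ℝ f (c μ • x) x) μ := by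
  have h := hf.hasFDerivAt.comp_hasDerivAt μ (hc.smul_const x)
  rwa [map_smul, smul_eq_mul] at h

lemma hasDerivAt_weight_scaling {φ : E3 → ℝ} (hφ : Differentiable ℝ φ) (p : ℝ) (x : E3) {μ : ℝ}
    (hμ : 0 < μ) : HasDerivAt (fun μ => μ ^ (p - 1) * φ (μ⁻¹ • x)) (μ ^ (p - 2) *
      ((p - 1) * φ (μ⁻¹ • x) - inner ℝ (μ⁻¹ • x) (gradient φ (μ⁻¹ • x)))) μ := by
  have h := (Real.hasDerivAt_rpow_const (p := p - 1) (.inl hμ.ne')).mul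
    (hasDerivAt_comp_smul (x := x) (hφ _) (hasDerivAt_inv hμ.ne'))
  refine h.congr_deriv ?_
  rw [inner_gradient_eq_fderiv, map_smul, smul_eq_mul, show p - 1 - 1 = p - 2 by ring,
    show p - 1 = p - 2 + 1 by ring, Real.rpow_add_one hμ.ne']
  field_simp
  ring

/-- The hypothesis on the weight says that `μ ↦ μ ^ (p - 1) φ (x / μ)` is nondecreasing. -/
lemma weight_scaling_le {φ : E3 → ℝ} (hφ : Differentiable ℝ φ) {p : ℝ}
    (hθ : ∀ x, 0 ≤ (p - 1) * φ x - inner ℝ x (gradient φ x)) (x : E3) {μ : ℝ} (h0 : 0 < μ)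
    (h1 : μ ≤ 1) : μ ^ (p - 1) * φ (μ⁻¹ • x) ≤ φ x := by
  have hd := fun μ (hμ : (0 : ℝ) < μ) => hasDerivAt_weight_scaling hφ p x hμ
  have h : MonotoneOn (fun μ : ℝ => μ ^ (p - 1) * φ (μ⁻¹ • x)) (Ioi 0) := by
    refine monotoneOn_of_deriv_nonneg (convex_Ioi 0)
      (fun μ hμ => (hd μ hμ).continuousAt.continuousWithinAt) (fun μ hμ => ?_) fun μ hμ => ?_
    · rw [interior_Ioi] at hμ
      exact (hd μ hμ).differentiableAt.differentiableWithinAt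
    · rw [interior_Ioi] at hμ
      rw [(hd μ hμ).deriv]
      exact mul_nonneg (Real.rpow_nonneg (le_of_lt hμ) _) (hθ _)
  simpa using h h0 (mem_Ioi.2 one_pos) h1

lemma memLp_gradient_of_isTest {f : E3 → ℝ} (hf : IsTest f) : MemLp (gradient f) 2 volume := by
  refine (continuous_gradient hf.1).memLp_of_hasCompactSupport ?_
  refine (hf.2.fderiv (𝕜 := ℝ)).mono fun x hx h' => hx ?_
  rw [← norm_eq_zero, norm_gradient, h', norm_zero]

/-- By Hardy's inequality, `f / |x|` is square integrable. -/
lemma memLp_div_norm {f : E3 → ℝ} (hf : IsTest f) : MemLp (fun x => ‖x‖⁻¹ * f x) 2 volume := by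
  have hG := memLp_gradient_of_isTest hf
  have h := eLpNorm_hardy (hf.continuous.memLp_of_hasCompactSupport hf.2) hG
    (isWeakGradient_gradient hf.1) le_rfl
  simp only [sw_zero] at h
  exact ⟨measurable_norm.inv.aestronglyMeasurable.mul hf.continuous.aestronglyMeasurable,
    h.trans_lt (ENNReal.mul_lt_top (by simp) hG.2)⟩

lemma memLp_npow_of_isTest {p : ℝ} (hp : 3 ≤ p) {f : E3 → ℝ} (hf : IsTest f) :
    MemLp (fun x => npow p (f x)) 2 volume := by
  refine ((continuous_npow hp).comp hf.continuous).memLp_of_hasCompactSupport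
    (hf.2.comp_left ?_)
  simp [npow]

lemma integrable_weight_npow {p : ℝ} (hp : 3 ≤ p) {φ : E3 → ℝ} (hφc : Continuous φ)
    (hφ : ∀ x, 0 ≤ φ x ∧ φ x ≤ 1) {f g : E3 → ℝ} (hf : IsTest f) (hg : IsTest g) :
    Integrable fun x => φ x * (npow p (f x) * (‖x‖⁻¹ * g x)) := by
  have h : Integrable fun x => npow p (f x) * (‖x‖⁻¹ * g x) :=
    (memLp_npow_of_isTest hp hf).integrable_mul (memLp_div_norm hg)
  refine h.bdd_mul hφc.aestronglyMeasurable (c := 1) (.of_forall fun x => ?_)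
  rw [Real.norm_eq_abs, abs_of_nonneg (hφ x).1]
  exact (hφ x).2

lemma isTest_scaling {f : E3 → ℝ} (hf : IsTest f) {μ : ℝ} (hμ : μ ≠ 0) :
    IsTest fun x => μ * f (μ • x) :=
  ⟨contDiff_const.mul (hf.1.comp (contDiff_const_smul μ)),
    (hf.2.comp_homeomorph (Homeomorph.smulOfNeZero μ hμ)).mul_left⟩

/-- Change of variables for the critical scaling `f ↦ μ f (μ x)`. -/
lemma integral_weight_scaling {p : ℝ} (φ f : E3 → ℝ) {μ : ℝ} (hμ : 0 < μ) :
    ∫ x, μ ^ (p - 1) * φ (μ⁻¹ • x) * (‖x‖⁻¹ * |f x| ^ (p + 1))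
      = ∫ x, φ x * (‖x‖⁻¹ * |μ * f (μ • x)| ^ (p + 1)) := by
  have h := Measure.integral_comp_smul volume
    (fun y : E3 => φ y * (‖y‖⁻¹ * |μ * f (μ • y)| ^ (p + 1))) μ⁻¹
  have e : ∀ x : E3, φ (μ⁻¹ • x) * (‖μ⁻¹ • x‖⁻¹ * |μ * f (μ • μ⁻¹ • x)| ^ (p + 1))
      = μ ^ 3 * (μ ^ (p - 1) * φ (μ⁻¹ • x) * (‖x‖⁻¹ * |f x| ^ (p + 1))) := fun x => by
    rw [smul_inv_smul₀ hμ.ne', norm_smul, norm_inv, Real.norm_eq_abs, abs_of_pos hμ, abs_mul,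
      abs_of_pos hμ, Real.mul_rpow hμ.le (abs_nonneg _), show p + 1 = p - 1 + 2 by ring,
      Real.rpow_add hμ, mul_inv, inv_inv, Real.rpow_two]
    ring
  simp only [e] at h
  rw [integral_const_mul, finrank_euclideanSpace_fin, inv_pow, inv_inv,
    abs_of_pos (by positivity), smul_eq_mul] at h
  exact mul_left_cancel₀ (by positivity) h

/-- The difference quotients at `μ = 1` of the scaling `μ ↦ μ f(μ x)` are bounded, uniformly in `x`. -/
lemma exists_bound_scaling {f : E3 → ℝ} (hf : IsTest f) :
    ∃ B, ∀ x, ∀ μ ∈ Ioo (0 : ℝ) 1, |f x - μ * f (μ • x)| ≤ B * (1 - μ) := by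
  have hd : Differentiable ℝ f := hf.1.differentiable (by simp)
  have hc : Continuous fun x => f x + fderiv ℝ f x x :=
    hf.continuous.add ((hf.1.continuous_fderiv (by simp)).clm_apply continuous_id)
  have hcs : HasCompactSupport fun x => f x + fderiv ℝ f x x := by
    refine HasCompactSupport.add hf.2 ((hf.2.fderiv (𝕜 := ℝ)).mono fun x hx h' => hx ?_)
    simp only [h', zero_apply]
  obtain ⟨B, hB⟩ := hcs.exists_bound_of_continuous hc
  refine ⟨B, fun x μ hμ => ?_⟩
  have hg : ∀ s : ℝ, HasDerivAt (fun s => s * f (s • x)) (f (s • x) + fderiv ℝ f (s • x) (s • x)) s :=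
    fun s => by
      refine ((hasDerivAt_id s).mul (hasDerivAt_comp_smul (x := x) (hd _) (hasDerivAt_id s))).congr_deriv ?_
      simp
  have h := (convex_univ (𝕜 := ℝ) (E := ℝ)).norm_image_sub_le_of_norm_hasDerivWithin_le
    (f := fun s => s * f (s • x)) (fun s _ => (hg s).hasDerivWithinAt) (fun s _ => hB (s • x))
    (mem_univ μ) (mem_univ 1)
  simpa [abs_of_pos (sub_pos.2 hμ.2)] using h

/-- The weight identity for test functions. In place of an integration by parts, which would require
`∇φ` to be locally integrable, the functional `∫ φ |f| ^ (p + 1) / |x|` is compared at `f` and at the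
rescaled function `μ f (μ x)`, and `μ` tends to `1`. -/
lemma lintegral_weight_le_of_isTest {φ : E3 → ℝ} (hφd : Differentiable ℝ φ)
    (hφ : ∀ x, 0 ≤ φ x ∧ φ x ≤ 1) {p : ℝ} (hp : 3 ≤ p)
    (hθ : ∀ x, 0 ≤ (p - 1) * φ x - inner ℝ x (gradient φ x)) {f : E3 → ℝ} (hf : IsTest f) :
    0 ≤ (p + 1) * (∫ x, φ x * (npow p (f x) * mop 0 f (gradient f) x)) ∧
    ∫⁻ x, ENNReal.ofReal (((p - 1) * φ x - inner ℝ x (gradient φ x)) / ‖x‖ * |f x| ^ (p + 1))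
      ≤ ENNReal.ofReal ((p + 1) * ∫ x, φ x * (npow p (f x) * mop 0 f (gradient f) x)) := by
  have hφc := hφd.continuous
  have hfd : Differentiable ℝ f := hf.1.differentiable (by simp)
  -- a sequence in `(0, 1)` which tends to `1`; the offset `2` keeps it positive at `n = 0`
  set μ : ℕ → ℝ := fun n => 1 - 1 / ((n : ℝ) + 2) with hμd
  have hμ : ∀ n, μ n ∈ Ioo (0 : ℝ) 1 := fun n => by
    have h1 : 1 / ((n : ℝ) + 2) ≤ 1 / 2 := one_div_le_one_div_of_le (by norm_num) (by simp)
    have h2 : 0 < 1 / ((n : ℝ) + 2) := by positivity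
    exact ⟨by simp only [hμd]; linarith, by simp only [hμd]; linarith⟩
  have hlim : Tendsto μ atTop (𝓝[≠] 1) := by
    refine tendsto_nhdsWithin_iff.2 ⟨?_, .of_forall fun n => (hμ n).2.ne⟩
    have h1 := (tendsto_add_atTop_iff_nat 1).2 (tendsto_one_div_add_atTop_nhds_zero_nat (𝕜 := ℝ))
    have h2 := h1.const_sub 1
    rw [sub_zero] at h2
    refine h2.congr fun n => ?_
    simp only [hμd]; push_cast; ring
  obtain ⟨B, hB⟩ := exists_bound_scaling hf
  have ht := fun n => isTest_scaling hf (hμ n).1.ne'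
  -- integrability
  have iA : Integrable fun x => φ x * (‖x‖⁻¹ * |f x| ^ (p + 1)) := by
    refine (integrable_weight_npow hp hφc hφ hf hf).congr (.of_forall fun x => ?_)
    simp only [← npow_mul_self hp]; ring
  have iB : ∀ n, Integrable fun x => φ x * (‖x‖⁻¹ * |μ n * f (μ n • x)| ^ (p + 1)) := fun n => by
    refine (integrable_weight_npow hp hφc hφ (ht n) (ht n)).congr (.of_forall fun x => ?_)
    simp only [← npow_mul_self hp]; ring
  have iC : ∀ n, Integrable fun x =>
      μ n ^ (p - 1) * φ ((μ n)⁻¹ • x) * (‖x‖⁻¹ * |f x| ^ (p + 1)) := fun n => by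
    have h := (integrable_weight_npow hp (φ := fun x => φ ((μ n)⁻¹ • x))
      (hφc.comp (continuous_const_smul _)) (fun x => hφ _) hf hf).const_mul (μ n ^ (p - 1))
    refine h.congr (.of_forall fun x => ?_)
    simp only [← npow_mul_self hp]; ring
  have iD : ∀ n, Integrable fun x =>
      φ x * (npow p (f x) * (‖x‖⁻¹ * ((1 - μ n)⁻¹ * (f x - μ n * f (μ n • x))))) := fun n => by
    have h := ((integrable_weight_npow hp hφc hφ hf hf).sub
      (integrable_weight_npow hp hφc hφ hf (ht n))).const_mul (1 - μ n)⁻¹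
    refine h.congr (.of_forall fun x => ?_)
    simp only [Pi.sub_apply]; ring
  refine lintegral_ofReal_le_of_tendsto
    (f := fun n x => (1 - μ n)⁻¹ * (φ x * (‖x‖⁻¹ * |f x| ^ (p + 1))
      - μ n ^ (p - 1) * φ ((μ n)⁻¹ • x) * (‖x‖⁻¹ * |f x| ^ (p + 1))))
    (a := fun n => (p + 1) * ∫ x,
      φ x * (npow p (f x) * (‖x‖⁻¹ * ((1 - μ n)⁻¹ * (f x - μ n * f (μ n • x))))))
    (fun n => (iA.sub (iC n)).const_mul _) (fun n => .of_forall fun x => ?_)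
    (.of_forall fun x => ?_) (fun n => ?_) ?_
  · have h1 := weight_scaling_le hφd hθ x (hμ n).1 (hμ n).2.le
    have h2 : 0 ≤ ‖x‖⁻¹ * |f x| ^ (p + 1) :=
      mul_nonneg (by positivity) (Real.rpow_nonneg (abs_nonneg _) _)
    change 0 ≤ (1 - μ n)⁻¹ * (φ x * _ - μ n ^ (p - 1) * φ ((μ n)⁻¹ • x) * _)
    rw [← sub_mul]
    exact mul_nonneg (inv_nonneg.2 (sub_nonneg.2 (hμ n).2.le)) (mul_nonneg (sub_nonneg.2 h1) h2)
  -- the integrand converges to the weighted density, by differentiation at `μ = 1`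
  · have h1 := (hasDerivAt_weight_scaling hφd p x one_pos).tendsto_slope.comp hlim
    have h2 := h1.mul_const (‖x‖⁻¹ * |f x| ^ (p + 1))
    simp only [inv_one, one_smul, Real.one_rpow, one_mul] at h2
    rw [div_mul_eq_mul_div₀, mul_div_assoc, div_eq_inv_mul (|f x| ^ (p + 1))]
    refine h2.congr fun n => ?_
    rw [Function.comp, slope_def_field]
    simp only [inv_one, one_smul, Real.one_rpow, one_mul]
    rw [div_eq_inv_mul, ← neg_sub 1 (μ n), inv_neg]
    ring
  -- change of variables, and the tangent line inequality
  · rw [integral_const_mul, integral_sub iA (iC n), integral_weight_scaling φ f (hμ n).1,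
      ← integral_sub iA (iB n), ← integral_const_mul, ← integral_const_mul]
    refine integral_mono ((iA.sub (iB n)).const_mul _) ((iD n).const_mul _) fun x => ?_
    have h1 := rpow_sub_rpow_le hp (f x) (μ n * f (μ n • x))
    have h2 : 0 ≤ (1 - μ n)⁻¹ * (φ x * ‖x‖⁻¹) :=
      mul_nonneg (inv_nonneg.2 (sub_nonneg.2 (hμ n).2.le)) (mul_nonneg (hφ x).1 (by positivity))
    have h3 := mul_le_mul_of_nonneg_left h1 h2
    linarith
  -- the upper bound converges, as `(f - μ f(μ x)) / (1 - μ)` tends to `f + x · ∇f`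
  · refine Tendsto.const_mul _ ?_
    refine tendsto_integral_of_dominated_convergence
      (fun x => B * |φ x * (|f x| ^ (p - 1) * (‖x‖⁻¹ * f x))|) (fun n => (iD n).1) ?_
      (fun n => .of_forall fun x => ?_) (.of_forall fun x => ?_)
    · have h1 : MemLp (fun x => |f x| ^ (p - 1)) 2 volume := by
        refine (hf.continuous.abs.rpow_const fun _ => .inr (by linarith)).memLp_of_hasCompactSupport
          (hf.2.comp_left (g := fun a : ℝ => |a| ^ (p - 1)) ?_)
        simp [Real.zero_rpow (by linarith : p - 1 ≠ 0)]
      have h2 : Integrable fun x => |f x| ^ (p - 1) * (‖x‖⁻¹ * f x) :=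
        h1.integrable_mul (memLp_div_norm hf)
      refine (h2.bdd_mul hφc.aestronglyMeasurable (c := 1)
        (.of_forall fun x => ?_)).abs.const_mul B
      rw [Real.norm_eq_abs, abs_of_nonneg (hφ x).1]
      exact (hφ x).2
    · have h1 : |(1 - μ n)⁻¹ * (f x - μ n * f (μ n • x))| ≤ B := by
        have h3 := sub_pos.2 (hμ n).2
        rw [abs_mul, abs_of_pos (inv_pos.2 h3), inv_mul_le_iff₀ h3, mul_comm _ B]
        exact hB x _ (hμ n)
      have h2 : 0 ≤ |φ x * (|f x| ^ (p - 1) * (‖x‖⁻¹ * f x))| := abs_nonneg _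
      refine le_trans (le_of_eq ?_) (mul_le_mul_of_nonneg_right h1 h2)
      rw [Real.norm_eq_abs, npow]
      simp only [abs_mul]
      ring
    · have h1 : HasDerivAt (fun s : ℝ => s * f (s • x)) (f x + fderiv ℝ f x x) 1 := by
        refine ((hasDerivAt_id (1 : ℝ)).mul
          (hasDerivAt_comp_smul (x := x) (hfd _) (hasDerivAt_id (1 : ℝ)))).congr_deriv ?_
        simp
      have h2 := h1.tendsto_slope.comp hlim
      have h3 : mop 0 f (gradient f) x = ‖x‖⁻¹ * (f x + fderiv ℝ f x x) := by
        rw [mop, sw_zero, inner_gradient_eq_fderiv]; ring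
      rw [h3]
      refine ((((h2.congr fun n => ?_).const_mul _).const_mul _).const_mul _)
      rw [Function.comp, slope_def_field, one_smul, one_mul, div_eq_inv_mul, ← neg_sub 1 (μ n),
        inv_neg]
      ring

/-- The weighted density is controlled by the interaction of the nonlinearity with the Morawetz
multiplier. -/
lemma lintegral_weight_le {φ : E3 → ℝ} (hφd : Differentiable ℝ φ)
    (hφ : ∀ x, 0 ≤ φ x ∧ φ x ≤ 1) {p : ℝ} (hp : 3 ≤ p)
    (hθ : ∀ x, 0 ≤ (p - 1) * φ x - inner ℝ x (gradient φ x)) {f : E3 → ℝ} (hf : MemHDot1 f)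
    (hf2 : MemLp f (ENNReal.ofReal (2 * p)) volume) :
    0 ≤ (p + 1) * (∫ x, φ x * npow p (f x) * mop 0 f (weakGrad f) x) ∧
    ∫⁻ x, ENNReal.ofReal (((p - 1) * φ x - inner ℝ x (gradient φ x)) / ‖x‖ * |f x| ^ (p + 1))
      ≤ ENNReal.ofReal ((p + 1) * ∫ x, φ x * npow p (f x) * mop 0 f (weakGrad f) x) := by
  have hp0 : 0 < p := by linarith
  have h2 : ENNReal.ofReal (2 * p / p) = 2 := by
    rw [mul_div_cancel_right₀ _ hp0.ne']; norm_num
  have hp2 : p ≤ 2 * p := by linarith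
  obtain ⟨u, hu, hq, hg, hae⟩ := exists_isTest_tendsto hf.1 hf.weakGrad.1 hf.weakGrad.2
  have h6 : ∀ n, MemLp (u n) 6 volume := fun n =>
    (hu n).continuous.memLp_of_hasCompactSupport (hu n).2
  have b2 : ∀ g : E3 → ℝ, eLpNorm (fun x => φ x * g x) 2 volume ≤ eLpNorm g 2 volume := fun g => by
    have := eLpNorm_weight_mul_le hφ 1 g 2
    simpa using this
  have lN := tendsto_eLpNorm_npow_sub hp hp2 (fun n => (hu n).continuous.aestronglyMeasurable) hf2
    (hq _ (by rw [ENNReal.one_le_ofReal]; linarith) ENNReal.ofReal_ne_top hf2)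
  rw [h2] at lN
  have mN : MemLp (fun x => npow p (f x)) 2 volume := by
    refine ⟨(continuous_npow hp).comp_aestronglyMeasurable hf2.1, ?_⟩
    have := eLpNorm_npow hp hp2 f
    rw [h2] at this
    rw [this]
    exact ENNReal.rpow_lt_top_of_nonneg hp0.le hf2.2.ne
  have mφ : ∀ {g : E3 → ℝ}, MemLp g 2 volume → MemLp (fun x => φ x * g x) 2 volume := fun hg =>
    ⟨hφd.continuous.aestronglyMeasurable.mul hg.1, (b2 _).trans_lt hg.2⟩
  have lM := tendsto_mop hf.1 hf.weakGrad.1 hf.weakGrad.2 (δ := fun _ => 0) (fun _ => le_rfl)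
    tendsto_const_nhds h6 (fun n => memLp_gradient_of_isTest (hu n))
    (fun n => isWeakGradient_gradient (hu n).1) hg
  have lim := tendsto_integral_mul (mφ mN) (memLp_mop hf.1 hf.weakGrad.1 hf.weakGrad.2 le_rfl)
    (fun n => mφ (memLp_npow_of_isTest hp (hu n)))
    (fun n => memLp_mop (h6 n) (memLp_gradient_of_isTest (hu n))
      (isWeakGradient_gradient (hu n).1) le_rfl)
    (tendsto_of_tendsto_of_tendsto_of_le_of_le tendsto_const_nhds lN (fun _ => bot_le) fun n => by
      refine le_trans (le_of_eq ?_) (b2 _)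
      congr 1; ext x
      simp only [Pi.sub_apply]; ring) lM
  have hΘ : Measurable fun x => ((p - 1) * φ x - inner ℝ x (gradient φ x)) / ‖x‖ := by
    have h1 : ∀ j, Measurable fun x => pd j φ x := fun j => measurable_fderiv_apply_const ℝ φ _
    have h2 : ∀ j, Measurable fun x : E3 => x j := fun j => Continuous.measurable (by fun_prop)
    simp only [inner_eq_sum, gradient_apply]
    exact ((hφd.continuous.measurable.const_mul _).sub ((((h2 0).mul (h1 0)).add
      ((h2 1).mul (h1 1))).add ((h2 2).mul (h1 2)))).div measurable_norm
  have cP : Continuous fun a : ℝ => |a| ^ (p + 1) := continuous_abs.rpow_const fun _ => .inr (by linarith)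
  have key : ∀ n, 0 ≤ (p + 1) * (∫ x, φ x * npow p (u n x) * mop 0 (u n) (gradient (u n)) x) ∧
      ∫⁻ x, ENNReal.ofReal (((p - 1) * φ x - inner ℝ x (gradient φ x)) / ‖x‖ * |u n x| ^ (p + 1))
        ≤ ENNReal.ofReal ((p + 1) * ∫ x, φ x * npow p (u n x)
          * mop 0 (u n) (gradient (u n)) x) := fun n => by
    simpa only [mul_assoc] using lintegral_weight_le_of_isTest hφd hφ hp hθ (hu n)
  refine ⟨ge_of_tendsto' (lim.const_mul _) fun n => (key n).1, ?_⟩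
  calc _ = ∫⁻ x, liminf (fun n => ENNReal.ofReal (((p - 1) * φ x - inner ℝ x (gradient φ x)) / ‖x‖
          * |u n x| ^ (p + 1))) atTop := by
        refine lintegral_congr_ae ?_
        filter_upwards [hae] with x hx
        exact ((ENNReal.continuous_ofReal.tendsto _).comp
          (((cP.tendsto _).comp hx).const_mul _)).liminf_eq.symm
    _ ≤ liminf (fun n => ∫⁻ x, ENNReal.ofReal (((p - 1) * φ x - inner ℝ x (gradient φ x)) / ‖x‖
          * |u n x| ^ (p + 1))) atTop := lintegral_liminf_le fun n =>
        (hΘ.mul (cP.comp (hu n).continuous).measurable).ennreal_ofReal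
    _ ≤ liminf (fun n => ENNReal.ofReal ((p + 1) * ∫ x, φ x * npow p (u n x)
          * mop 0 (u n) (gradient (u n)) x)) atTop :=
        liminf_le_liminf (.of_forall fun n => (key n).2)
    _ = _ := ((ENNReal.continuous_ofReal.tendsto _).comp (lim.const_mul _)).liminf_eq

/-! ### The space-time estimate -/

namespace IsSolution

variable {φ : E3 → ℝ} {κ p t₀ : ℝ} {I : Set ℝ} {v₀ v₁ : E3 → ℝ} {v w : ℝ → E3 → ℝ} {t₁ : ℝ}

/-- The estimate on a compact time interval, with `48 = 6 · 8`. -/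
lemma lintegral_morawetz_le (h : IsSolution φ κ p t₀ I v₀ v₁ v w) (hp3 : 3 ≤ p) (hp5 : p < 5)
    (hκ : 0 ≤ κ) (hφd : Differentiable ℝ φ) (hφ : ∀ x, 0 ≤ φ x ∧ φ x ≤ 1)
    (hθ : ∀ x, 0 ≤ (p - 1) * φ x - inner ℝ x (gradient φ x)) (h01 : t₀ < t₁)
    (hI : Icc t₀ t₁ ⊆ I) :
    ∫⁻ t in Icc t₀ t₁, ∫⁻ x : E3, ENNReal.ofReal (Real.exp (-κ * t) *
      (((p - 1) * φ x - inner ℝ x (gradient φ x)) / ‖x‖) * |v t x| ^ (p + 1))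
      ≤ 48 * energy φ κ p t₀ (v t₀) (w t₀) := by
  set c := clampTime t₀ t₁ with hc
  set N : ℝ → ℝ := fun t => ∫ x, nonlinearity φ κ p v (c t) x
        * mop 0 (v (c t)) (weakGrad (v (c t))) x with hN
  have hLi := ((h.isLinearSolution hp3 hp5 hκ hφd.continuous hφ h01 hI).morawetz h01.le).1
  have hE := h.neg_integral_mop_le hp3 hp5 hκ hφd.continuous hφ h01 hI
  have key : ∀ᵐ t ∂volume.restrict (Icc t₀ t₁), 0 ≤ (p + 1) * -N t ∧
      ∫⁻ x : E3, ENNReal.ofReal (Real.exp (-κ * t) *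
      (((p - 1) * φ x - inner ℝ x (gradient φ x)) / ‖x‖) * |v t x| ^ (p + 1))
        ≤ ENNReal.ofReal ((p + 1) * -N t) := by
    filter_upwards [h.ae_memLp hp3 hp5 h01.le hI, ae_restrict_mem measurableSet_Icc] with t ht hmem
    rw [← hc, hc, clampTime_eq hmem] at ht
    obtain ⟨k1, k2⟩ := lintegral_weight_le hφd hφ hp3 hθ (h.mem_hDot1 _ (hI hmem)) ht
    have e : (p + 1) * -N t = Real.exp (-κ * t) * ((p + 1) * ∫ x, φ x * npow p (v t x)
        * mop 0 (v t) (weakGrad (v t)) x) := by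
      rw [mul_left_comm, ← integral_const_mul, ← integral_neg]
      congr 1
      refine integral_congr_ae (.of_forall fun x => ?_)
      simp only [hc, clampTime_eq hmem, nonlinearity_eq]
      ring
    rw [e]
    refine ⟨mul_nonneg (Real.exp_pos _).le k1, ?_⟩
    simp only [mul_assoc (Real.exp _), ENNReal.ofReal_mul (Real.exp_pos _).le]
    rw [lintegral_const_mul' _ _ ENNReal.ofReal_ne_top]
    exact mul_le_mul' le_rfl k2
  calc _ ≤ ∫⁻ t in Icc t₀ t₁, ENNReal.ofReal ((p + 1) * -N t) :=
        lintegral_mono_ae (key.mono fun t ht => ht.2)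
    _ = ENNReal.ofReal ((p + 1) * -∫ t in Icc t₀ t₁, N t) := by
        rw [← integral_neg, ← integral_const_mul]
        exact (ofReal_integral_eq_lintegral_ofReal (hLi.neg.const_mul _)
          (key.mono fun t ht => ht.1)).symm
    _ ≤ 6 * (8 * energy φ κ p t₀ (v t₀) (w t₀)) := by
        rw [ENNReal.ofReal_mul (by linarith)]
        -- `p + 1 ≤ 6`
        refine mul_le_mul' ?_ hE
        rw [show (6 : ℝ≥0∞) = ENNReal.ofReal 6 by norm_num]
        exact ENNReal.ofReal_le_ofReal (by linarith)
    _ = 48 * energy φ κ p t₀ (v t₀) (w t₀) := by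
        rw [← mul_assoc]; norm_num

end IsSolution

lemma Icc_subset_forwardInterval {t₀ t₁ : ℝ} {T : ℝ≥0∞} (h : t₁ ∈ forwardInterval t₀ T) :
    Icc t₀ t₁ ⊆ forwardInterval t₀ T := fun _ ht =>
  ⟨ht.1, (ENNReal.ofReal_le_ofReal (by linarith [ht.2])).trans_lt h.2⟩

/-- A forward interval of positive length is exhausted by compact intervals. -/
lemma exists_monotone_Icc_cover {t₀ : ℝ} {T : ℝ≥0∞} (hT : 0 < T) :
    ∃ s : ℕ → ℝ, Monotone s ∧ (∀ n, t₀ < s n ∧ s n ∈ forwardInterval t₀ T) ∧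
      forwardInterval t₀ T ⊆ ⋃ n, Icc t₀ (s n) := by
  obtain ⟨b, b1, b2, b3⟩ := exists_seq_strictMono_tendsto' hT
  have hbt : ∀ n, b n ≠ ⊤ := fun n => (b2 n).2.ne_top
  refine ⟨fun n => t₀ + (b n).toReal, fun m n hmn => ?_, fun n => ⟨?_, ?_, ?_⟩, fun t ht => ?_⟩
  · have := ENNReal.toReal_mono (hbt n) (b1.monotone hmn)
    simpa using this
  · have := ENNReal.toReal_pos (b2 n).1.ne' (hbt n)
    linarith
  · simp
  · rw [add_sub_cancel_left, ENNReal.ofReal_toReal (hbt n)]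
    exact (b2 n).2
  · obtain ⟨n, hn⟩ := (b3.eventually_const_lt ht.2).exists
    refine mem_iUnion.2 ⟨n, ht.1, ?_⟩
    have := (ENNReal.ofReal_le_iff_le_toReal (hbt n)).1 hn.le
    linarith

end

end WaveMorawetz

theorem mainTheorem4 :
    ∃ C : ℝ≥0, ∀ (p κ t₀ : ℝ) (T : ℝ≥0∞) (φ : WaveMorawetz.E3 → ℝ)
      (v₀ v₁ : WaveMorawetz.E3 → ℝ) (v w : ℝ → WaveMorawetz.E3 → ℝ),
      3 ≤ p → p < 5 → 0 ≤ κ → 0 < T →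
      Differentiable ℝ φ →
      (∀ x, 0 ≤ φ x ∧ φ x ≤ 1) →
      (∀ x, 0 ≤ (p - 1) * φ x - inner ℝ x (gradient φ x)) →
      WaveMorawetz.IsSolution φ κ p t₀ (WaveMorawetz.forwardInterval t₀ T) v₀ v₁ v w →
      WaveMorawetz.energy φ κ p t₀ (v t₀) (w t₀) < ⊤ →
      ∫⁻ t in WaveMorawetz.forwardInterval t₀ T, ∫⁻ x : WaveMorawetz.E3,
          ENNReal.ofReal (Real.exp (-κ * t) *
            (((p - 1) * φ x - inner ℝ x (gradient φ x)) / ‖x‖) * |v t x| ^ (p + 1))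
        ≤ (C : ℝ≥0∞) * WaveMorawetz.energy φ κ p t₀ (v t₀) (w t₀) := by
  refine ⟨48, fun p κ t₀ T φ v₀ v₁ v w hp3 hp5 hκ hT hφd hφ hθ h _ => ?_⟩
  obtain ⟨s, hs, hs', hsub⟩ := WaveMorawetz.exists_monotone_Icc_cover (t₀ := t₀) hT
  refine (lintegral_mono_set hsub).trans ?_
  rw [setLIntegral_iUnion_of_directed _
    (directed_of_isDirected_le fun m n hmn => Icc_subset_Icc_right (hs hmn))]
  exact iSup_le fun n => h.lintegral_morawetz_le hp3 hp5 hκ hφd hφ hθ (hs' n).1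
    (WaveMorawetz.Icc_subset_forwardInterval (hs' n).2)
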